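/- **Setting.** Let $n\ge 1$ and order $\mathbb Z^n$ right-lexicographically ($a<b$ iff for some $i$, $a_i<b_i$ and $a_j=b_j$ for all $j>i$). For $0\le k\le n$ let $\mathbb Z^k\subset\mathbb Z^n$ be the convex subgroup of vectors whose coordinates after the $k$-th vanish, let $e_{k+1}$ (for $k<n$) be the $(k+1)$-st unit vector, and write $1=e_1$ for the least positive element. *The space $\overline\Gamma$.* Let $(\Gamma,d)$ be a $\mathbb Z^n$-tree (a non-empty geodesically linear $\mathbb Z^n$-metric space such that $[x,y]\cap[x,z]=[x,w]$ for some $w$, and $[x,y]\cup[y,z]=[x,z]$ whenever $[x,y]\cap[y,z]=\{y\}$). A $\mathbb Z^k$-subtree is a class of the relation $d(v,w)\in\mathbb Z^k$. For $1\le k\le n$, $\partial_k\Gamma$ is the set of isometries $\gamma:[0,\infty)_{\mathbb Z^k}\to\Gamma$ modulo having a common tail. The $\mathbb Z^m$-subtrees of a $\mathbb Z^{m+1}$-subtree $T$ ($1\le m<n$) are the vertices of a simplicial tree, the distance of two of them being the $(m+1)$-st coordinate of the distance of any two of their points; two of them are adjacent if this distance is $1$. If $S,S'$ are adjacent and $x\in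 S$, $y\in S'$, then the segment $[x,y]$ is cut into two $\mathbb Z^m$-rays, one in $S$ from $x$ and one in $S'$ from $y$; their two ends are called the pair of ends of the edge between $S$ and $S'$. Put $\overline\Gamma=\Gamma\cup\bigl(\bigcup_{k=1}^n\partial_k\Gamma\bigr)/\!\sim$, where $\sim$ identifies, for all $1\le m<n$ and all adjacent $S,S'$, the two ends of such a pair. For a $\mathbb Z^m$-subtree $S$ let $\overline S\subset\overline\Gamma$ consist of the points of $S$ and the ends of types $\mathbb Z^1,\dots,\mathbb Z^m$ of $S$. *The metric.* Choose a base point in each $\mathbb Z$-subtree and, for each $1\le m<n$ and each $\mathbb Z^{m+1}$-subtree $T$, a $\mathbb Z^m$-subtree $T_0\subset T$ and, for every $k$, an injective numbering by natural numbers of the $\mathbb Z^m$-subtrees of $T$ of level $k$, i.e. at distance $k$ from $T_0$. (Such choices exist iff each of these levels is countable.) Define $d_{\overline T}$ for $\mathbb Z^m$-subtrees $T$ by induction on $m$. If $m=1$ and $w$ is the base point of $T$, then $d_{\overline T}(x,y)=e^{-(x\cdot y)_w}$ for $x\ne y$ and $d_{\overline T}(x,x)=0$, where $(x\cdot y)_w=\frac12(d(x,w)+d(y,w)-d(x,y))$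 for points, and the Gromov product is extended to ends by limits along the rays from $w$. If $T$ is a $\mathbb Z^{m+1}$-subtree, rescale $d_{\overline S}$, for each $\mathbb Z^m$-subtree $S\subset T$ of level $k\ge1$ and number $j$, by $2^{-(k+j)}$ (the metric of $\overline{T_0}$ is unchanged). For $x\neq y$ in $\overline T$ let $(S_i)_{i\in I}$ ($I$ an interval in $\mathbb Z$) be the $\mathbb Z^m$-subtrees along the geodesic from $x$ to $y$: the sequence starts with some $S_i$ such that $x\in\overline{S_i}$, or, if $x\in\partial_{m+1}T$, it is infinite to the left and converges to $x$; likewise for $y$ on the right. Then $d_{\overline T}(x,y)$ is the sum over $i\in I$ of the rescaled distances in $\overline{S_i}$ between $a_i$ and $a_{i+1}$, where $\{a_{i+1}\}=\overline{S_i}\cap\overline{S_{i+1}}$ and, at the finite ends of the sequence, the missing point is $x$ or $y$; and $d_{\overline T}(x,x)=0$. Put $d_{\overline\Gamma}=d_{\overline T}$ for the unique $\mathbb Z^n$-subtree $T=\Gamma$. *The tree $\Gamma_G$.* Let $X$ be a set. A $\mathbb Z^n$-word is a function $w:[1,|w|]\to X^{\pm}$ with $0\le|w|\in\mathbb Z^n$;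 it is reduced if $w(\beta+1)\ne w(\beta)^{-1}$ for $1\le\beta<|w|$. Concatenation and inversion are defined as usual, and $u\circ v$ denotes a reduced concatenation. The longest common initial segment of $u$ and $v$, if it exists, is the word $c=\mathrm{com}(u,v)$ with $u=c\circ\tilde u$, $v=c\circ\tilde v$ such that $\tilde u,\tilde v$ do not begin with the same letter. Let $u*v=\tilde u^{-1}\circ\tilde v$ where $u^{-1}=\mathrm{com}(u^{-1},v)\circ\tilde u$, $v=\mathrm{com}(u^{-1},v)\circ\tilde v$ (a partial operation). $CDR(\mathbb Z^n,X)$ is the set of reduced words of the form $c^{-1}\circ u\circ c$ with $u$ cyclically reduced. A $\mathbb Z^n$-free group is here a group $G\subset CDR(\mathbb Z^n,X)$, for some $X$, with multiplication $*$ (defined on all of $G\times G$) and with inversion of words. Put $c(f,g)=|\mathrm{com}(f,g)|$. The universal tree is $\Gamma_G=\{(\alpha,g): g\in G,\ \alpha\in[0,|g|]\}/\!\sim$, where $(\alpha,f)\sim(\beta,g)$ iff $\alpha=\beta\in[0,c(f,g)]$, with the distance $d(\langle\alpha,f\rangle,\langle\beta,g\rangle)=\alpha+\beta-2\min\{\alpha,\beta,c(f,g)\}$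 and the action $h\cdot\langle\alpha,g\rangle=\langle|h|-\alpha,h\rangle$ if $\alpha\le c(h^{-1},g)$, and $h\cdot\langle\alpha,g\rangle=\langle|h|+\alpha-2c(h^{-1},g),h*g\rangle$ otherwise. **Theorem.** 1. Let $\Gamma$ be a $\mathbb Z^n$-tree all of whose $\mathbb Z$-subtrees are locally finite. Then, for all choices as above, $d_{\overline\Gamma}$ is a metric on $\overline\Gamma$, and $\overline\Gamma$ is compact in the induced topology. 2. Let $G\subset CDR(\mathbb Z^n,X)$ be a finitely generated non-abelian $\mathbb Z^n$-free group. Then choices as above exist for $\Gamma_G$, and for all of them $(\overline\Gamma_G,d_{\overline\Gamma_G})$ is a compact metric space. The action of $G$ on $\Gamma_G$ extends to an action of $G$ on $\overline\Gamma_G$ such that $g$ sends the end of a ray $\gamma$ to the end of the ray $g\circ\gamma$. This action has no global fixed point, the orbit of every point of $\overline\Gamma_G$ is infinite, and every $g\in G$ acts continuously with respect to $d_{\overline\Gamma_G}$ (for all choices). -/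

import Mathlib

open Filter Topology

namespace ZnFree

/-! ### The ordered group `ℤⁿ` (right lexicographic order) -/

/-- The abelian group `ℤⁿ`. Coordinates are numbered from `0`. -/
def ZVec (n : ℕ) : Type := Fin n → ℤ

instance (n : ℕ) : AddCommGroup (ZVec n) := inferInstanceAs (AddCommGroup (Fin n → ℤ))

/-- The right lexicographic order on `ℤⁿ`: `a < b` iff for some `i` one has `a i < b i` and
`a j = b j` for all `j > i`. -/
noncomputable instance (n : ℕ) : LinearOrder (ZVec n) :=
  inferInstanceAs (LinearOrder (Lex ((Fin n)ᵒᵈ → ℤ)))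

theorem ZVec.lt_def {n : ℕ} (a b : ZVec n) :
    a < b ↔ ∃ i : Fin n, (∀ j, i < j → a j = b j) ∧ a i < b i := Iff.rfl

theorem ZVec.add_apply {n : ℕ} (a b : ZVec n) (i : Fin n) : (a + b) i = a i + b i := rfl

theorem ZVec.neg_apply {n : ℕ} (a : ZVec n) (i : Fin n) : (-a) i = -a i := rfl

theorem ZVec.zero_apply {n : ℕ} (i : Fin n) : (0 : ZVec n) i = 0 := rfl

instance (n : ℕ) : IsOrderedAddMonoid (ZVec n) where
  add_le_add_left a b h c := by
    rcases h.eq_or_lt with rfl | h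
    · exact le_rfl
    · obtain ⟨i, h1, h2⟩ := (ZVec.lt_def a b).1 h
      refine le_of_lt ((ZVec.lt_def _ _).2 ⟨i, fun j hj => ?_, ?_⟩)
      · exact congrArg (· + c j) (h1 j hj)
      · exact add_lt_add_left h2 (c i)

/-- The coordinate vector of `ℤⁿ` with a one in coordinate `k`. The vector `e n 0` is the least
positive element, written `1` in the theory of infinite words. -/
def e (n k : ℕ) : ZVec n := fun i => if i.val = k then 1 else 0

/-- The coordinate with number `k` of an element of `ℤⁿ` (zero if there is no such coordinate). -/
def coord {n : ℕ} (a : ZVec n) (k : ℕ) : ℤ := if h : k < n then a ⟨k, h⟩ else 0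

/-- The convex subgroup `ℤᵏ` of `ℤⁿ`: only the first `k` coordinates may be non-zero. -/
def convexSub (n k : ℕ) : AddSubgroup (ZVec n) where
  carrier := {a | ∀ i : Fin n, k ≤ i.val → a i = 0}
  zero_mem' := fun _ _ => rfl
  add_mem' := by
    intro a b ha hb i hi
    rw [ZVec.add_apply, ha i hi, hb i hi, add_zero]
  neg_mem' := by
    intro a ha i hi
    rw [ZVec.neg_apply, ha i hi, neg_zero]

/-- The half-line `[0, ∞)` of `ℤᵏ`, inside `ℤⁿ`. -/
def cone (n k : ℕ) : AddSubmonoid (ZVec n) where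
  carrier := {a | a ∈ convexSub n k ∧ 0 ≤ a}
  zero_mem' := ⟨(convexSub n k).zero_mem, le_rfl⟩
  add_mem' := fun ha hb => ⟨(convexSub n k).add_mem ha.1 hb.1, add_nonneg ha.2 hb.2⟩

theorem e_nonneg (n : ℕ) : 0 ≤ e n 0 := by
  rcases Nat.eq_zero_or_pos n with rfl | hn
  · exact le_of_eq (funext fun i => i.elim0)
  · refine le_of_lt ((ZVec.lt_def _ _).2 ⟨⟨0, hn⟩, fun j hj => ?_, ?_⟩)
    · have : j.val ≠ 0 := by
        have : 0 < j.val := hj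
        omega
      simp [e, this, ZVec.zero_apply]
    · simp [e, ZVec.zero_apply]

theorem e_le_of_pos {n : ℕ} {a : ZVec n} (ha : 0 < a) : e n 0 ≤ a := by
  obtain ⟨i, h1, h2⟩ := (ZVec.lt_def _ _).1 ha
  have h2' : (0 : ℤ) < a i := h2
  by_cases hi : i.val = 0
  · by_cases h3 : a i = 1
    · refine le_of_eq (funext fun j => ?_)
      by_cases hj : j = i
      · subst hj
        have : e n 0 j = 1 := by simp [e, hi]
        rw [this, h3]
      · have hlt : i < j := by
          have : j.val ≠ i.val := fun h => hj (Fin.ext h)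
          exact Fin.lt_def.2 (by omega)
        have hj0 : j.val ≠ 0 := by
          have := Fin.lt_def.1 hlt
          omega
        have : e n 0 j = 0 := by simp [e, hj0]
        rw [this]
        exact h1 j hlt
    · refine le_of_lt ((ZVec.lt_def _ _).2 ⟨i, fun j hlt => ?_, ?_⟩)
      · have hj0 : j.val ≠ 0 := by
          have := Fin.lt_def.1 hlt
          omega
        have : e n 0 j = 0 := by simp [e, hj0]
        rw [this]
        exact h1 j hlt
      · have : e n 0 i = 1 := by simp [e, hi]
        rw [this]
        omega
  · refine le_of_lt ((ZVec.lt_def _ _).2 ⟨i, fun j hlt => ?_, ?_⟩)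
    · have hj0 : j.val ≠ 0 := by
        have := Fin.lt_def.1 hlt
        omega
      have : e n 0 j = 0 := by simp [e, hj0]
      rw [this]
      exact h1 j hlt
    · have : e n 0 i = 0 := by simp [e, hi]
      rw [this]
      exact h2'

theorem e_pos_of_pos {n : ℕ} {a : ZVec n} (ha : 0 < a) : 0 < e n 0 := by
  refine lt_of_le_of_ne (e_nonneg n) fun h => ?_
  obtain ⟨i, -, -⟩ := (ZVec.lt_def _ _).1 ha
  have h1 : (0 : ZVec n) ⟨0, i.pos⟩ = e n 0 ⟨0, i.pos⟩ := congrFun h _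
  simp [e, ZVec.zero_apply] at h1

/-- The least positive element as a point of the half-line of `ℤ¹`. -/
def coneUnit (n : ℕ) : cone n 1 :=
  ⟨e n 0, fun i hi => by
    have : i.val ≠ 0 := by omega
    simp [e, this], e_nonneg n⟩

/-! ### `Λ`-trees -/

section Tree

variable {L : Type*} [AddCommGroup L] [LinearOrder L] {Γ : Type*}

/-- `s` is a segment with endpoints `x` and `y`: the image of an isometry `[a, b] → Γ` that sends
`a` to `x` and `b` to `y`. -/
def IsSegment (p : Γ → Γ → L) (s : Set Γ) (x y : Γ) : Prop :=
  ∃ (a b : L) (h : a ≤ b) (f : Set.Icc a b → Γ),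
    (∀ u v, p (f u) (f v) = |(u : L) - v|) ∧ Set.range f = s ∧
      f ⟨a, le_rfl, h⟩ = x ∧ f ⟨b, h, le_rfl⟩ = y

/-- `Λ`-trees. -/
structure IsLambdaTree (p : Γ → Γ → L) : Prop where
  nonempty : Nonempty Γ
  nonneg : ∀ x y, 0 ≤ p x y
  eq_zero_iff : ∀ x y, p x y = 0 ↔ x = y
  symm : ∀ x y, p x y = p y x
  triangle : ∀ x y z, p x y ≤ p x z + p y z
  /-- the space is geodesically linear -/
  geodesic : ∀ x y, ∃! s, IsSegment p s x y
  inter : ∀ x y z s t, IsSegment p s x y → IsSegment p t x z → ∃ w, IsSegment p (s ∩ t) x w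
  union : ∀ x y z s t, IsSegment p s x y → IsSegment p t y z → s ∩ t = {y} →
    IsSegment p (s ∪ t) x z

end Tree

/-! ### The compactification of a `ℤⁿ`-tree -/

section Compactification

variable {n : ℕ} {Γ : Type*} (p : Γ → Γ → ZVec n)

/-- `T` is a `ℤᵏ`-subtree: a class of the relation "the distance lies in `ℤᵏ`". -/
def IsSubtree (k : ℕ) (T : Set Γ) : Prop :=
  ∃ v, T = {w | p v w ∈ convexSub n k}

/-- All `ℤ`-subtrees are locally finite: every vertex has finitely many neighbours at distance
one. -/
def ZLocallyFinite : Prop := ∀ v, {w | p v w = e n 0}.Finite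

/-- Isometries `[0, ∞) → Γ`, where `[0, ∞)` is the half-line of `ℤᵏ`. -/
structure Ray (k : ℕ) where
  toFun : cone n k → Γ
  isometry : ∀ a b, p (toFun a) (toFun b) = |(a : ZVec n) - b|

variable {p}

/-- Equivalent rays: they have a common tail. -/
def Ray.SameTail {k : ℕ} (γ γ' : Ray p k) : Prop :=
  ∃ a a' : cone n k, ∀ c, γ.toFun (a + c) = γ'.toFun (a' + c)

/-- The `ℤᵏ`-subtrees that contain the rays `γ` and `γ'` are adjacent in a `ℤᵏ⁺¹`-subtree, and
`γ`, `γ'` are the two rays into which the segment from `γ 0` to `γ' 0` is cut (the second one is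
traversed backwards). So the ends of `γ` and `γ'` are the pair of ends that belongs to the edge
between the two subtrees. -/
def Ray.Opposite {k : ℕ} (γ γ' : Ray p k) : Prop :=
  ∃ b : ZVec n, b - e n k ∈ convexSub n k ∧
    ∀ c c' : cone n k, p (γ.toFun c) (γ'.toFun c') = b - c - c'

variable (p)

/-- Rays of all the types `ℤ¹, …, ℤⁿ`. -/
abbrev AnyRay : Type _ := (k : Set.Icc 1 n) × Ray p k

variable {p}

/-- The identifications between rays: equivalent rays give the same end, and for adjacent subtrees
the two ends that belong to the edge between them are identified. -/
inductive EndRel : AnyRay p → AnyRay p → Prop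
  | tail {k : Set.Icc 1 n} (γ γ' : Ray p k) : γ.SameTail γ' → EndRel ⟨k, γ⟩ ⟨k, γ'⟩
  | glue {k : Set.Icc 1 n} (γ γ' : Ray p k) : (k : ℕ) < n → γ.Opposite γ' →
      EndRel ⟨k, γ⟩ ⟨k, γ'⟩

variable (p)

/-- The compactification: the points of `Γ` together with the ends of all types, adjacent ends
being identified (the quotient is by the equivalence relation that `EndRel` generates). -/
def Compactification : Type _ := Γ ⊕ Quot (EndRel (p := p))

variable {p}

/-- A point of `Γ` as a point of the compactification. -/
def vertex (v : Γ) : Compactification p := Sum.inl v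

/-- The end of a ray as a point of the compactification. -/
def endOf {k : ℕ} (hk : k ∈ Set.Icc 1 n) (γ : Ray p k) : Compactification p :=
  Sum.inr (Quot.mk _ ⟨⟨k, hk⟩, γ⟩)

/-- The compactification of a `ℤᵐ`-subtree `T`, as a subset of that of `Γ`: the points of `T` and
the ends of the types `ℤ¹, …, ℤᵐ` of `T`. -/
def bar (m : ℕ) (T : Set Γ) : Set (Compactification p) :=
  {x | (∃ v ∈ T, x = vertex v) ∨
    ∃ (k : ℕ) (hk : k ∈ Set.Icc 1 n) (γ : Ray p k),
      k ≤ m ∧ Set.range γ.toFun ⊆ T ∧ x = endOf hk γ}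

variable (p)

/-- For two `ℤᵐ`-subtrees of one `ℤᵐ⁺¹`-subtree `T`: their distance in the simplicial tree whose
vertices are the `ℤᵐ`-subtrees of `T`. It is the coordinate number `m` of the distance of any two
points. -/
noncomputable def subtreeDist (m : ℕ) (S S' : Set Γ) : ℕ :=
  sInf {k : ℕ | ∃ v ∈ S, ∃ w ∈ S', coord (p v w) m = k}

/-- The choices made in the construction of the metric: a base point in every `ℤ`-subtree and, in
every `ℤᵐ⁺¹`-subtree `T` (`m ≥ 1`), a `ℤᵐ`-subtree of level `0` and an enumeration of the
`ℤᵐ`-subtrees of `T` on each level. -/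
structure Choices where
  base : Set Γ → Γ
  base_mem : ∀ T, IsSubtree p 1 T → base T ∈ T
  root : ℕ → Set Γ → Set Γ
  root_spec : ∀ m T, 1 ≤ m → m < n → IsSubtree p (m + 1) T →
    IsSubtree p m (root m T) ∧ root m T ⊆ T
  index : ℕ → Set Γ → ℕ
  index_injOn : ∀ m T k, 1 ≤ m → m < n → IsSubtree p (m + 1) T →
    Set.InjOn (index m) {S | IsSubtree p m S ∧ S ⊆ T ∧ subtreeDist p m (root m T) S = k}

variable {p}

/-- The factor by which the metric of the `ℤᵐ`-subtree `S` of the `ℤᵐ⁺¹`-subtree `T` is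
rescaled: `1` for the subtree of level `0`, and `1 / 2 ^ (k + j)` for the subtree with number `j`
of level `k ≥ 1`. -/
noncomputable def Choices.weight (D : Choices p) (m : ℕ) (T S : Set Γ) : ℝ :=
  if subtreeDist p m (D.root m T) S = 0 then 1
  else (1 / 2) ^ (subtreeDist p m (D.root m T) S + D.index m S)

/-- The sequence of points that represents a point `x` as seen from `w` in a `ℤ`-subtree: it is
constant if `x` is a point of the subtree, and for an end it runs along the ray from `w`. -/
def Approximates (w : Γ) (x : Compactification p) (u : ℕ → Γ) : Prop :=
  (∃ v, x = vertex v ∧ ∀ i, u i = v) ∨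
    ∃ (h : 1 ∈ Set.Icc 1 n) (γ : Ray p 1), γ.toFun 0 = w ∧ x = endOf h γ ∧
      ∀ i : ℕ, u i = γ.toFun (i • coneUnit n)

variable (p) in
/-- The Gromov product `(u · v)_w` of points in a `ℤ`-subtree. -/
noncomputable def gromov (w u v : Γ) : ℝ :=
  ((coord (p u w) 0 : ℝ) + coord (p v w) 0 - coord (p u v) 0) / 2

open Classical in
/-- The metric on the compactification of a `ℤ`-subtree with base point `w`: for `x ≠ y` it is
`exp (-(x · y)_w)`, where the Gromov product of ends is a limit along rays from `w`. -/
noncomputable def simplicialDist (w : Γ) (x y : Compactification p) : ℝ :=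
  if h : x ≠ y ∧ ∃ l : ℝ, ∃ u v : ℕ → Γ, Approximates w x u ∧ Approximates w y v ∧
      Tendsto (fun i => gromov p w (u i) (v i)) atTop (𝓝 l)
  then Real.exp (-h.2.choose) else 0

/-- The point `x` is an end of type `ℤᵐ⁺¹` that is represented by a ray which meets `S i` for all
indices `i` with `F i`. -/
def EndAlong (m : ℕ) (x : Compactification p) (S : ℤ → Set Γ) (F : ℤ → Prop) : Prop :=
  ∃ (h : m + 1 ∈ Set.Icc 1 n) (γ : Ray p (m + 1)), x = endOf h γ ∧
    ∀ i, F i → ∃ c, γ.toFun c ∈ S i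

/-- In the `ℤᵐ⁺¹`-subtree `T`, the `ℤᵐ`-subtrees `S i` (`i` in an interval `I` of `ℤ`) are the
successive vertices of the geodesic from `x` to `y`, and `a (i + 1)` is the common point of the
compactifications of `S i` and `S (i + 1)`. The interval is finite, infinite to one side, or equal
to `ℤ`, according to how many of `x` and `y` are ends of type `ℤᵐ⁺¹`. -/
structure IsChain (m : ℕ) (T : Set Γ) (x y : Compactification p) (I : Set ℤ) (S : ℤ → Set Γ)
    (a : ℤ → Compactification p) : Prop where
  nonempty : I.Nonempty
  interval : I.OrdConnected
  subtree : ∀ i ∈ I, IsSubtree p m (S i) ∧ S i ⊆ T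
  geodesic : ∀ i ∈ I, ∀ j ∈ I, (subtreeDist p m (S i) (S j) : ℤ) = |i - j|
  common : ∀ i ∈ I, i + 1 ∈ I → a (i + 1) ∈ bar m (S i) ∩ bar m (S (i + 1))
  start : (∃ i, IsLeast I i ∧ a i = x ∧ x ∈ bar m (S i)) ∨
    (¬ BddBelow I ∧ ∃ N : ℤ, EndAlong m x S fun i => i ∈ I ∧ i ≤ N)
  finish : (∃ i, IsGreatest I i ∧ a (i + 1) = y ∧ y ∈ bar m (S i)) ∨
    (¬ BddAbove I ∧ ∃ N : ℤ, EndAlong m y S fun i => i ∈ I ∧ N ≤ i)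

open Classical in
/-- The metric on the compactification of the `ℤᵐ⁺¹`-subtree `T`, when the (rescaled) metrics `δ S`
on the compactifications of its `ℤᵐ`-subtrees `S` are given: the sum of the distances
`δ (S i) (a i) (a (i + 1))` along the geodesic. -/
noncomputable def chainDist (m : ℕ) (T : Set Γ)
    (δ : Set Γ → Compactification p → Compactification p → ℝ) (x y : Compactification p) : ℝ :=
  if h : x ≠ y ∧ ∃ (l : ℝ) (I : Set ℤ) (S : ℤ → Set Γ) (a : ℤ → Compactification p),
      IsChain m T x y I S a ∧ HasSum (fun i : I => δ (S i) (a i) (a (i + 1))) l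
  then h.2.choose else 0

/-- The metric on the compactification of a `ℤᵐ`-subtree, `m ≥ 1`, by induction on `m`. -/
noncomputable def Choices.subtreeMetric (D : Choices p) :
    ℕ → Set Γ → Compactification p → Compactification p → ℝ
  | 0, _ => fun _ _ => 0
  | 1, T => simplicialDist (D.base T)
  | m + 2, T => chainDist (m + 1) T
      fun S x y => D.weight (m + 1) T S * Choices.subtreeMetric D (m + 1) S x y

/-- The metric on the compactification of the `ℤⁿ`-tree `Γ`. -/
noncomputable def Choices.metric (D : Choices p) (x y : Compactification p) : ℝ :=
  D.subtreeMetric n Set.univ x y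

end Compactification

/-! ### Infinite words -/

/-- `ℤⁿ`-words over the alphabet `X`: functions `[1, len] → X^±`. Letters of `X^±` are pairs, the
inverse of `(x, b)` being `(x, !b)`; the function has the value `none` outside `[1, len]`. -/
@[ext] structure Word (n : ℕ) (X : Type*) where
  len : ZVec n
  letter : ZVec n → Option (X × Bool)
  len_nonneg : 0 ≤ len
  isSome_iff : ∀ b, (letter b).isSome ↔ e n 0 ≤ b ∧ b ≤ len

/-- The inverse of a letter. -/
def invLetter {X : Type*} (x : X × Bool) : X × Bool := (x.1, !x.2)

namespace Word

variable {n : ℕ} {X : Type*}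

/-- Concatenation. -/
noncomputable def concat (u v : Word n X) : Word n X where
  len := u.len + v.len
  letter b := if b ≤ u.len then u.letter b else v.letter (b - u.len)
  len_nonneg := add_nonneg u.len_nonneg v.len_nonneg
  isSome_iff b := by
    split_ifs with h
    · rw [u.isSome_iff]
      exact ⟨fun h' => ⟨h'.1, h.trans (le_add_of_nonneg_right v.len_nonneg)⟩,
        fun h' => ⟨h'.1, h⟩⟩
    · rw [v.isSome_iff]
      have hb : u.len < b := not_le.1 h
      constructor
      · rintro ⟨_, h2⟩
        exact ⟨e_le_of_pos (u.len_nonneg.trans_lt hb), sub_le_iff_le_add'.1 h2⟩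
      · rintro ⟨_, h2⟩
        exact ⟨e_le_of_pos (sub_pos.2 hb), sub_le_iff_le_add'.2 h2⟩

/-- The inverse word. -/
def inv (u : Word n X) : Word n X where
  len := u.len
  letter b := (u.letter (u.len + e n 0 - b)).map invLetter
  len_nonneg := u.len_nonneg
  isSome_iff b := by
    rw [Option.isSome_map, u.isSome_iff]
    constructor
    · rintro ⟨h1, h2⟩
      refine ⟨?_, ?_⟩
      · have := sub_le_iff_le_add.1 h2
        exact le_of_add_le_add_left this
      · have := le_sub_iff_add_le.1 h1
        rw [add_comm] at this
        exact le_of_add_le_add_right this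
    · rintro ⟨h1, h2⟩
      refine ⟨?_, ?_⟩
      · rw [le_sub_iff_add_le, add_comm]
        gcongr
      · rw [sub_le_iff_le_add]
        gcongr

/-- Reduced words: no letter is followed by its inverse. -/
def Reduced (u : Word n X) : Prop :=
  ∀ b, e n 0 ≤ b → b < u.len → u.letter (b + e n 0) ≠ (u.letter b).map invLetter

/-- Cyclically reduced words: the last letter is not the inverse of the first one. -/
def CyclicallyReduced (u : Word n X) : Prop :=
  ¬ ∃ x, u.letter (e n 0) = some x ∧ u.letter u.len = some (invLetter x)

/-- The set `CDR(ℤⁿ, X)` of reduced words `u` that have a cyclic decomposition, that is,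
`u = c⁻¹ ∘ w ∘ c` with `w` cyclically reduced; the sign `∘` means that the concatenation is
reduced. -/
def IsCDR (u : Word n X) : Prop :=
  u.Reduced ∧ ∃ c w : Word n X, c.Reduced ∧ w.Reduced ∧ w.CyclicallyReduced ∧
    u = (c.inv.concat w).concat c

/-- `c` is the longest common initial segment of `u` and `v`, with `u = c ∘ u'` and
`v = c ∘ v'`. -/
def IsCom (c u v u' v' : Word n X) : Prop :=
  u = c.concat u' ∧ v = c.concat v' ∧
    ¬ ∃ x, u'.letter (e n 0) = some x ∧ v'.letter (e n 0) = some x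

/-- The product `u ∗ v` is defined and is equal to `w`. -/
def IsProd (u v w : Word n X) : Prop :=
  ∃ c u' v', IsCom c u.inv v u' v' ∧ w = u'.inv.concat v'

theorem inv_inv (u : Word n X) : u.inv.inv = u := by
  ext b x
  · rfl
  · have h : u.len + e n 0 - (u.len + e n 0 - b) = b := by abel
    have h2 : (invLetter ∘ invLetter : X × Bool → X × Bool) = id := by
      funext y
      simp [invLetter]
    simp only [inv, h, Option.map_map, h2, Option.map_id, id]

theorem IsCom.len_le {c u v u' v' : Word n X} (h : IsCom c u v u' v') :
    c.len ≤ u.len ∧ c.len ≤ v.len := by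
  obtain ⟨rfl, rfl, -⟩ := h
  exact ⟨le_add_of_nonneg_right u'.len_nonneg, le_add_of_nonneg_right v'.len_nonneg⟩

theorem IsCom.le_iff {c u v u' v' : Word n X} (h : IsCom c u v u' v') {a : ZVec n}
    (hu : a ≤ u.len) (hv : a ≤ v.len) :
    a ≤ c.len ↔ ∀ b ≤ a, u.letter b = v.letter b := by
  obtain ⟨rfl, rfl, h⟩ := h
  constructor
  · intro ha b hb
    simp only [concat, if_pos (hb.trans ha)]
  · intro hab
    by_contra hc
    have hpos : 0 < a - c.len := sub_pos.2 (not_le.1 hc)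
    have hea : c.len + e n 0 ≤ a := by
      have := e_le_of_pos hpos
      rwa [le_sub_iff_add_le'] at this
    have hn : ¬ c.len + e n 0 ≤ c.len :=
      not_le.2 (lt_add_of_pos_right _ (e_pos_of_pos hpos))
    have hl := hab _ hea
    simp only [concat, if_neg hn, add_sub_cancel_left] at hl
    have hs : (u'.letter (e n 0)).isSome :=
      (u'.isSome_iff _).2 ⟨le_rfl, le_of_add_le_add_left (hea.trans hu)⟩
    obtain ⟨x, hx⟩ := Option.isSome_iff_exists.1 hs
    exact h ⟨x, hx, hl ▸ hx⟩

theorem IsCom.len_unique {c d u v u' v' u₂ v₂ : Word n X} (h : IsCom c u v u' v')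
    (h' : IsCom d u v u₂ v₂) : c.len = d.len :=
  le_antisymm ((h'.le_iff h.len_le.1 h.len_le.2).2 ((h.le_iff h.len_le.1 h.len_le.2).1 le_rfl))
    ((h.le_iff h'.len_le.1 h'.len_le.2).2 ((h'.le_iff h'.len_le.1 h'.len_le.2).1 le_rfl))

end Word

/-! ### Subgroups of `CDR(ℤⁿ, X)` and their universal trees -/

/-- A group `G` that is realized as a subgroup of `CDR(ℤⁿ, X)`. -/
structure CDRGroup (n : ℕ) (X : Type*) (G : Type*) [Group G] where
  word : G → Word n X
  injective : Function.Injective word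
  isCDR : ∀ g, (word g).IsCDR
  mul : ∀ g h, (word g).IsProd (word h) (word (g * h))
  inv : ∀ g, word g⁻¹ = (word g).inv

namespace CDRGroup

variable {n : ℕ} {X G : Type*} [Group G] (φ : CDRGroup n X G)

theorem exists_com (f g : G) :
    ∃ c u v, Word.IsCom c (φ.word f) (φ.word g) u v := by
  obtain ⟨c, u, v, h, -⟩ := φ.mul f⁻¹ g
  rw [φ.inv, Word.inv_inv] at h
  exact ⟨c, u, v, h⟩

/-- The length `c(f, g)` of the longest common initial segment of `f` and `g`. -/
noncomputable def comLen (f g : G) : ZVec n := (φ.exists_com f g).choose.len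

theorem comLen_eq {f g : G} {c u v : Word n X}
    (h : Word.IsCom c (φ.word f) (φ.word g) u v) : φ.comLen f g = c.len := by
  obtain ⟨u', v', h'⟩ := (φ.exists_com f g).choose_spec
  exact Word.IsCom.len_unique h' h

theorem comLen_nonneg (f g : G) : 0 ≤ φ.comLen f g := Word.len_nonneg _

theorem comLen_le (f g : G) :
    φ.comLen f g ≤ (φ.word f).len ∧ φ.comLen f g ≤ (φ.word g).len := by
  obtain ⟨c, u, v, h⟩ := φ.exists_com f g
  rw [φ.comLen_eq h]
  exact h.len_le

theorem le_comLen_iff {f g : G} {a : ZVec n} (hf : a ≤ (φ.word f).len)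
    (hg : a ≤ (φ.word g).len) :
    a ≤ φ.comLen f g ↔ ∀ b ≤ a, (φ.word f).letter b = (φ.word g).letter b := by
  obtain ⟨c, u, v, h⟩ := φ.exists_com f g
  rw [φ.comLen_eq h]
  exact h.le_iff hf hg

theorem len_mul (h g : G) : (φ.word (h * g)).len =
    (φ.word h).len + (φ.word g).len - (φ.comLen h⁻¹ g + φ.comLen h⁻¹ g) := by
  obtain ⟨c, u, v, hc, hw⟩ := φ.mul h g
  have h1 : φ.comLen h⁻¹ g = c.len := φ.comLen_eq (by rw [φ.inv]; exact hc)
  have h2 : (φ.word h).len = c.len + u.len := congrArg Word.len hc.1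
  have h3 : (φ.word g).len = c.len + v.len := congrArg Word.len hc.2.1
  have h4 : (φ.word (h * g)).len = u.len + v.len := congrArg Word.len hw
  rw [h1, h2, h3, h4]
  abel

theorem letter_mul (he : 0 < e n 0) (h g : G) (b : ZVec n) : (φ.word (h * g)).letter b =
    if b ≤ (φ.word h).len - φ.comLen h⁻¹ g then (φ.word h).letter b
    else (φ.word g).letter (b - (φ.word h).len + (φ.comLen h⁻¹ g + φ.comLen h⁻¹ g)) := by
  obtain ⟨c, u, v, hc, hw⟩ := φ.mul h g
  have h1 : φ.comLen h⁻¹ g = c.len := φ.comLen_eq (by rw [φ.inv]; exact hc)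
  have h2 : (φ.word h).len = c.len + u.len := congrArg Word.len hc.1
  have h5 : φ.word h = (c.concat u).inv := by rw [← hc.1, Word.inv_inv]
  have h6 : (φ.word h).len - φ.comLen h⁻¹ g = u.len := by rw [h1, h2]; abel
  rw [h6, hw]
  by_cases hb : b ≤ u.len
  · have hlt : ¬ c.len + u.len + e n 0 - b ≤ c.len := by
      rw [not_le]
      have : c.len + u.len + e n 0 - b = c.len + (u.len - b + e n 0) := by abel
      rw [this]
      exact lt_add_of_pos_right _ (add_pos_of_nonneg_of_pos (sub_nonneg.2 hb) he)
    have heq : c.len + u.len + e n 0 - b - c.len = u.len + e n 0 - b := by abel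
    have hb' : b ≤ u.inv.len := hb
    rw [if_pos hb, h5]
    simp only [Word.concat, if_pos hb']
    simp only [Word.inv, if_neg hlt, heq]
  · have hb' : ¬ b ≤ u.inv.len := hb
    have hlt : ¬ b - u.len + c.len ≤ c.len := by
      rw [not_le]
      exact lt_add_of_pos_left _ (sub_pos.2 (not_le.1 hb))
    have heq : b - (c.len + u.len) + (c.len + c.len) = b - u.len + c.len := by abel
    rw [if_neg hb, h1, h2, heq, hc.2.1]
    simp only [Word.concat, if_neg hb', if_neg hlt]
    congr 1
    simp only [Word.inv]
    abel

/-- The set of pairs `(a, g)` with `g ∈ G` and `a ∈ [0, |g|]`. -/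
def Pairs : Type _ := {q : ZVec n × G // 0 ≤ q.1 ∧ q.1 ≤ (φ.word q.2).len}

/-- The identification `(a, f) ∼ (b, g)` iff `a = b ∈ [0, c(f, g)]`. -/
instance pairsSetoid : Setoid φ.Pairs where
  r q q' := q.1.1 = q'.1.1 ∧ q.1.1 ≤ φ.comLen q.1.2 q'.1.2
  iseqv := by
    refine ⟨?_, ?_, ?_⟩
    · intro q
      exact ⟨rfl, (φ.le_comLen_iff q.2.2 q.2.2).2 fun _ _ => rfl⟩
    · rintro ⟨⟨a, f⟩, ha⟩ ⟨⟨b, g⟩, hb⟩ ⟨h1, h2⟩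
      dsimp only at *
      subst h1
      exact ⟨rfl, (φ.le_comLen_iff hb.2 ha.2).2 fun c hc =>
        ((φ.le_comLen_iff ha.2 hb.2).1 h2 c hc).symm⟩
    · rintro ⟨⟨a, f⟩, ha⟩ ⟨⟨b, g⟩, hb⟩ ⟨⟨c, k⟩, hc⟩ ⟨h1, h2⟩ ⟨h3, h4⟩
      dsimp only at *
      subst h1
      subst h3
      exact ⟨rfl, (φ.le_comLen_iff ha.2 hc.2).2 fun d hd =>
        ((φ.le_comLen_iff ha.2 hb.2).1 h2 d hd).trans ((φ.le_comLen_iff hb.2 hc.2).1 h4 d hd)⟩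

/-- The universal tree of `G`. -/
def UniversalTree : Type _ := Quotient φ.pairsSetoid

/-- The vertex `⟨a, g⟩`. -/
def point (a : ZVec n) (g : G) (h : 0 ≤ a ∧ a ≤ (φ.word g).len) : φ.UniversalTree :=
  Quotient.mk φ.pairsSetoid ⟨(a, g), h⟩

theorem min_comLen_le {a : ZVec n} {f f' : G} (g : G) (h : a ≤ φ.comLen f f') :
    min a (φ.comLen f g) ≤ φ.comLen f' g := by
  have hf := φ.comLen_le f f'
  have hg := φ.comLen_le f g
  have m1 := min_le_left a (φ.comLen f g)
  have m2 := min_le_right a (φ.comLen f g)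
  refine (φ.le_comLen_iff (m1.trans (h.trans hf.2)) (m2.trans hg.2)).2 fun b hb => ?_
  rw [← (φ.le_comLen_iff (h.trans hf.1) (h.trans hf.2)).1 h b (hb.trans m1)]
  exact (φ.le_comLen_iff (m2.trans hg.1) (m2.trans hg.2)).1 m2 b hb

theorem comLen_comm (f g : G) : φ.comLen f g = φ.comLen g f := by
  have key : ∀ f g, φ.comLen f g ≤ φ.comLen g f := fun f g =>
    (φ.le_comLen_iff (φ.comLen_le f g).2 (φ.comLen_le f g).1).2 fun b hb =>
      ((φ.le_comLen_iff (φ.comLen_le f g).1 (φ.comLen_le f g).2).1 le_rfl b hb).symm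
  exact le_antisymm (key f g) (key g f)

theorem min_comLen_congr {a : ZVec n} {f f' : G} (g : G) (h : a ≤ φ.comLen f f') :
    min a (φ.comLen f g) = min a (φ.comLen f' g) :=
  le_antisymm (le_min (min_le_left _ _) (φ.min_comLen_le g h))
    (le_min (min_le_left _ _) (φ.min_comLen_le g (by rwa [φ.comLen_comm] at h)))

/-- The distance in the universal tree: the distance between `⟨a, f⟩` and `⟨b, g⟩` is
`a + b - 2 min {a, b, c(f, g)}`. -/
noncomputable def dist : φ.UniversalTree → φ.UniversalTree → ZVec n :=
  Quotient.lift₂ (fun q q' : φ.Pairs =>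
    q.1.1 + q'.1.1 - 2 • min (min q.1.1 q'.1.1) (φ.comLen q.1.2 q'.1.2)) (by
    rintro ⟨⟨a, f⟩, ha⟩ ⟨⟨b, g⟩, hb⟩ ⟨⟨a', f'⟩, ha'⟩ ⟨⟨b', g'⟩, hb'⟩ ⟨h1, h2⟩ ⟨h3, h4⟩
    dsimp only at *
    subst h1
    subst h3
    have e1 : min (min a b) (φ.comLen f g) = min (min a b) (φ.comLen f' g) := by
      rw [min_comm a b, min_assoc, min_assoc, φ.min_comLen_congr g h2]
    have e2 : min (min a b) (φ.comLen f' g) = min (min a b) (φ.comLen f' g') := by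
      rw [min_assoc, min_assoc, φ.comLen_comm f' g, φ.comLen_comm f' g',
        φ.min_comLen_congr f' h4]
    rw [e1, e2])

theorem act_bound {h g : G} {a : ZVec n} (h1 : 0 ≤ a ∧ a ≤ (φ.word g).len)
    (h2 : ¬ a ≤ φ.comLen h⁻¹ g) :
    0 ≤ (φ.word h).len + a - (φ.comLen h⁻¹ g + φ.comLen h⁻¹ g) ∧
      (φ.word h).len + a - (φ.comLen h⁻¹ g + φ.comLen h⁻¹ g) ≤ (φ.word (h * g)).len := by
  have h3 : φ.comLen h⁻¹ g ≤ (φ.word h).len := by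
    have := (φ.comLen_le h⁻¹ g).1
    rwa [φ.inv] at this
  refine ⟨sub_nonneg.2 (add_le_add h3 (not_le.1 h2).le), ?_⟩
  rw [φ.len_mul]
  exact sub_le_sub_right (add_le_add_right h1.2 _) _

/-- The action of `G` on its universal tree: `h · ⟨a, g⟩` is `⟨|h| - a, h⟩` if `a ≤ c(h⁻¹, g)`, and
`⟨|h| + a - 2 c(h⁻¹, g), h ∗ g⟩` otherwise. -/
noncomputable def act (h : G) : φ.UniversalTree → φ.UniversalTree :=
  Quotient.lift (fun q : φ.Pairs =>
    if hq : q.1.1 ≤ φ.comLen h⁻¹ q.1.2 then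
      φ.point ((φ.word h).len - q.1.1) h ⟨sub_nonneg.2 (hq.trans (by
        have := (φ.comLen_le h⁻¹ q.1.2).1
        rwa [φ.inv] at this)), sub_le_self _ q.2.1⟩
    else φ.point ((φ.word h).len + q.1.1 - (φ.comLen h⁻¹ q.1.2 + φ.comLen h⁻¹ q.1.2)) (h * q.1.2)
      (φ.act_bound q.2 hq)) (by
    rintro ⟨⟨a, g⟩, ha⟩ ⟨⟨a', g'⟩, ha'⟩ ⟨h1, h2⟩
    dsimp only at *
    subst h1
    have hm := φ.min_comLen_congr h⁻¹ h2
    rw [φ.comLen_comm g, φ.comLen_comm g'] at hm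
    by_cases hq : a ≤ φ.comLen h⁻¹ g
    · have hq' : a ≤ φ.comLen h⁻¹ g' := by
        rw [min_eq_left hq] at hm
        exact min_eq_left_iff.1 hm.symm
      rw [dif_pos hq, dif_pos hq']
    · have hq' : ¬ a ≤ φ.comLen h⁻¹ g' := fun h' => by
        rw [min_eq_left h'] at hm
        exact hq (min_eq_left_iff.1 hm)
      have hc : φ.comLen h⁻¹ g = φ.comLen h⁻¹ g' := by
        rwa [min_eq_right (not_le.1 hq).le, min_eq_right (not_le.1 hq').le] at hm
      rw [dif_neg hq, dif_neg hq']
      have he : 0 < e n 0 := e_pos_of_pos ((φ.comLen_nonneg _ _).trans_lt (not_le.1 hq))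
      refine Quotient.sound ⟨by dsimp only; rw [hc], ?_⟩
      have b1 := φ.act_bound ha hq
      have b2 := φ.act_bound ha' hq'
      rw [← hc] at b2
      refine (φ.le_comLen_iff b1.2 b2.2).2 fun b hb => ?_
      rw [φ.letter_mul he, φ.letter_mul he, ← hc]
      split_ifs
      · rfl
      · refine (φ.le_comLen_iff ha.2 ha'.2).1 h2 _ ?_
        have e1 : (φ.word h).len + a - (φ.word h).len = a := by abel
        have e2 : b + (φ.comLen h⁻¹ g + φ.comLen h⁻¹ g) - (φ.word h).len =
            b - (φ.word h).len + (φ.comLen h⁻¹ g + φ.comLen h⁻¹ g) := by abel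
        have hb3 := le_sub_iff_add_le.1 hb
        have hb4 := sub_le_sub_right hb3 (φ.word h).len
        rwa [e1, e2] at hb4)

end CDRGroup

end ZnFree

set_option linter.unusedSectionVars false

/-! A point `x` of the compactification is encoded by its direction field: the map that sends a
vertex `u` to the neighbour of `u` on the way to `x`, and fixes `x` if `x` is a vertex. Such fields
satisfy conditions that involve at most two vertices at a time (`Consistent`), and conversely each
consistent field belongs to exactly one point. If it fixes a vertex, it is the field of this vertex.
Otherwise, following it from a vertex gives a linearly ordered set whose distances form an initial
segment of the positive cone without maximum; a tail of this set is a ray of type ℤᵏ for some `k`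
(`field_surjective_aux`). Two rays with the same field are tail equivalent or form the pair of ends
of an edge (`tail_or_opposite`), and these are precisely the identifications made in the
compactification.

The metric can be read off from the fields. In a ℤ-subtree with base point `w`, the Gromov product
of two points is the least distance from `w` of a vertex where their fields differ
(`simplicialDist_eq`). On higher levels the sum along a chain equals a sum over all ℤᵐ-subtrees
(`IsChain.hasSum`): from inside `S i` the points `a i` and `a (i + 1)` are seen in the directions of
`x` and `y`, and a subtree off the chain does not separate `x` from `y`. So the metric is
`fieldDist`, an iterated weighted sum. Symmetry and the triangle inequality hold termwise, and
definiteness is injectivity of `x ↦ field x`. The weights on each level are summable, so by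
dominated convergence pointwise convergence of fields implies metric convergence. If Γ is locally
finite, the consistent fields are a closed subset of a product of finite sets, hence compact, and
they map continuously onto the compactification. Thus, for every choice, the metric topology is that
of pointwise convergence of fields; this also makes the action of each isometry continuous.

For the group, the cyclic decomposition of words gives `2 c(g⁻¹, g) < |g|`, that is, `|g| < |g²|`,
for `g ≠ 1`. So each such element is hyperbolic; the action is free and roots are unique. If the
orbit of a point is finite, powers of any two elements fix this point, and the squares of these
powers commute because they agree at a vertex of a ray; by uniqueness of roots the two elements
commute. Choices exist since a finitely generated group and its tree are countable.

The deeper point is local finiteness (`zLocallyFinite_of_fg`). By downward induction on `m`, the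
stabilizer of each ℤᵐ-subtree is finitely generated and has finitely many orbits on the branches at
this subtree (`branchFinite_and_fg`). Finite generation descends because a Busemann function embeds
the stabilizer of a branch into ℤⁿ. For `m = 0` the stabilizer is trivial, and different neighbours
lie on different branches. -/

namespace ZnFree

section

/-! ### Arithmetic of `ℤⁿ` -/

namespace ZVec

variable {n : ℕ}

theorem e_pos [NeZero n] : 0 < e n 0 := by
  refine lt_of_le_of_ne (e_nonneg n) fun h => ?_
  have h1 : (0 : ZVec n) ⟨0, Nat.pos_of_ne_zero (NeZero.ne n)⟩ = e n 0 ⟨0, _⟩ := congrFun h _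
  simp [e, ZVec.zero_apply] at h1

theorem convexSub_mono {k l : ℕ} (h : k ≤ l) : convexSub n k ≤ convexSub n l :=
  fun _ ha i hi => ha i (h.trans hi)

theorem mem_convexSub_self (a : ZVec n) : a ∈ convexSub n n :=
  fun i hi => absurd i.isLt (by omega)

theorem mem_convexSub_zero {a : ZVec n} : a ∈ convexSub n 0 ↔ a = 0 :=
  ⟨fun h => funext fun i => h i (Nat.zero_le _), fun h => h ▸ (convexSub n 0).zero_mem⟩

theorem mem_convexSub_of_le {k : ℕ} {a b : ZVec n} (ha : 0 ≤ a) (hab : a ≤ b)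
    (hb : b ∈ convexSub n k) : a ∈ convexSub n k := by
  rcases ha.eq_or_lt with rfl | ha
  · exact (convexSub n k).zero_mem
  obtain ⟨i, h1, h2⟩ := (lt_def _ _).1 ha
  rcases hab.eq_or_lt with rfl | hab
  · exact hb
  obtain ⟨j, h3, h4⟩ := (lt_def _ _).1 hab
  have hik : i.val < k := by
    by_contra hk
    rcases lt_trichotomy i j with h | h | h
    · have h5 : (0 : ℤ) = a j := h1 j h
      have h6 := hb j (by have := Fin.lt_def.1 h; omega)
      omega
    · subst h
      have h6 := hb i (by omega)
      have h7 : (0 : ℤ) < a i := h2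
      omega
    · have h6 := hb i (by omega)
      have h7 : (0 : ℤ) < a i := h2
      have h8 := h3 i h
      omega
  intro l hl
  exact (h1 l (Fin.lt_def.2 (by omega))).symm

theorem mem_convexSub_of_add_self {k : ℕ} {a : ZVec n} (h : a + a ∈ convexSub n k) :
    a ∈ convexSub n k := by
  intro i hi
  have := h i hi
  rw [add_apply] at this
  omega

theorem abs_mem_convexSub {k : ℕ} {a : ZVec n} : |a| ∈ convexSub n k ↔ a ∈ convexSub n k := by
  rcases abs_choice a with h | h <;> rw [h]
  exact neg_mem_iff

theorem coord_add (a b : ZVec n) (k : ℕ) : coord (a + b) k = coord a k + coord b k := by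
  unfold coord; split_ifs <;> simp [add_apply]

theorem coord_neg (a : ZVec n) (k : ℕ) : coord (-a) k = -coord a k := by
  unfold coord; split_ifs <;> simp [neg_apply]

theorem coord_sub (a b : ZVec n) (k : ℕ) : coord (a - b) k = coord a k - coord b k := by
  rw [sub_eq_add_neg, coord_add, coord_neg, sub_eq_add_neg]

@[simp] theorem coord_zero (k : ℕ) : coord (0 : ZVec n) k = 0 := by
  unfold coord; split_ifs <;> simp [zero_apply]

theorem coord_eq_zero {m : ℕ} {a : ZVec n} (h : a ∈ convexSub n m) : coord a m = 0 := by
  unfold coord; split_ifs with h'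
  · exact h _ le_rfl
  · rfl

theorem mem_convexSub_of_coord {m : ℕ} {a : ZVec n} (h : a ∈ convexSub n (m + 1))
    (h0 : coord a m = 0) : a ∈ convexSub n m := by
  intro i hi
  rcases hi.eq_or_lt with rfl | hi
  · simpa [coord] using h0
  · exact h i hi

theorem lt_of_coord_lt {m : ℕ} {a b : ZVec n} (h : b - a ∈ convexSub n (m + 1))
    (h0 : coord a m < coord b m) : a < b := by
  have hm : m < n := by
    by_contra hm
    simp [coord, hm] at h0
  refine (lt_def _ _).2 ⟨⟨m, hm⟩, fun j hj => ?_, by simpa [coord, hm] using h0⟩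
  have h1 : b j + (-a) j = 0 := h j (Fin.lt_def.1 hj)
  rw [neg_apply] at h1
  omega

theorem coord_le {m : ℕ} {a b : ZVec n} (h : b - a ∈ convexSub n (m + 1)) (hab : a ≤ b) :
    coord a m ≤ coord b m := by
  by_contra hc
  have := lt_of_coord_lt (by rw [← neg_sub]; exact neg_mem h) (not_le.1 hc)
  exact absurd hab (not_le.2 this)

theorem coord_nonneg {m : ℕ} {a : ZVec n} (h : a ∈ convexSub n (m + 1)) (ha : 0 ≤ a) :
    0 ≤ coord a m := by
  have := coord_le (a := 0) (b := a) (by simpa using h) ha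
  simpa using this

theorem e_mem_convexSub (m : ℕ) : e n m ∈ convexSub n (m + 1) := by
  intro i hi
  have : i.val ≠ m := by omega
  simp [e, this]

theorem coord_e {m : ℕ} (hm : m < n) : coord (e n m) m = 1 := by simp [coord, hm, e]

theorem coord_zsmul (a : ZVec n) (j : ℤ) (k : ℕ) : coord (j • a) k = j * coord a k := by
  unfold coord; split_ifs
  · exact rfl
  · simp

theorem coord_nsmul (a : ZVec n) (j : ℕ) (k : ℕ) : coord (j • a) k = j * coord a k := by
  rw [← natCast_zsmul, coord_zsmul]

theorem e_nonneg' (m : ℕ) : 0 ≤ e n m := by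
  by_cases hm : m < n
  · exact (lt_of_coord_lt (m := m) (by simpa using e_mem_convexSub m)
      (by simp [coord_e hm])).le
  · refine le_of_eq (funext fun i => ?_)
    have : i.val ≠ m := by omega
    simp [e, this, zero_apply]

theorem eq_zsmul_of_mem_one [NeZero n] {a : ZVec n} (h : a ∈ convexSub n 1) :
    a = coord a 0 • e n 0 := by
  have hn : 0 < n := Nat.pos_of_ne_zero (NeZero.ne n)
  have h1 : a - coord a 0 • e n 0 ∈ convexSub n 0 := by
    refine mem_convexSub_of_coord ?_ ?_
    · exact sub_mem h (zsmul_mem (e_mem_convexSub 0) _)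
    · rw [coord_sub, coord_zsmul, coord_e hn]; ring
  exact sub_eq_zero.1 (mem_convexSub_zero.1 h1)

theorem lt_of_not_mem {k : ℕ} {a b : ZVec n} (ha : 0 ≤ a) (h : a ∉ convexSub n k)
    (hb : b ∈ convexSub n k) : b < a := by
  by_contra hc
  exact h (mem_convexSub_of_le ha (not_lt.1 hc) hb)

end ZVec

/-! ### Metric description of `ℤⁿ`-trees -/

section

variable {n : ℕ} {Γ : Type*}

/-- A `ℤⁿ`-metric space in which points can be found on segments at any distance, and that is
`0`-hyperbolic with integral Gromov products. -/
structure IsZTree (p : Γ → Γ → ZVec n) : Prop where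
  self : ∀ x, p x x = 0
  eq_of : ∀ {x y}, p x y = 0 → x = y
  symm : ∀ x y, p x y = p y x
  nonneg : ∀ x y, 0 ≤ p x y
  between : ∀ x y c, 0 ≤ c → c ≤ p x y → ∃ z, p x z = c ∧ p z y = p x y - c
  four : ∀ x y z t, p x y + p z t ≤ max (p x z + p y t) (p x t + p y z)
  parity : ∀ x y z, ∃ r, p x y + p x z - p y z = r + r

theorem IsSegment.mem_imp {p : Γ → Γ → ZVec n} {s : Set Γ} {x y z : Γ} (h : IsSegment p s x y)
    (hz : z ∈ s) : p x z + p z y = p x y := by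
  obtain ⟨a, b, hab, f, hf, rfl, rfl, rfl⟩ := h
  obtain ⟨⟨u, hu⟩, rfl⟩ := hz
  rw [hf, hf, hf]
  have h1 := hu.1
  have h2 := hu.2
  simp only
  rw [abs_of_nonpos (by grind), abs_of_nonpos (by grind), abs_of_nonpos (by grind)]
  abel

theorem IsSegment.left_mem {p : Γ → Γ → ZVec n} {s : Set Γ} {x y : Γ} (h : IsSegment p s x y) :
    x ∈ s := by
  obtain ⟨a, b, hab, f, hf, rfl, rfl, rfl⟩ := h
  exact ⟨_, rfl⟩

theorem IsSegment.right_mem {p : Γ → Γ → ZVec n} {s : Set Γ} {x y : Γ} (h : IsSegment p s x y) :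
    y ∈ s := by
  obtain ⟨a, b, hab, f, hf, rfl, rfl, rfl⟩ := h
  exact ⟨_, rfl⟩

theorem IsSegment.exists_at {p : Γ → Γ → ZVec n} {s : Set Γ} {x y : Γ} (h : IsSegment p s x y)
    (c : ZVec n) (h0 : 0 ≤ c) (hc : c ≤ p x y) : ∃ z ∈ s, p x z = c := by
  obtain ⟨a, b, hab, f, hf, rfl, rfl, rfl⟩ := h
  rw [hf, abs_of_nonpos (by simp only; grind)] at hc
  simp only at hc
  refine ⟨f ⟨a + c, by grind, by grind⟩, ⟨_, rfl⟩, ?_⟩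
  rw [hf]
  simp only
  rw [abs_of_nonpos (by grind)]
  abel

theorem IsSegment.unique_at {p : Γ → Γ → ZVec n} {s : Set Γ} {x y z z' : Γ}
    (h : IsSegment p s x y) (hz : z ∈ s) (hz' : z' ∈ s) (he : p x z = p x z') : z = z' := by
  obtain ⟨a, b, hab, f, hf, rfl, rfl, rfl⟩ := h
  obtain ⟨⟨u, hu⟩, rfl⟩ := hz
  obtain ⟨⟨v, hv⟩, rfl⟩ := hz'
  rw [hf, hf] at he
  simp only at he
  rw [abs_of_nonpos (by grind), abs_of_nonpos (by grind)] at he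
  congr 2
  grind

/-- Medians carry the proof: the far endpoint of `[x,y] ∩ [x,z]` lies on all three sides, by the
union axiom. The four point condition then compares the positions of two medians on one segment. The
metric form of the axioms is also the one that is easy to verify for the universal tree. -/
theorem IsLambdaTree.isZTree {p : Γ → Γ → ZVec n} (h : IsLambdaTree p) : IsZTree p := by
  have hself : ∀ x, p x x = 0 := fun x => (h.eq_zero_iff x x).2 rfl
  -- A point that lies metrically between `x` and `y` is on the segment: `[x,z]` and `[z,y]` meet
  -- only in `z`, so their union is a segment, and segments are unique.
  have hmem : ∀ {x y z s}, IsSegment p s x y → p x z + p z y = p x y → z ∈ s := by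
    intro x y z s hs hz
    obtain ⟨s1, h1, -⟩ := h.geodesic x z
    obtain ⟨s2, h2, -⟩ := h.geodesic z y
    have h3 : s1 ∩ s2 = {z} := by
      refine Set.eq_singleton_iff_unique_mem.2 ⟨⟨h1.right_mem, h2.left_mem⟩, fun t ht => ?_⟩
      have e1 := h1.mem_imp ht.1
      have e2 := h2.mem_imp ht.2
      have e3 := h.triangle x y t
      have e4 := h.symm t y
      have e5 := h.symm z t
      have e6 := h.nonneg z t
      exact ((h.eq_zero_iff z t).1 (by grind)).symm
    have h4 := h.union x z y s1 s2 h1 h2 h3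
    rw [(h.geodesic x y).unique hs h4]
    exact Or.inl h1.right_mem
  have huniq : ∀ {x y z z'}, p x z + p z y = p x y → p x z' + p z' y = p x y →
      p x z = p x z' → z = z' := by
    intro x y z z' hz hz' he
    obtain ⟨s, hs, -⟩ := h.geodesic x y
    exact hs.unique_at (hmem hs hz) (hmem hs hz') he
  have hbet : ∀ x y c, 0 ≤ c → c ≤ p x y → ∃ z, p x z = c ∧ p z y = p x y - c := by
    intro x y c h0 hc
    obtain ⟨s, hs, -⟩ := h.geodesic x y
    obtain ⟨z, hz, hzc⟩ := hs.exists_at c h0 hc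
    have := hs.mem_imp hz
    exact ⟨z, hzc, by grind⟩
  have hmed : ∀ x y z, ∃ w, p x w + p w y = p x y ∧ p x w + p w z = p x z ∧
      p y w + p w z = p y z := by
    intro x y z
    obtain ⟨s, hs, -⟩ := h.geodesic x y
    obtain ⟨t, ht, -⟩ := h.geodesic x z
    obtain ⟨w, hw⟩ := h.inter x y z s t hs ht
    have hws := hs.mem_imp hw.right_mem.1
    have hwt := ht.mem_imp hw.right_mem.2
    obtain ⟨s1, h1, -⟩ := h.geodesic y w
    obtain ⟨s2, h2, -⟩ := h.geodesic w z
    have h3 : s1 ∩ s2 = {w} := by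
      refine Set.eq_singleton_iff_unique_mem.2 ⟨⟨h1.right_mem, h2.left_mem⟩, fun v hv => ?_⟩
      have e1 := h1.mem_imp hv.1
      have e2 := h2.mem_imp hv.2
      have t1 := h.triangle x y v
      have t2 := h.triangle x v w
      have t3 := h.triangle x z v
      have s1 := h.symm y v
      have s2 := h.symm v z
      have s3 := h.symm w v
      have s4 := h.symm y w
      have s5 := h.symm w z
      have a1 : v ∈ s := hmem hs (by grind)
      have a2 : v ∈ t := hmem ht (by grind)
      have a3 := hw.mem_imp ⟨a1, a2⟩
      have e6 := h.nonneg v w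
      have t4 := h.triangle x y w
      exact (h.eq_zero_iff v w).1 (by grind)
    have h4 := h.union y w z s1 s2 h1 h2 h3
    exact ⟨w, hws, hwt, h4.mem_imp (Or.inl h1.right_mem)⟩
  -- On `[x,z]` the branch point `w` of `y` comes before the branch point `w'` of `t`, so going from
  -- `z` and from `t` to `y` one passes through `w`.
  have key : ∀ x y z t w w', p x w + p w y = p x y → p x w + p w z = p x z →
      p y w + p w z = p y z → p x w' + p w' z = p x z → p x w' + p w' t = p x t →
      p x w ≤ p x w' → p x z + p y t ≤ p x t + p y z := by
    intro x y z t w w' h1 h2 h3 h4 h5 hle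
    obtain ⟨v, hv1, hv2⟩ := hbet x w' (p x w) (h.nonneg _ _) hle
    have t1 := h.triangle x z v
    have t2 := h.triangle v z w'
    have t3 := h.triangle x t v
    have t4 := h.triangle v t w'
    have s1 := h.symm z v
    have s2 := h.symm z w'
    have s3 := h.symm t v
    have s4 := h.symm t w'
    have hvw : v = w := huniq (x := x) (y := z) (by grind) h2 hv1
    subst hvw
    have t5 := h.triangle y t v
    have s5 := h.symm y v
    grind
  refine ⟨hself, fun {x y} => (h.eq_zero_iff x y).1, h.symm, h.nonneg, hbet, ?_, ?_⟩
  · intro x z y t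
    obtain ⟨w, h1, h2, h3⟩ := hmed x y z
    obtain ⟨w', h4, h5, h6⟩ := hmed x z t
    rcases le_total (p x w) (p x w') with hle | hle
    · have := key x y z t w w' h1 h2 h3 h4 h5 hle
      refine this.trans (le_max_of_le_right ?_)
      rw [h.symm z y]
    · have s1 := h.symm t w'
      have s2 := h.symm w' z
      have s3 := h.symm t z
      have := key x t z y w' w h5 h4 (by grind) h2 h1 hle
      refine le_max_of_le_left ?_
      rw [h.symm y t, h.symm z t]
      exact this
  · intro x y z
    obtain ⟨w, h1, h2, h3⟩ := hmed x y z
    have := h.symm y w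
    exact ⟨p x w, by grind⟩

variable {p : Γ → Γ → ZVec n}

namespace IsZTree

variable (h : IsZTree p)
include h

theorem triangle (x y z : Γ) : p x y ≤ p x z + p z y := by
  have h1 := h.four x y z z
  rw [h.self, max_self, h.symm y z] at h1
  simpa using h1

/-- Both sums on the right of the four point condition for `x, y, z, z'` are equal to `p x y`, which
leaves `p z z' ≤ 0`. -/
theorem eq_of_between {x y z z' : Γ} (h1 : p x z + p z y = p x y) (h2 : p x z' + p z' y = p x y)
    (h3 : p x z = p x z') : z = z' := by
  have h4 := h.four x y z z'
  have h5 := h.nonneg z z'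
  have := h.symm y z
  have := h.symm y z'
  exact h.eq_of (by grind)

/-- Parity makes the Gromov product `r` of `y` and `z` at `x` an element of ℤⁿ; the median is the
point of `[x,y]` at distance `r` from `x`. -/
theorem exists_median (x y z : Γ) : ∃ w, p x w + p w y = p x y ∧ p x w + p w z = p x z ∧
    p y w + p w z = p y z := by
  obtain ⟨r, hr⟩ := h.parity x y z
  have t1 := h.triangle x y z
  have t2 := h.triangle x z y
  have t3 := h.triangle y z x
  have s1 := h.symm y z
  have s2 := h.symm x y
  obtain ⟨w, h1, h2⟩ := h.between x y r (by grind) (by grind)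
  have h3 := h.four x y z w
  have t4 := h.triangle x z w
  have t5 := h.triangle y z w
  have s3 := h.symm w y
  have s4 := h.symm w z
  exact ⟨w, by grind, by grind, by grind⟩

/-- The distance to a point of a segment. -/
theorem dist_of_between {x a b y : Γ} (hy : p a y + p y b = p a b) :
    p x y = max (p x a - p a y) (p x b - p y b) := by
  have h1 := h.four x y a b
  have t1 := h.triangle x a y
  have t2 := h.triangle x b y
  have s1 := h.symm y a
  grind

end IsZTree

/-! ### Directions -/

open Classical in
variable (p) in
/-- The neighbour of `u` on the way to `v`; it is `u` if `u = v`. -/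
noncomputable def dir (u v : Γ) : Γ :=
  if h : ∃ w, p u w = e n 0 ∧ p w v = p u v - e n 0 then h.choose else u

namespace IsZTree

variable (h : IsZTree p)
include h

theorem pos {u v : Γ} (huv : u ≠ v) : 0 < p u v :=
  lt_of_le_of_ne (h.nonneg u v) fun h' => huv (h.eq_of h'.symm)

theorem one_le {u v : Γ} (huv : u ≠ v) : e n 0 ≤ p u v := e_le_of_pos (h.pos huv)

variable [NeZero n]

theorem dir_spec {u v : Γ} (huv : u ≠ v) :
    p u (dir p u v) = e n 0 ∧ p (dir p u v) v = p u v - e n 0 := by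
  have h1 : ∃ w, p u w = e n 0 ∧ p w v = p u v - e n 0 :=
    h.between u v _ (e_nonneg n) (h.one_le huv)
  rw [dir, dif_pos h1]
  exact h1.choose_spec

theorem dir_self (u : Γ) : dir p u u = u := by
  rw [dir, dif_neg]
  rintro ⟨w, h1, h2⟩
  have := h.nonneg w u
  have := h.self u
  have := ZVec.e_pos (n := n)
  grind

theorem dir_eq {u v w : Γ} (h1 : p u w = e n 0) (h2 : p w v = p u v - e n 0) : dir p u v = w := by
  have huv : u ≠ v := by
    rintro rfl
    have := h.nonneg w u
    have := h.self u
    have := ZVec.e_pos (n := n)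
    grind
  obtain ⟨h3, h4⟩ := h.dir_spec huv
  exact h.eq_of_between (x := u) (y := v) (by grind) (by grind) (by grind)

theorem dir_of_adj {u v : Γ} (h1 : p u v = e n 0) : dir p u v = v :=
  h.dir_eq h1 (by rw [h.self, h1, sub_self])

theorem ne_of_adj {u v : Γ} (h1 : p u v = e n 0) : u ≠ v := by
  rintro rfl
  exact ZVec.e_pos.ne' (h1.symm.trans (h.self u))

theorem dir_ne {u v : Γ} (huv : u ≠ v) : dir p u v ≠ u :=
  (h.ne_of_adj (h.dir_spec huv).1).symm

/-- If `u` is not between `v` and `v'`, their Gromov product at `u` is positive, hence at least the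
least positive element, and the two segments from `u` share the first edge. Statements about
directions and about betweenness are translated into each other by this. -/
theorem dir_ne_dir_iff {u v v' : Γ} (h1 : u ≠ v) (h2 : u ≠ v') :
    dir p u v ≠ dir p u v' ↔ p v u + p u v' = p v v' := by
  have e0 := ZVec.e_pos (n := n)
  obtain ⟨a1, a2⟩ := h.dir_spec h1
  obtain ⟨b1, b2⟩ := h.dir_spec h2
  have s1 := h.symm v u
  have s2 := h.symm v v'
  constructor
  · intro hne
    by_contra hc
    apply hne
    have t := h.triangle v v' u
    obtain ⟨r, hr⟩ := h.parity u v v'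
    have hr0 : 0 < r := by grind
    have hr1 := e_le_of_pos hr0
    refine h.dir_eq b1 ?_
    have f := h.four v (dir p u v') u v'
    have t2 := h.triangle u v (dir p u v')
    have s3 := h.symm (dir p u v') u
    have s4 := h.symm (dir p u v') v
    grind
  · intro hb heq
    rw [← heq] at b2
    have t := h.triangle v v' (dir p u v)
    have s3 := h.symm (dir p u v) v
    grind

theorem dir_eq_dir_iff {u v v' : Γ} (h1 : u ≠ v) (h2 : u ≠ v') :
    dir p u v = dir p u v' ↔ p v u + p u v' ≠ p v v' := by
  rw [← not_iff_not, not_not]; exact h.dir_ne_dir_iff h1 h2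

/-- Along a segment the direction does not change. -/
theorem dir_of_between {u v w : Γ} (hu : u ≠ v) (hb : p u v + p v w = p u w) :
    dir p u v = dir p u w := by
  have hv := h.pos hu
  have := h.nonneg v w
  have huw : u ≠ w := by
    rintro rfl
    rw [h.self] at hb
    grind
  rw [h.dir_eq_dir_iff hu huw]
  have s := h.symm u v
  grind

end IsZTree

end

end

section

variable {n : ℕ} {Γ : Type*} {p : Γ → Γ → ZVec n}

/-! ### Rays and direction fields -/

theorem cone_le_add {k : ℕ} (c d : cone n k) : (c : ZVec n) ≤ (c + d : cone n k) :=
  le_add_of_nonneg_right d.2.2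

theorem coe_cone_add {k : ℕ} (c d : cone n k) : ((c + d : cone n k) : ZVec n) = c + d := rfl

/-- The least positive element as a point of the half-line of `ℤᵏ`. -/
def coneOne (n : ℕ) {k : ℕ} (hk : 1 ≤ k) : cone n k :=
  ⟨e n 0, ZVec.convexSub_mono hk (ZVec.e_mem_convexSub 0), e_nonneg n⟩

namespace Ray

variable {k : ℕ} (γ : Ray p k)

theorem dist_of_le {c c' : cone n k} (hc : (c : ZVec n) ≤ c') :
    p (γ.toFun c) (γ.toFun c') = c' - c := by
  rw [γ.isometry, abs_of_nonpos (by grind)]; abel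

theorem dist_add (c d : cone n k) : p (γ.toFun c) (γ.toFun (c + d)) = d := by
  rw [γ.dist_of_le (cone_le_add c d), coe_cone_add]; abel

theorem dist_zero (c : cone n k) : p (γ.toFun 0) (γ.toFun c) = c := by
  have := γ.dist_add 0 c
  rwa [zero_add] at this

/-- The points of a segment with endpoints on a ray are on the ray. -/
theorem mem_range_of_between (h : IsZTree p) {c c' : cone n k} {u : Γ}
    (hu : p (γ.toFun c) u + p u (γ.toFun c') = p (γ.toFun c) (γ.toFun c')) :
    ∃ d, γ.toFun d = u := by
  have key : ∀ c c' : cone n k, (c : ZVec n) ≤ c' →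
      p (γ.toFun c) u + p u (γ.toFun c') = p (γ.toFun c) (γ.toFun c') → ∃ d, γ.toFun d = u := by
    intro c c' hc hu
    have h1 := γ.dist_of_le hc
    have h2 := h.nonneg (γ.toFun c) u
    have h3 := h.nonneg u (γ.toFun c')
    have h4 : p (γ.toFun c) u ∈ convexSub n k :=
      ZVec.mem_convexSub_of_le h2 (by grind) (h1 ▸ sub_mem c'.2.1 c.2.1)
    have h5 := γ.dist_add c ⟨_, h4, h2⟩
    refine ⟨c + ⟨_, h4, h2⟩, h.eq_of_between (y := γ.toFun c') ?_ hu h5⟩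
    rw [h5, γ.dist_of_le (by rw [coe_cone_add]; grind), h1, coe_cone_add]
    abel
  rcases le_total (c : ZVec n) c' with hc | hc
  · exact key c c' hc hu
  · refine key c' c hc ?_
    rw [h.symm (γ.toFun c') u, h.symm u (γ.toFun c), h.symm (γ.toFun c') (γ.toFun c), ← hu,
      add_comm]

end Ray

open Classical in
/-- The neighbour of `u` on the way to the end of the ray `γ`. -/
noncomputable def rayDir {k : ℕ} (γ : Ray p k) (u : Γ) : Γ :=
  if h : ∃ w, ∃ c₀ : cone n k, ∀ c, dir p u (γ.toFun (c₀ + c)) = w then h.choose else u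

theorem rayDir_eq {k : ℕ} {γ : Ray p k} {u w : Γ} (c₀ : cone n k)
    (hw : ∀ c, dir p u (γ.toFun (c₀ + c)) = w) : rayDir γ u = w := by
  have h1 : ∃ w, ∃ c₀ : cone n k, ∀ c, dir p u (γ.toFun (c₀ + c)) = w := ⟨w, c₀, hw⟩
  rw [rayDir, dif_pos h1]
  obtain ⟨c₁, hc₁⟩ := h1.choose_spec
  rw [← hw c₁, ← hc₁ c₀, add_comm]

namespace IsZTree

variable [NeZero n] (h : IsZTree p)
include h

theorem dir_ray {k : ℕ} (hk : 1 ≤ k) (γ : Ray p k) (c d : cone n k) :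
    dir p (γ.toFun c) (γ.toFun (c + coneOne n hk + d)) = γ.toFun (c + coneOne n hk) := by
  refine h.dir_eq (γ.dist_add _ _) ?_
  rw [γ.dist_add, add_assoc, γ.dist_add, coe_cone_add]
  exact (add_sub_cancel_left (e n 0) _).symm

theorem rayDir_apply {k : ℕ} (hk : 1 ≤ k) (γ : Ray p k) (c : cone n k) :
    rayDir γ (γ.toFun c) = γ.toFun (c + coneOne n hk) :=
  rayDir_eq _ (h.dir_ray hk γ c)

/-- A point off the ray is never between two points of the ray, so all of them lie in one direction
from it. -/
theorem dir_ray_of_not_mem {k : ℕ} (γ : Ray p k) {u : Γ} (hu : ¬ ∃ c, γ.toFun c = u)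
    (c : cone n k) : dir p u (γ.toFun c) = rayDir γ u := by
  have key : ∀ c c' : cone n k, dir p u (γ.toFun c) = dir p u (γ.toFun c') := by
    intro c c'
    rw [h.dir_eq_dir_iff (fun h' => hu ⟨c, h'.symm⟩) (fun h' => hu ⟨c', h'.symm⟩)]
    exact fun h' => hu (γ.mem_range_of_between h h')
  exact (rayDir_eq 0 fun d => key _ _).symm

theorem exists_dir_ray {k : ℕ} (hk : 1 ≤ k) (γ : Ray p k) (u : Γ) :
    ∃ c₀ : cone n k, ∀ c, dir p u (γ.toFun (c₀ + c)) = rayDir γ u := by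
  by_cases hu : ∃ c, γ.toFun c = u
  · obtain ⟨c, rfl⟩ := hu
    exact ⟨c + coneOne n hk, fun d => by rw [h.dir_ray, h.rayDir_apply hk]⟩
  · exact ⟨0, fun c => h.dir_ray_of_not_mem γ hu _⟩

/-- This separates ends from vertices, since the field of a vertex fixes that vertex. It also shows
that the default value in `rayDir` does not occur. -/
theorem rayDir_ne {k : ℕ} (hk : 1 ≤ k) (γ : Ray p k) (u : Γ) : rayDir γ u ≠ u := by
  obtain ⟨c, hc⟩ := h.exists_dir_ray hk γ u
  by_cases hu : γ.toFun (c + 0) = u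
  · rw [← hc (coneOne n hk)]
    refine h.dir_ne fun h' => ?_
    have h1 := γ.dist_add (c + 0) (coneOne n hk)
    rw [add_zero] at h1 hu
    rw [← h', hu, h.self] at h1
    exact ZVec.e_pos.ne h1
  · rw [← hc 0]
    exact h.dir_ne (Ne.symm hu)

theorem rayDir_of_sameTail {k : ℕ} (hk : 1 ≤ k) {γ γ' : Ray p k} (ht : γ.SameTail γ') :
    rayDir γ = rayDir γ' := by
  funext u
  obtain ⟨a, a', haa⟩ := ht
  obtain ⟨c, hc⟩ := h.exists_dir_ray hk γ u
  refine (rayDir_eq (a' + c) fun d => ?_).symm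
  rw [add_assoc, ← haa, ← add_assoc, add_comm a, add_assoc]
  exact hc _

omit [NeZero n] in
theorem opposite_symm {k : ℕ} {γ γ' : Ray p k} (ho : γ.Opposite γ') : γ'.Opposite γ := by
  obtain ⟨b, hb, hd⟩ := ho
  exact ⟨b, hb, fun c c' => by rw [h.symm, hd]; abel⟩

/-- The two rays together fill the segment between their starting points. On one ray, the next
vertex is on the way to the whole other ray; a point off both is not between them, so it sees them
in one direction. Hence `field` is well defined on glued ends. -/
theorem rayDir_of_opposite {k : ℕ} (hk : 1 ≤ k) (hkn : k < n) {γ γ' : Ray p k}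
    (ho : γ.Opposite γ') : rayDir γ = rayDir γ' := by
  have key : ∀ {γ γ' : Ray p k}, γ.Opposite γ' → ∀ c,
      rayDir γ (γ.toFun c) = rayDir γ' (γ.toFun c) := by
    rintro γ γ' ⟨b, hb, hd⟩ c
    rw [h.rayDir_apply hk]
    refine (rayDir_eq 0 fun d => ?_).symm
    refine h.dir_eq (γ.dist_add _ _) ?_
    rw [hd, hd, coe_cone_add c, coneOne]
    abel
  funext u
  by_cases h1 : ∃ c, γ.toFun c = u
  · obtain ⟨c, rfl⟩ := h1
    exact key ho c
  by_cases h2 : ∃ c, γ'.toFun c = u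
  · obtain ⟨c, rfl⟩ := h2
    exact (key (h.opposite_symm ho) c).symm
  rw [← h.dir_ray_of_not_mem γ h1 0, ← h.dir_ray_of_not_mem γ' h2 0,
    h.dir_eq_dir_iff (fun h' => h1 ⟨_, h'.symm⟩) (fun h' => h2 ⟨_, h'.symm⟩)]
  intro hb
  obtain ⟨b, hbk, hd⟩ := ho
  have hb0 : p (γ.toFun 0) (γ'.toFun 0) = b := by
    rw [hd]; simp
  have n1 := h.nonneg (γ.toFun 0) u
  have n2 := h.nonneg u (γ'.toFun 0)
  have hbm : b ∈ convexSub n (k + 1) := by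
    have := add_mem (ZVec.convexSub_mono (Nat.le_succ k) hbk) (ZVec.e_mem_convexSub (n := n) k)
    rwa [sub_add_cancel] at this
  have hcb : coord b k = 1 := by
    have := ZVec.coord_eq_zero hbk
    rw [ZVec.coord_sub, ZVec.coord_e hkn] at this
    omega
  have m1 := ZVec.mem_convexSub_of_le n1 (by grind) hbm
  have m2 := ZVec.mem_convexSub_of_le n2 (by grind) hbm
  have c1 := ZVec.coord_nonneg m1 n1
  have c2 := ZVec.coord_nonneg m2 n2
  -- A point between the two starting points splits a total of one in coordinate `k` into two
  -- non-negative integers, so it is at a distance in ℤᵏ from one starting point and lies on that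
  -- ray.
  have c3 : coord (p (γ.toFun 0) u) k + coord (p u (γ'.toFun 0)) k = 1 := by
    rw [← ZVec.coord_add, hb, hb0, hcb]
  by_cases c0 : coord (p (γ.toFun 0) u) k = 0
  · have m3 := ZVec.mem_convexSub_of_coord m1 c0
    refine h1 ⟨⟨_, m3, n1⟩, h.eq_of_between (x := γ.toFun 0) (y := γ'.toFun 0) ?_ hb ?_⟩
    · rw [γ.dist_zero, hd, hb0]; simp
    · exact γ.dist_zero _
  · have m3 := ZVec.mem_convexSub_of_coord m2 (by omega)
    have e1 := hd 0 ⟨_, m3, n2⟩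
    have e2 := γ'.dist_zero ⟨_, m3, n2⟩
    have e3 : ((0 : cone n k) : ZVec n) = 0 := rfl
    have e4 := h.symm (γ'.toFun 0) (γ'.toFun ⟨_, m3, n2⟩)
    exact h2 ⟨⟨_, m3, n2⟩, h.eq_of_between (x := γ.toFun 0) (y := γ'.toFun 0) (by grind) hb
      (by grind)⟩

end IsZTree

/-- The direction field of a point of the compactification: it assigns to a point `u` its neighbour
on the way to `x`, and `x` itself to the point `x`. -/
noncomputable def IsZTree.field [NeZero n] (h : IsZTree p) : Compactification p → Γ → Γ
  | Sum.inl v => fun u => dir p u v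
  | Sum.inr q => Quot.lift (fun r : AnyRay p => rayDir r.2) (by
      rintro _ _ (⟨γ, γ', ht⟩ | ⟨γ, γ', hk, ho⟩)
      · rename_i k
        exact h.rayDir_of_sameTail k.2.1 ht
      · rename_i k
        exact h.rayDir_of_opposite k.2.1 hk ho) q

/-- Direction fields that are consistent: they have the properties of fields that point to a
vertex. -/
structure Consistent (p : Γ → Γ → ZVec n) (D : Γ → Γ) : Prop where
  flow : ∀ u v, u ≠ v → D u = dir p u v ∨ D v = dir p v u
  asymm : ∀ u v, p u v = e n 0 → ¬ (D u = v ∧ D v = u)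
  nbr : ∀ u, D u = u ∨ p u (D u) = e n 0

namespace IsZTree

variable [NeZero n] (h : IsZTree p)

theorem field_vertex (v u : Γ) : h.field (vertex v) u = dir p u v := rfl

theorem field_endOf {k : ℕ} (hk : k ∈ Set.Icc 1 n) (γ : Ray p k) (u : Γ) :
    h.field (endOf hk γ) u = rayDir γ u := rfl

theorem cases (x : Compactification p) :
    (∃ v, x = vertex v) ∨ ∃ (k : ℕ) (hk : k ∈ Set.Icc 1 n) (γ : Ray p k), x = endOf hk γ := by
  rcases x with v | q
  · exact Or.inl ⟨v, rfl⟩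
  · obtain ⟨⟨⟨k, hk⟩, γ⟩, rfl⟩ := Quot.exists_rep q
    exact Or.inr ⟨k, hk, γ, rfl⟩

/-- Sufficiently far out on a ray there is a vertex that is indistinguishable from the end at both
given points. So a property that involves two vertices at a time passes from fields of vertices to
fields of ends. -/
theorem exists_vertex_field (x : Compactification p) (u v : Γ) :
    ∃ w, h.field x u = dir p u w ∧ h.field x v = dir p v w := by
  rcases cases x with ⟨w, rfl⟩ | ⟨k, hk, γ, rfl⟩
  · exact ⟨w, rfl, rfl⟩
  · obtain ⟨c, hc⟩ := h.exists_dir_ray hk.1 γ u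
    obtain ⟨d, hd⟩ := h.exists_dir_ray hk.1 γ v
    exact ⟨γ.toFun (c + d), (hc d).symm, by rw [add_comm]; exact (hd c).symm⟩

include h

theorem consistent_dir (w : Γ) : Consistent p (fun u => dir p u w) := by
  refine ⟨fun u v huv => ?_, ?_, ?_⟩
  · by_cases h1 : u = w
    · subst h1; exact Or.inr rfl
    by_cases h2 : v = w
    · subst h2; exact Or.inl rfl
    by_contra hc
    push Not at hc
    have a1 := (h.dir_ne_dir_iff h1 huv).1 hc.1
    have a2 := (h.dir_ne_dir_iff h2 huv.symm).1 hc.2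
    have := h.pos huv
    have := h.symm u v
    grind
  · rintro u v huv ⟨h1, h2⟩
    have hu : u ≠ w := by
      rintro rfl
      simp only [h.dir_self] at h1
      exact h.ne_of_adj huv h1
    have hv : v ≠ w := by
      rintro rfl
      simp only [h.dir_self] at h2
      exact h.ne_of_adj huv h2.symm
    obtain ⟨-, a2⟩ := h.dir_spec hu
    obtain ⟨-, b2⟩ := h.dir_spec hv
    rw [h1] at a2
    rw [h2] at b2
    have := ZVec.e_pos (n := n)
    grind
  · intro u
    by_cases hu : u = w
    · exact Or.inl (by rw [hu, h.dir_self])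
    · exact Or.inr (h.dir_spec hu).1

theorem consistent_field (x : Compactification p) : Consistent p (h.field x) := by
  refine ⟨fun u v huv => ?_, fun u v huv => ?_, fun u => ?_⟩
  · obtain ⟨w, h1, h2⟩ := h.exists_vertex_field x u v
    rw [h1, h2]
    exact (h.consistent_dir w).flow u v huv
  · obtain ⟨w, h1, h2⟩ := h.exists_vertex_field x u v
    rw [h1, h2]
    exact (h.consistent_dir w).asymm u v huv
  · obtain ⟨w, h1, -⟩ := h.exists_vertex_field x u u
    rw [h1]
    exact (h.consistent_dir w).nbr u

/-! ### Points of the compactification with the same field -/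

/-- At `γ (c + d)` the common field does not point back to the common point `γ c`. Off `γ'`, or on
`γ'` before `c'`, it would do so; hence `γ (c + d)` lies on `γ'` after `c'`, at distance `d`. -/
theorem mem_of_rayDir_eq {k k' : ℕ} (hk : 1 ≤ k) (hk' : 1 ≤ k') {γ : Ray p k} {γ' : Ray p k'}
    (hD : rayDir γ = rayDir γ') {c : cone n k} {c' : cone n k'} (hc : γ.toFun c = γ'.toFun c')
    (d : cone n k) :
    ∃ hd : (d : ZVec n) ∈ cone n k', γ.toFun (c + d) = γ'.toFun (c' + ⟨d, hd⟩) := by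
  by_cases hd0 : (d : ZVec n) = 0
  · refine ⟨by rw [hd0]; exact zero_mem _, ?_⟩
    have : d = 0 := Subtype.ext hd0
    subst this
    have h0 : (⟨((0 : cone n k) : ZVec n), by exact zero_mem _⟩ : cone n k') = 0 := rfl
    rw [h0, add_zero, add_zero, hc]
  have hd : 0 < (d : ZVec n) := lt_of_le_of_ne d.2.2 (Ne.symm hd0)
  have e0 := ZVec.e_pos (n := n)
  have h1 : p (γ'.toFun c') (γ.toFun (c + d)) = d := by rw [← hc, γ.dist_add]
  have hne : rayDir γ (γ.toFun (c + d)) ≠ dir p (γ.toFun (c + d)) (γ'.toFun c') := by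
    intro h2
    have h3 := (h.dir_spec (u := γ.toFun (c + d)) (v := γ'.toFun c') (by
      intro h'; rw [h', h.self] at h1; exact hd.ne h1)).2
    rw [← h2, h.rayDir_apply hk, ← hc, h.symm, add_assoc, γ.dist_add, h.symm _ (γ.toFun c),
      γ.dist_add, coe_cone_add] at h3
    have h4 : ((coneOne n hk : cone n k) : ZVec n) = e n 0 := rfl
    grind
  by_cases hu : ∃ c'', γ'.toFun c'' = γ.toFun (c + d)
  · obtain ⟨c'', hc''⟩ := hu
    rcases le_total (c' : ZVec n) c'' with hle | hle
    · have h5 := γ'.dist_of_le hle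
      rw [hc'', h1] at h5
      have hdm : (d : ZVec n) ∈ cone n k' := ⟨h5 ▸ sub_mem c''.2.1 c'.2.1, d.2.2⟩
      refine ⟨hdm, ?_⟩
      rw [← hc'']
      congr 1
      refine Subtype.ext ?_
      rw [coe_cone_add, h5]
      abel
    · exfalso
      have h5 := γ'.dist_of_le hle
      rw [hc'', h.symm, h1] at h5
      apply hne
      rw [hD, ← hc'', h.rayDir_apply hk']
      have h4 : ((coneOne n hk' : cone n k') : ZVec n) = e n 0 := rfl
      have h6 := e_le_of_pos hd
      refine (h.dir_eq (γ'.dist_add _ _) ?_).symm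
      rw [γ'.dist_of_le (by rw [coe_cone_add]; grind), γ'.dist_of_le hle, coe_cone_add]
      grind
  · exact absurd (by rw [hD, h.dir_ray_of_not_mem γ' hu]) hne

/-- The distance along a ray that runs towards `v`. -/
theorem dist_of_dir_eq {k : ℕ} (hk : 1 ≤ k) (γ : Ray p k) (v : Γ)
    (hv : ∀ c, dir p (γ.toFun c) v = γ.toFun (c + coneOne n hk)) (c : cone n k) :
    p (γ.toFun c) v = p (γ.toFun 0) v - c := by
  obtain ⟨w, h1, h2, h3⟩ := h.exists_median (γ.toFun 0) (γ.toFun c) v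
  obtain ⟨d, rfl⟩ := γ.mem_range_of_between h h1
  rw [γ.dist_zero] at h1 h2
  by_cases hdc : d = c
  · subst hdc
    grind
  · exfalso
    have hnn := h.nonneg (γ.toFun d) (γ.toFun c)
    -- The median lies on the ray at `d`. If `d < c`, the ray would leave the segment to `v` at `d`,
    -- although its next vertex there is the direction to `v`.
    have hle : (d : ZVec n) ≤ c := by rw [γ.dist_zero] at h1; grind
    have hlt : (d : ZVec n) < c := lt_of_le_of_ne hle fun h' => hdc (Subtype.ext h')
    have hle' := e_le_of_pos (sub_pos.2 hlt)
    have hn1 : γ.toFun d ≠ γ.toFun c := fun h' => by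
      have := γ.dist_of_le hle
      rw [h', h.self] at this
      grind
    have e0 := ZVec.e_pos (n := n)
    have hn2 : γ.toFun d ≠ v := fun h' => by
      have h4 := hv d
      rw [h', h.dir_self, ← h'] at h4
      have := γ.dist_add d (coneOne n hk)
      rw [← h4, h.self] at this
      exact e0.ne this
    refine (h.dir_ne_dir_iff hn1 hn2).2 h3 ?_
    rw [hv]
    have := h.dir_ray hk γ d ⟨c - d - e n 0, sub_mem (sub_mem c.2.1 d.2.1)
      (coneOne n hk).2.1, by grind⟩
    rw [← this]
    congr 2
    refine Subtype.ext ?_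
    change (c : ZVec n) = d + e n 0 + (c - d - e n 0)
    abel

end IsZTree

theorem e_not_mem_convexSub {k : ℕ} (hk : k < n) : e n k ∉ convexSub n k := fun h' => by
  have := ZVec.coord_eq_zero h'
  rw [ZVec.coord_e hk] at this
  omega

/-- Every positive element outside `ℤᵏ` is, up to `ℤᵏ`, at least the next coordinate vector. -/
theorem sub_mem_of_lt_e {k : ℕ} (hk : k < n) {d : ZVec n} (h0 : 0 ≤ d) (hd : d ∉ convexSub n k)
    (hlt : d < e n k) : d - e n k ∈ convexSub n k := by
  have m1 := ZVec.mem_convexSub_of_le h0 hlt.le (ZVec.e_mem_convexSub k)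
  have m2 := sub_mem m1 (ZVec.e_mem_convexSub k)
  refine ZVec.mem_convexSub_of_coord m2 ?_
  have c1 := ZVec.coord_nonneg m1 h0
  have c2 : coord d k ≠ 0 := fun h' => hd (ZVec.mem_convexSub_of_coord m1 h')
  have c3 := ZVec.coord_le (by rw [← neg_sub]; exact neg_mem m2) hlt.le
  rw [ZVec.coord_sub]
  rw [ZVec.coord_e hk] at *
  omega

namespace IsZTree

variable [NeZero n] (h : IsZTree p)
include h

/-- If the rays meet, each continues along the other, which forces equal types. If they are
disjoint, each runs towards the other, and between their starting points there is no room for a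
point off both; the resulting cut of the segment into two half-lines determines the types and the
length `b`. -/
theorem type_eq_of_rayDir_eq {k k' : ℕ} (hk : k ∈ Set.Icc 1 n) (hk' : k' ∈ Set.Icc 1 n)
    {γ : Ray p k} {γ' : Ray p k'} (hD : rayDir γ = rayDir γ') :
    k = k' ∧ ((∃ (c : cone n k) (c' : cone n k'), γ.toFun c = γ'.toFun c') ∨
      (k < n ∧ ∃ b, b - e n k ∈ convexSub n k ∧ ∀ (c : cone n k) (c' : cone n k'),
        p (γ.toFun c) (γ'.toFun c') = b - c - c')) := by
  by_cases hA : ∃ (c : cone n k) (c' : cone n k'), γ.toFun c = γ'.toFun c'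
  · refine ⟨?_, Or.inl hA⟩
    obtain ⟨c, c', hc⟩ := hA
    have key : ∀ {k k' : ℕ}, 1 ≤ k → k ≤ n → (∀ d ∈ cone n k, d ∈ cone n k') → k ≤ k' := by
      intro k k' h1 h2 hd
      by_contra hkk
      have h3 := (hd (e n (k - 1)) ⟨by
        have := ZVec.e_mem_convexSub (n := n) (k - 1)
        rwa [Nat.sub_add_cancel h1] at this, ZVec.e_nonneg' _⟩).1
      exact e_not_mem_convexSub (n := n) (k := k - 1) (by omega)
        (ZVec.convexSub_mono (by omega) h3)
    exact le_antisymm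
      (key hk.1 hk.2 fun d hd => (h.mem_of_rayDir_eq hk.1 hk'.1 hD hc ⟨d, hd⟩).1)
      (key hk'.1 hk'.2 fun d hd => (h.mem_of_rayDir_eq hk'.1 hk.1 hD.symm hc.symm ⟨d, hd⟩).1)
  have n1 : ∀ c, ¬ ∃ c', γ'.toFun c' = γ.toFun c := fun c ⟨c', hc⟩ => hA ⟨c, c', hc.symm⟩
  have n2 : ∀ c', ¬ ∃ c, γ.toFun c = γ'.toFun c' := fun c' ⟨c, hc⟩ => hA ⟨c, c', hc⟩
  have d1 : ∀ c c', p (γ.toFun c) (γ'.toFun c') = p (γ.toFun 0) (γ'.toFun c') - c := by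
    intro c c'
    refine h.dist_of_dir_eq hk.1 γ _ (fun c => ?_) c
    rw [h.dir_ray_of_not_mem γ' (n1 c), ← hD, h.rayDir_apply hk.1]
  have d2 : ∀ c c', p (γ.toFun c) (γ'.toFun c') = p (γ.toFun c) (γ'.toFun 0) - c' := by
    intro c c'
    rw [h.symm, h.symm _ (γ'.toFun 0)]
    refine h.dist_of_dir_eq hk'.1 γ' _ (fun c' => ?_) c'
    rw [h.dir_ray_of_not_mem γ (n2 c'), hD, h.rayDir_apply hk'.1]
  set b := p (γ.toFun 0) (γ'.toFun 0) with hb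
  have dd : ∀ c c', p (γ.toFun c) (γ'.toFun c') = b - c - c' := fun c c' => by
    rw [d2, d1]
  have hb0 : 0 ≤ b := h.nonneg _ _
  -- A point of the segment on neither ray would see the two rays in different directions, while
  -- both directions are the value of the common field.
  have hbt : ∀ t, 0 ≤ t → t ≤ b → t ∈ convexSub n k ∨ b - t ∈ convexSub n k' := by
    intro t h0 ht
    obtain ⟨u, hu1, hu2⟩ := h.between _ _ t h0 ht
    by_cases a1 : ∃ c, γ.toFun c = u
    · obtain ⟨c, rfl⟩ := a1
      left; rw [← hu1, γ.dist_zero]; exact c.2.1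
    by_cases a2 : ∃ c, γ'.toFun c = u
    · obtain ⟨c, rfl⟩ := a2
      right; rw [hb, ← hu2, h.symm, γ'.dist_zero]; exact c.2.1
    exfalso
    refine (h.dir_ne_dir_iff (fun h' => a1 ⟨_, h'.symm⟩) fun h' => a2 ⟨_, h'.symm⟩).2
      (?_ : p (γ.toFun 0) u + p u (γ'.toFun 0) = _) ?_
    · rw [hu1, hu2]; abel
    · rw [h.dir_ray_of_not_mem γ a1, h.dir_ray_of_not_mem γ' a2, hD]
  have b1 : b ∉ convexSub n k := fun hm => by
    refine hA ⟨⟨b, hm, hb0⟩, 0, h.eq_of ?_⟩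
    rw [dd]; simp
  have b2 : b ∉ convexSub n k' := fun hm => by
    refine hA ⟨0, ⟨b, hm, hb0⟩, h.eq_of ?_⟩
    rw [dd]; simp
  -- For different types, a point of the segment at distance `e n (min k k')` from the start of the
  -- ray of smaller type is too far to be on that ray and too close to be on the other.
  have k1 : k = k' := by
    rcases lt_trichotomy k k' with hlt | heq | hlt
    · exfalso
      have hkn : k < n := hlt.trans_le hk'.2
      have m := ZVec.convexSub_mono (Nat.succ_le_of_lt hlt) (ZVec.e_mem_convexSub (n := n) k)
      rcases hbt (e n k) (ZVec.e_nonneg' k) (ZVec.lt_of_not_mem hb0 b2 m).le with h1 | h1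
      · exact e_not_mem_convexSub hkn h1
      · exact b2 (by simpa using add_mem h1 m)
    · exact heq
    · exfalso
      have hkn : k' < n := hlt.trans_le hk.2
      have m := ZVec.convexSub_mono (Nat.succ_le_of_lt hlt) (ZVec.e_mem_convexSub (n := n) k')
      have hle := (ZVec.lt_of_not_mem hb0 b1 m).le
      have h0 := ZVec.e_nonneg' (n := n) k'
      rcases hbt (b - e n k') (by grind) (by grind) with h1 | h1
      · exact b1 (by simpa using add_mem h1 m)
      · rw [sub_sub_cancel] at h1
        exact e_not_mem_convexSub hkn h1
  subst k1
  have hkn : k < n := lt_of_le_of_ne hk.2 fun h' => by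
    subst h'; exact b1 (ZVec.mem_convexSub_self b)
  refine ⟨rfl, Or.inr ⟨hkn, b, ?_, dd⟩⟩
  rcases lt_or_ge b (e n k) with hlt | hge
  · exact sub_mem_of_lt_e hkn hb0 b1 hlt
  · rcases hbt (e n k) (ZVec.e_nonneg' k) hge with h1 | h1
    · exact absurd h1 (e_not_mem_convexSub hkn)
    · exact h1

theorem tail_or_opposite {k : ℕ} (hk : k ∈ Set.Icc 1 n) {γ γ' : Ray p k}
    (hD : rayDir γ = rayDir γ') : γ.SameTail γ' ∨ (k < n ∧ γ.Opposite γ') := by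
  rcases (h.type_eq_of_rayDir_eq hk hk hD).2 with ⟨c, c', hc⟩ | h1
  · exact Or.inl ⟨c, c', fun d => (h.mem_of_rayDir_eq hk.1 hk.1 hD hc d).2⟩
  · exact Or.inr h1

/-- The fixed vertex, if any, is recovered from the field; equal fields of two ends arise only from
the generators of `EndRel`. -/
theorem field_injective : Function.Injective h.field := by
  intro x y hxy
  rcases cases x with ⟨v, rfl⟩ | ⟨k, hk, γ, rfl⟩ <;> rcases cases y with ⟨w, rfl⟩ | ⟨l, hl, γ', rfl⟩
  · have h1 := congrFun hxy v
    rw [field_vertex, field_vertex, h.dir_self] at h1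
    by_contra hc
    exact h.dir_ne (fun h' : v = w => hc (by rw [h'])) h1.symm
  · have h1 := congrFun hxy v
    rw [field_vertex, field_endOf, h.dir_self] at h1
    exact absurd h1.symm (h.rayDir_ne hl.1 γ' v)
  · have h1 := congrFun hxy w
    rw [field_vertex, field_endOf, h.dir_self] at h1
    exact absurd h1 (h.rayDir_ne hk.1 γ w)
  · have hD : rayDir γ = rayDir γ' := hxy
    have := (h.type_eq_of_rayDir_eq hk hl hD).1
    subst this
    rcases h.tail_or_opposite hk hD with ht | ⟨hkn, ho⟩
    · exact congrArg Sum.inr (Quot.sound (EndRel.tail (k := ⟨k, hk⟩) γ γ' ht))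
    · exact congrArg Sum.inr (Quot.sound (EndRel.glue (k := ⟨k, hk⟩) γ γ' hkn ho))

theorem endOf_eq {k : ℕ} (hk : k ∈ Set.Icc 1 n) {γ γ' : Ray p k}
    (he : (endOf hk γ : Compactification p) = endOf hk γ') :
    γ.SameTail γ' ∨ (k < n ∧ γ.Opposite γ') :=
  h.tail_or_opposite hk (congrArg h.field he)

theorem endOf_eq_of_sameTail {k : ℕ} (hk : k ∈ Set.Icc 1 n) {γ γ' : Ray p k}
    (ht : γ.SameTail γ') : (endOf hk γ : Compactification p) = endOf hk γ' :=
  congrArg Sum.inr (Quot.sound (EndRel.tail (k := ⟨k, hk⟩) γ γ' ht))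

end IsZTree

end

section

variable {n : ℕ} {Γ : Type*} {p : Γ → Γ → ZVec n}

/-! ### Every consistent direction field comes from a point -/

/-- An initial segment of the positive cone without a maximum is the downward closure of a coset
of some `ℤᵏ`. -/
theorem exists_cut [NeZero n] {J : Set (ZVec n)} (h0 : 0 ∈ J) (hnn : ∀ a ∈ J, 0 ≤ a)
    (hdown : ∀ a ∈ J, ∀ b, 0 ≤ b → b ≤ a → b ∈ J) (hsucc : ∀ a ∈ J, a + e n 0 ∈ J) :
    ∃ k ∈ Set.Icc 1 n, ∃ b ∈ J, (∀ c ∈ cone n k, b + c ∈ J) ∧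
      ∀ a ∈ J, ∃ c ∈ cone n k, a ≤ b + c := by
  classical
  have hn : 1 ≤ n := Nat.one_le_iff_ne_zero.2 (NeZero.ne n)
  -- The wanted `k` is the greatest type of half-line under which `J` is stable; `P 1` is iteration
  -- of the successor.
  let P : ℕ → Prop := fun k => ∀ a ∈ J, ∀ c ∈ cone n k, a + c ∈ J
  have hP1 : P 1 := by
    intro a ha c hc
    have h1 := ZVec.eq_zsmul_of_mem_one hc.1
    obtain ⟨j, hj⟩ := Int.eq_ofNat_of_zero_le (ZVec.coord_nonneg (m := 0) hc.1 hc.2)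
    rw [hj] at h1
    rw [h1]
    clear h1 hj hc
    induction j with
    | zero => simpa using ha
    | succ j ih =>
      have := hsucc _ ih
      rwa [add_assoc, ← add_one_zsmul] at this
  have hPk : P (Nat.findGreatest P n) := Nat.findGreatest_spec hn hP1
  have hk1 : 1 ≤ Nat.findGreatest P n := Nat.le_findGreatest hn hP1
  have hkn : Nat.findGreatest P n ≤ n := Nat.findGreatest_le n
  have hnot : Nat.findGreatest P n < n → ¬ P (Nat.findGreatest P n + 1) := fun h =>
    Nat.findGreatest_is_greatest (Nat.lt_succ_self _) h
  generalize Nat.findGreatest P n = k at hPk hk1 hkn hnot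
  rcases hkn.eq_or_lt with rfl | hkn'
  · exact ⟨k, ⟨hk1, le_rfl⟩, 0, h0, fun c hc => hPk 0 h0 c hc, fun a ha =>
      ⟨a, ⟨ZVec.mem_convexSub_self a, hnn a ha⟩, by simp⟩⟩
  have hex := hnot hkn'
  simp only [P] at hex
  push Not at hex
  obtain ⟨a, ha, c, hc, hac⟩ := hex
  -- Stability under ℤᵏ⁺¹ fails at `a`, so some multiple of `e n k` leads out of `J`. With `i` the
  -- last multiple that stays inside, `b = a + i • e n k` lies in the highest coset of ℤᵏ that meets
  -- `J` above `b`.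
  let Q : ℕ → Prop := fun j => a + j • e n k ∉ J
  have hQ : ∃ j, Q j := by
    obtain ⟨j, hj⟩ := Int.eq_ofNat_of_zero_le (ZVec.coord_nonneg hc.1 hc.2)
    refine ⟨j + 1, fun h' => hac (hdown _ h' _ (add_nonneg (hnn a ha) hc.2) ?_)⟩
    have : c < (j + 1) • e n k := by
      refine ZVec.lt_of_coord_lt (sub_mem (nsmul_mem (ZVec.e_mem_convexSub k) _) hc.1) ?_
      rw [hj, ZVec.coord_nsmul, ZVec.coord_e hkn']
      simp
    grind
  obtain ⟨i, hi⟩ : ∃ i, Nat.find hQ = i + 1 :=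
    Nat.exists_eq_succ_of_ne_zero fun h' => by
      have := Nat.find_spec hQ
      rw [h'] at this
      exact this (by simpa using ha)
  have hb : a + i • e n k ∈ J := by
    by_contra h'
    exact Nat.find_min hQ (by omega : i < Nat.find hQ) h'
  have hbe : a + i • e n k + e n k ∉ J := by
    have := Nat.find_spec hQ
    rw [hi] at this
    simp only [Q] at this
    rwa [succ_nsmul, ← add_assoc] at this
  refine ⟨k, ⟨hk1, hkn⟩, _, hb, fun c hc => hPk _ hb c hc, fun a' ha' => ?_⟩
  set b := a + i • e n k
  rcases le_or_gt a' b with hle | hlt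
  · exact ⟨0, zero_mem _, by simpa using hle⟩
  have hd0 : 0 ≤ a' - b := by grind
  by_cases hd : a' - b ∈ convexSub n k
  · exact ⟨a' - b, ⟨hd, hd0⟩, by simp⟩
  exfalso
  have hb0 := hnn b hb
  have e0 := ZVec.e_nonneg' (n := n) k
  rcases le_or_gt (e n k) (a' - b) with h1 | h1
  · exact hbe (hdown _ ha' _ (by grind) (by grind))
  · have h2 := sub_mem_of_lt_e hkn' hd0 hd h1
    rw [← neg_mem_iff, neg_sub] at h2
    refine hbe ?_
    have := hPk _ ha' _ ⟨h2, by grind⟩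
    convert this using 1
    abel

namespace IsZTree

variable [NeZero n] (h : IsZTree p)
include h

theorem between_trans {v u w t : Γ} (hu : p v u + p u w = p v w) (ht : p v t + p t u = p v u) :
    p v t + p t w = p v w := by
  have := h.triangle v w t
  have := h.triangle t w u
  grind

theorem between_of_le {v u w t : Γ} (hu : p v u + p u w = p v w) (ht : p v t + p t w = p v w)
    (hle : p v t ≤ p v u) : p v t + p t u = p v u := by
  obtain ⟨s, h1, h2⟩ := h.between v u (p v t) (h.nonneg _ _) hle
  have hs : p v s + p s u = p v u := by grind
  have := h.eq_of_between (h.between_trans hu hs) ht h1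
  subst this
  exact hs

theorem dir_comm_of_between {v t w : Γ} (ht : p v t + p t w = p v w) (htw : t ≠ w) :
    dir p w t = dir p w v := by
  refine h.dir_of_between htw.symm ?_
  have := h.symm v t
  have := h.symm v w
  have := h.symm t w
  grind

/-- The ray is found by following the field from `v₀`, possibly past infinitely many steps: `R`
consists of all `u` towards which the field points along the whole segment from `v₀`. Its distances
from `v₀` satisfy the hypotheses of `exists_cut`. -/
theorem field_surjective_aux {D : Γ → Γ} (hD : Consistent p D) (hv : ∀ v, D v ≠ v) (v₀ : Γ) :
    ∃ (k : ℕ) (_ : k ∈ Set.Icc 1 n) (γ : Ray p k), rayDir γ = D := by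
  have e0 := ZVec.e_pos (n := n)
  let R : Set Γ := {u | ∀ t, p v₀ t + p t u = p v₀ u → t ≠ u → D t = dir p t u}
  have hR0 : v₀ ∈ R := by
    intro t ht hne
    rw [h.self] at ht
    have := h.nonneg v₀ t
    have := h.pos hne
    grind
  have hRdown : ∀ u ∈ R, ∀ t, p v₀ t + p t u = p v₀ u → t ∈ R := by
    intro u hu t ht s hs hst
    rw [hu s (h.between_trans ht hs)]
    · refine (h.dir_of_between hst ?_).symm
      have := h.between_trans ht hs
      grind
    · rintro rfl
      have := h.pos hst
      have := h.symm s t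
      have := h.nonneg v₀ t
      grind
  have hnbr : ∀ u, p u (D u) = e n 0 := fun u => (hD.nbr u).resolve_left (hv u)
  have hRsucc : ∀ u ∈ R, D u ∈ R ∧ p v₀ (D u) = p v₀ u + e n 0 := by
    intro u hu
    have hw := hnbr u
    have hB : p v₀ u + p u (D u) = p v₀ (D u) := by
      by_cases huv : u = v₀
      · rw [huv, h.self, zero_add]
      refine (h.dir_ne_dir_iff huv (h.ne_of_adj hw)).1 ?_
      rw [h.dir_of_adj hw]
      intro hc
      obtain ⟨a1, a2⟩ := h.dir_spec huv
      rw [hc] at a1 a2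
      have s1 := h.symm u v₀
      have s2 := h.symm (D u) v₀
      have s3 := h.symm u (D u)
      have h1 := hu (D u) (by grind) (h.ne_of_adj a1).symm
      rw [h.dir_of_adj (by rw [← s3, a1])] at h1
      exact hD.asymm u (D u) a1 ⟨rfl, h1⟩
    refine ⟨?_, by rw [← hB, hw]⟩
    intro s hs hne
    have h1 := h.one_le hne
    have hsu := h.between_of_le hB hs (by grind)
    by_cases hsu' : s = u
    · subst hsu'
      rw [h.dir_of_adj hw]
    · rw [hu s hsu hsu']
      refine h.dir_of_between hsu' ?_
      grind
  -- If two points of `R` branched off each other, the field would have two values at the branch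
  -- point.
  have hRlin : ∀ u ∈ R, ∀ u' ∈ R, p v₀ u ≤ p v₀ u' → p v₀ u + p u u' = p v₀ u' := by
    intro u hu u' hu' hle
    obtain ⟨m, h1, h2, h3⟩ := h.exists_median v₀ u u'
    by_cases hmu : m = u
    · subst hmu; exact h2
    by_cases hmu' : m = u'
    · subst hmu'
      have := h.pos hmu
      grind
    exfalso
    exact (h.dir_ne_dir_iff hmu hmu').2 h3 (by rw [← hu m h1 hmu, ← hu' m h2 hmu'])
  have hRinj : ∀ u ∈ R, ∀ u' ∈ R, p v₀ u = p v₀ u' → u = u' := by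
    intro u hu u' hu' he
    have := hRlin u hu u' hu' he.le
    exact h.eq_of (by grind)
  obtain ⟨k, hk, b, hb, hbc, hcof⟩ := exists_cut (J := (p v₀) '' R) ⟨v₀, hR0, h.self _⟩
    (by rintro _ ⟨u, -, rfl⟩; exact h.nonneg _ _)
    (by
      rintro _ ⟨u, hu, rfl⟩ b h0 hb
      obtain ⟨t, h1, h2⟩ := h.between _ _ b h0 hb
      exact ⟨t, hRdown u hu t (by grind), h1⟩)
    (by
      rintro _ ⟨u, hu, rfl⟩
      exact ⟨D u, (hRsucc u hu).1, (hRsucc u hu).2⟩)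
  choose f hfR hf using fun c : cone n k => hbc c c.2
  have hfle : ∀ c c' : cone n k, (c : ZVec n) ≤ c' → p (f c) (f c') = c' - c := by
    intro c c' hc
    have := hRlin _ (hfR c) _ (hfR c') (by rw [hf, hf]; grind)
    rw [hf, hf] at this
    grind
  let γ : Ray p k := ⟨f, fun c c' => by
    rcases le_total (c : ZVec n) c' with hc | hc
    · rw [hfle c c' hc, abs_of_nonpos (by grind), neg_sub]
    · rw [h.symm, hfle c' c hc, abs_of_nonneg (by grind)]⟩
  have hDγ : ∀ c, D (γ.toFun c) = γ.toFun (c + coneOne n hk.1) := by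
    intro c
    obtain ⟨h1, h2⟩ := hRsucc _ (hfR c)
    refine hRinj _ h1 _ (hfR _) ?_
    rw [h2, hf, hf, coe_cone_add, add_assoc]
    rfl
  refine ⟨k, hk, γ, funext fun u => ?_⟩
  by_cases hur : ∃ c, γ.toFun c = u
  · obtain ⟨c, rfl⟩ := hur
    rw [h.rayDir_apply hk.1, hDγ]
  rw [← h.dir_ray_of_not_mem γ hur 0]
  have hu0 : u ≠ γ.toFun 0 := fun h' => hur ⟨0, h'.symm⟩
  by_cases huR : u ∈ R
  · obtain ⟨c, hc, hle⟩ := hcof _ ⟨u, huR, rfl⟩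
    have h1 : γ.toFun ⟨c, hc⟩ ∈ R := hfR _
    have h2 : p v₀ (γ.toFun ⟨c, hc⟩) = b + c := hf _
    rw [h1 u (hRlin u huR _ h1 (by rw [h2]; exact hle)) (fun h' => hur ⟨_, h'.symm⟩),
      h.dir_ray_of_not_mem γ hur, h.dir_ray_of_not_mem γ hur]
  -- Here `u` is off `R`. If the field at `γ 0` points to `u`, then `γ 0` is between `v₀` and `u`.
  -- The field fails to point to `u` at some `t` before `u`, so it points back at `u`, towards `v₀`
  -- and hence towards `γ 0`.
  · rcases hD.flow u (γ.toFun 0) hu0 with h1 | h1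
    · exact h1.symm
    rw [hDγ] at h1
    have hB : p v₀ (γ.toFun 0) + p (γ.toFun 0) u = p v₀ u := by
      by_cases hv0 : γ.toFun 0 = v₀
      · rw [hv0, h.self, zero_add]
      refine (h.dir_ne_dir_iff hv0 hu0.symm).1 ?_
      rw [← h1]
      intro hc
      have h2 := (h.dir_spec hv0).2
      rw [hc, h.symm, h.symm (γ.toFun 0)] at h2
      have h3 : p v₀ (γ.toFun (0 + coneOne n hk.1)) = b + _ := hf _
      have h4 : p v₀ (γ.toFun 0) = b + _ := hf _
      rw [h3, h4] at h2
      have h5 : ((0 + coneOne n hk.1 : cone n k) : ZVec n) = 0 + e n 0 := rfl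
      have h6 : ((0 : cone n k) : ZVec n) = 0 := rfl
      grind
    simp only [R, Set.mem_ofPred_eq] at huR
    push Not at huR
    obtain ⟨t, ht, htu, hDt⟩ := huR
    rw [(hD.flow t u htu).resolve_left hDt, h.dir_comm_of_between ht htu,
      h.dir_comm_of_between hB hu0.symm]

theorem exists_field_eq [Nonempty Γ] {D : Γ → Γ} (hD : Consistent p D) :
    ∃ x, h.field x = D := by
  by_cases hv : ∃ v, D v = v
  · obtain ⟨v, hv⟩ := hv
    refine ⟨vertex v, funext fun u => ?_⟩
    rw [field_vertex]
    by_cases huv : u = v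
    · rw [huv, hv, h.dir_self]
    · refine ((hD.flow u v huv).resolve_right fun h' => ?_).symm
      exact h.dir_ne (Ne.symm huv) (h'.symm.trans hv)
  · push Not at hv
    obtain ⟨k, hk, γ, hγ⟩ := h.field_surjective_aux hD hv (Classical.arbitrary Γ)
    exact ⟨endOf hk γ, hγ⟩

end IsZTree

/-! ### Compactness of the space of consistent fields -/

/-- By Tychonoff: each value lies in a finite set, and each condition is closed because it depends
on at most two coordinates with values in a discrete space. -/
theorem isCompact_consistent (hf : ZLocallyFinite p) :
    letI : TopologicalSpace Γ := ⊥
    IsCompact {D : Γ → Γ | Consistent p D} := by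
  let _ : TopologicalSpace Γ := ⊥
  have : DiscreteTopology Γ := ⟨rfl⟩
  have hK : IsCompact (Set.pi Set.univ fun v : Γ => insert v {w | p v w = e n 0}) :=
    isCompact_univ_pi fun v => ((hf v).insert v).isCompact
  refine hK.of_isClosed_subset ?_ fun D hD v _ => hD.nbr v
  have h1 : {D : Γ → Γ | Consistent p D} =
      (⋂ u, ⋂ v, {D | u ≠ v → D u = dir p u v ∨ D v = dir p v u}) ∩
        ((⋂ u, ⋂ v, {D | p u v = e n 0 → ¬ (D u = v ∧ D v = u)}) ∩
          ⋂ u, {D | D u = u ∨ p u (D u) = e n 0}) := by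
    ext D
    simp only [Set.mem_inter_iff, Set.mem_iInter, Set.mem_ofPred_eq]
    exact ⟨fun hD => ⟨hD.flow, hD.asymm, hD.nbr⟩, fun hD => ⟨hD.1, hD.2.1, hD.2.2⟩⟩
  rw [h1]
  have h2 : ∀ (u v : Γ) (s : Set (Γ × Γ)), IsClosed {D : Γ → Γ | (D u, D v) ∈ s} := fun u v s =>
    (isClosed_discrete s).preimage ((continuous_apply u).prodMk (continuous_apply v))
  refine (isClosed_iInter fun u => isClosed_iInter fun v => ?_).inter
    ((isClosed_iInter fun u => isClosed_iInter fun v => ?_).inter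
      (isClosed_iInter fun u => ?_))
  · exact h2 u v {q | u ≠ v → q.1 = dir p u v ∨ q.2 = dir p v u}
  · exact h2 u v {q | p u v = e n 0 → ¬ (q.1 = v ∧ q.2 = u)}
  · exact h2 u u {q | q.1 = u ∨ p u q.1 = e n 0}

end

section

variable {n : ℕ} {Γ : Type*} {p : Γ → Γ → ZVec n}

/-! ### Subtrees and their distances -/

variable (p) in
/-- The `ℤᵏ`-subtree of a point. -/
def subtreeOf (k : ℕ) (v : Γ) : Set Γ := {w | p v w ∈ convexSub n k}

theorem isSubtree_subtreeOf (k : ℕ) (v : Γ) : IsSubtree p k (subtreeOf p k v) := ⟨v, rfl⟩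

namespace IsZTree

variable (h : IsZTree p)
include h

theorem mem_trans {k : ℕ} {x y z : Γ} (h1 : p x y ∈ convexSub n k) (h2 : p y z ∈ convexSub n k) :
    p x z ∈ convexSub n k :=
  ZVec.mem_convexSub_of_le (h.nonneg _ _) (h.triangle x z y) (add_mem h1 h2)

theorem mem_subtreeOf_self (k : ℕ) (v : Γ) : v ∈ subtreeOf p k v := by
  change p v v ∈ convexSub n k
  rw [h.self]; exact zero_mem _

theorem mem_subtree_iff {k : ℕ} {T : Set Γ} (hT : IsSubtree p k T) {v w : Γ} (hv : v ∈ T) :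
    w ∈ T ↔ p v w ∈ convexSub n k := by
  obtain ⟨u, rfl⟩ := hT
  have h1 : p v u ∈ convexSub n k := h.symm v u ▸ hv
  exact ⟨fun hw => h.mem_trans h1 hw, fun hw => h.mem_trans (show p u v ∈ _ from hv) hw⟩

theorem subtree_eq {k : ℕ} {T T' : Set Γ} (hT : IsSubtree p k T) (hT' : IsSubtree p k T') {v : Γ}
    (hv : v ∈ T) (hv' : v ∈ T') : T = T' := by
  ext w
  rw [h.mem_subtree_iff hT hv, h.mem_subtree_iff hT' hv']

theorem subtree_eq_subtreeOf {k : ℕ} {T : Set Γ} (hT : IsSubtree p k T) {v : Γ} (hv : v ∈ T) :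
    T = subtreeOf p k v :=
  h.subtree_eq hT (isSubtree_subtreeOf k v) hv (h.mem_subtreeOf_self k v)

theorem subtree_nonempty {k : ℕ} {T : Set Γ} (hT : IsSubtree p k T) : T.Nonempty := by
  obtain ⟨v, rfl⟩ := hT
  exact ⟨v, h.mem_subtreeOf_self k v⟩

theorem subtreeOf_subset {k : ℕ} {T : Set Γ} (hT : IsSubtree p (k + 1) T) {v : Γ} (hv : v ∈ T) :
    subtreeOf p k v ⊆ T := fun _ hw =>
  (h.mem_subtree_iff hT hv).2 (ZVec.convexSub_mono (Nat.le_succ k) hw)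

theorem sub_dist_mem {k : ℕ} {v v' : Γ} (hv : p v v' ∈ convexSub n k) (w : Γ) :
    p v w - p v' w ∈ convexSub n k := by
  refine ZVec.abs_mem_convexSub.1 (ZVec.mem_convexSub_of_le (abs_nonneg _) ?_ hv)
  have := h.triangle v w v'
  have := h.triangle v' w v
  have := h.symm v v'
  grind

theorem coord_dist_congr {m : ℕ} {v v' w w' : Γ} (hv : p v v' ∈ convexSub n m)
    (hw : p w w' ∈ convexSub n m) : coord (p v w) m = coord (p v' w') m := by
  have h1 := ZVec.coord_eq_zero (h.sub_dist_mem hv w)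
  have h2 := ZVec.coord_eq_zero (h.sub_dist_mem hw v')
  rw [ZVec.coord_sub] at h1 h2
  rw [h.symm w, h.symm w'] at h2
  omega

theorem subtreeDist_eq {m : ℕ} {T S S' : Set Γ} (hT : IsSubtree p (m + 1) T)
    (hS : IsSubtree p m S) (hS' : IsSubtree p m S') (hST : S ⊆ T) (hST' : S' ⊆ T) {v w : Γ}
    (hv : v ∈ S) (hw : w ∈ S') : (subtreeDist p m S S' : ℤ) = coord (p v w) m := by
  have h1 := ZVec.coord_nonneg ((h.mem_subtree_iff hT (hST hv)).1 (hST' hw)) (h.nonneg v w)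
  obtain ⟨k, hk⟩ := Int.eq_ofNat_of_zero_le h1
  have h2 : {k : ℕ | ∃ v ∈ S, ∃ w ∈ S', coord (p v w) m = k} = {k} := by
    ext l
    simp only [Set.mem_singleton_iff]
    constructor
    · rintro ⟨v', hv', w', hw', hl⟩
      rw [← h.coord_dist_congr ((h.mem_subtree_iff hS hv).1 hv')
        ((h.mem_subtree_iff hS' hw).1 hw'), hk] at hl
      exact_mod_cast hl.symm
    · rintro rfl
      exact ⟨v, hv, w, hw, hk⟩
  rw [subtreeDist, h2, csInf_singleton, hk]

theorem subtree_eq_of_dist_eq_zero {m : ℕ} {T S S' : Set Γ} (hT : IsSubtree p (m + 1) T)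
    (hS : IsSubtree p m S) (hS' : IsSubtree p m S') (hST : S ⊆ T) (hST' : S' ⊆ T)
    (h0 : subtreeDist p m S S' = 0) : S = S' := by
  obtain ⟨v, hv⟩ := h.subtree_nonempty hS
  obtain ⟨w, hw⟩ := h.subtree_nonempty hS'
  have h1 := h.subtreeDist_eq hT hS hS' hST hST' hv hw
  rw [h0] at h1
  refine h.subtree_eq hS hS' ((h.mem_subtree_iff hS hv).2 ?_) hw
  exact ZVec.mem_convexSub_of_coord ((h.mem_subtree_iff hT (hST hv)).1 (hST' hw)) h1.symm

end IsZTree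

/-! ### The metric in terms of direction fields -/

variable (p) in
/-- The `ℤᵐ`-subtrees of `T`. -/
abbrev SubtreesIn (m : ℕ) (T : Set Γ) : Type _ := {S : Set Γ // IsSubtree p m S ∧ S ⊆ T}

variable (p) in
/-- The fields `D` and `D'` differ at a point of the `ℤ`-subtree of `w` at distance `j` from `w`. -/
def DifferAt (w : Γ) (D D' : Γ → Γ) (j : ℕ) : Prop := ∃ t, p w t = j • e n 0 ∧ D t ≠ D' t

open Classical in
variable (p) in
/-- The distance of two direction fields on the `ℤ`-subtree of `w`: it is `exp (-j)` if `j` is the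
least distance from `w` of a point where they differ. -/
noncomputable def rayFieldDist (w : Γ) (D D' : Γ → Γ) : ℝ :=
  if ∃ j, DifferAt p w D D' j then Real.exp (-(sInf {j | DifferAt p w D D' j} : ℕ)) else 0

/-- The distance of two direction fields on a `ℤᵐ`-subtree, `m ≥ 1`. -/
noncomputable def Choices.fieldDist (C : Choices p) : ℕ → Set Γ → (Γ → Γ) → (Γ → Γ) → ℝ
  | 0, _ => fun _ _ => 0
  | 1, T => rayFieldDist p (C.base T)
  | m + 2, T => fun D D' =>
      ∑' S : SubtreesIn p (m + 1) T, C.weight (m + 1) T S * Choices.fieldDist C (m + 1) S D D'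

theorem DifferAt.symm {w : Γ} {D D' : Γ → Γ} {j : ℕ} (hd : DifferAt p w D D' j) :
    DifferAt p w D' D j := by
  obtain ⟨t, h1, h2⟩ := hd
  exact ⟨t, h1, h2.symm⟩

theorem rayFieldDist_nonneg (w : Γ) (D D' : Γ → Γ) : 0 ≤ rayFieldDist p w D D' := by
  unfold rayFieldDist; split_ifs
  · positivity
  · exact le_rfl

theorem rayFieldDist_le_one (w : Γ) (D D' : Γ → Γ) : rayFieldDist p w D D' ≤ 1 := by
  unfold rayFieldDist; split_ifs
  · rw [Real.exp_le_one_iff]; simp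
  · exact zero_le_one

theorem rayFieldDist_comm (w : Γ) (D D' : Γ → Γ) :
    rayFieldDist p w D D' = rayFieldDist p w D' D := by
  have h1 : ∀ j, DifferAt p w D D' j ↔ DifferAt p w D' D j :=
    fun j => ⟨DifferAt.symm, DifferAt.symm⟩
  classical exact if_congr (exists_congr h1) (by simp only [h1]) rfl

theorem rayFieldDist_self (w : Γ) (D : Γ → Γ) : rayFieldDist p w D D = 0 := by
  rw [rayFieldDist, if_neg]
  rintro ⟨j, t, -, ht⟩
  exact ht rfl

theorem exp_le_rayFieldDist {w : Γ} {D D' : Γ → Γ} {j : ℕ} (hd : DifferAt p w D D' j) :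
    Real.exp (-j) ≤ rayFieldDist p w D D' := by
  rw [rayFieldDist, if_pos ⟨j, hd⟩, Real.exp_le_exp, neg_le_neg_iff]
  exact_mod_cast Nat.sInf_le hd

theorem rayFieldDist_eq {w : Γ} {D D' : Γ → Γ} {j : ℕ} (hd : DifferAt p w D D' j)
    (hmin : ∀ i < j, ¬ DifferAt p w D D' i) : rayFieldDist p w D D' = Real.exp (-j) := by
  have h1 : sInf {j | DifferAt p w D D' j} = j :=
    le_antisymm (Nat.sInf_le hd) (not_lt.1 fun h => hmin _ h (Nat.sInf_mem (s := {j | DifferAt p w D D' j}) ⟨j, hd⟩))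
  rw [rayFieldDist, if_pos ⟨j, hd⟩, h1]

/-- At the first vertex where `D` and `D''` differ, `D'` differs from one of them. -/
theorem rayFieldDist_triangle (w : Γ) (D D' D'' : Γ → Γ) :
    rayFieldDist p w D D'' ≤ rayFieldDist p w D D' + rayFieldDist p w D' D'' := by
  have n1 := rayFieldDist_nonneg (p := p) w D D'
  have n2 := rayFieldDist_nonneg (p := p) w D' D''
  by_cases hd : ∃ j, DifferAt p w D D'' j
  · obtain ⟨t, h1, h2⟩ := Nat.sInf_mem (s := {j | DifferAt p w D D'' j}) hd
    rw [rayFieldDist, if_pos hd]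
    by_cases h3 : D t = D' t
    · have := exp_le_rayFieldDist (D := D') (D' := D'') ⟨t, h1, h3 ▸ h2⟩
      linarith
    · have := exp_le_rayFieldDist (D := D) (D' := D') ⟨t, h1, h3⟩
      linarith
  · rw [rayFieldDist, if_neg hd]
    linarith

namespace Choices

variable (C : Choices p)

theorem weight_nonneg (m : ℕ) (T S : Set Γ) : 0 ≤ C.weight m T S := by
  unfold weight; split_ifs <;> positivity

theorem weight_pos (m : ℕ) (T S : Set Γ) : 0 < C.weight m T S := by
  unfold weight; split_ifs <;> positivity

/-- Level and number determine a subtree, so the weights are dominated by a double geometric series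
with sum `4`, plus `1` for the subtree of level zero, whose weight ignores its number. -/
theorem weight_summable (h : IsZTree p) {m : ℕ} (h1 : 1 ≤ m) (hmn : m < n) {T : Set Γ}
    (hT : IsSubtree p (m + 1) T) :
    Summable (fun S : SubtreesIn p m T => C.weight m T S) ∧
      ∑' S : SubtreesIn p m T, C.weight m T S ≤ 5 := by
  classical
  obtain ⟨hr1, hr2⟩ := C.root_spec m T h1 hmn hT
  let R : SubtreesIn p m T := ⟨C.root m T, hr1, hr2⟩
  let ι : SubtreesIn p m T → ℕ × ℕ := fun S =>
    (subtreeDist p m (C.root m T) S, C.index m S)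
  have hι : Function.Injective ι := by
    rintro ⟨S, hS⟩ ⟨S', hS'⟩ he
    have e1 : subtreeDist p m (C.root m T) S = subtreeDist p m (C.root m T) S' :=
      congrArg Prod.fst he
    have e2 : C.index m S = C.index m S' := congrArg Prod.snd he
    exact Subtype.ext (C.index_injOn m T _ h1 hmn hT ⟨hS.1, hS.2, rfl⟩ ⟨hS'.1, hS'.2, e1.symm⟩ e2)
  let g : ℕ × ℕ → ℝ := fun q => (1 / 2) ^ q.1 * (1 / 2) ^ q.2
  have hg : HasSum g (2 * 2) := by
    have h2 := hasSum_geometric_two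
    exact h2.mul h2 (h2.summable.mul_of_nonneg h2.summable (fun _ => by positivity)
      (fun _ => by positivity))
  have hgι : Summable fun S => g (ι S) := hg.summable.comp_injective hι
  have hgle : ∑' S, g (ι S) ≤ 2 * 2 := by
    rw [← hg.tsum_eq]
    exact tsum_comp_le_tsum_of_inj hg.summable (fun _ => by positivity) hι
  have hR : HasSum (fun S : SubtreesIn p m T => if S = R then (1 : ℝ) else 0) 1 :=
    hasSum_ite_eq R 1
  have hle : ∀ S : SubtreesIn p m T, C.weight m T S ≤ g (ι S) + if S = R then (1 : ℝ) else 0 := by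
    intro S
    have hp : 0 ≤ g (ι S) := by positivity
    unfold weight
    split_ifs with h2 h3 h3
    · linarith
    · exact absurd (Subtype.ext (h.subtree_eq_of_dist_eq_zero hT hr1 S.2.1 hr2 S.2.2 h2).symm) h3
    · rw [pow_add]; change g (ι S) ≤ _; linarith
    · rw [pow_add]; change g (ι S) ≤ _; linarith
  have hs := hgι.add hR.summable
  have hw := Summable.of_nonneg_of_le (fun S : SubtreesIn p m T => C.weight_nonneg m T S) hle hs
  refine ⟨hw, (hw.tsum_le_tsum hle hs).trans ?_⟩
  rw [Summable.tsum_add hgι hR.summable, hR.tsum_eq]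
  linarith

theorem fieldDist_nonneg (m : ℕ) (T : Set Γ) (D D' : Γ → Γ) : 0 ≤ C.fieldDist m T D D' := by
  induction m using Nat.twoStepInduction generalizing T with
  | zero => exact le_rfl
  | one => exact rayFieldDist_nonneg _ _ _
  | more m _ ih => exact tsum_nonneg fun S => mul_nonneg (C.weight_nonneg _ _ _) (ih _)

theorem fieldDist_comm (m : ℕ) (T : Set Γ) (D D' : Γ → Γ) :
    C.fieldDist m T D D' = C.fieldDist m T D' D := by
  induction m using Nat.twoStepInduction generalizing T with
  | zero => rfl
  | one => exact rayFieldDist_comm _ _ _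
  | more m _ ih => exact tsum_congr fun S => by rw [ih]

theorem fieldDist_self (m : ℕ) (T : Set Γ) (D : Γ → Γ) : C.fieldDist m T D D = 0 := by
  induction m using Nat.twoStepInduction generalizing T with
  | zero => rfl
  | one => exact rayFieldDist_self _ _
  | more m _ ih => exact (tsum_congr fun S => by rw [ih, mul_zero]).trans tsum_zero

/-- Each passage to the next level costs at most the total weight `5`. The uniform bound is the
majorant for summability and for dominated convergence. -/
theorem fieldDist_le (h : IsZTree p) {m : ℕ} (hmn : m ≤ n) {T : Set Γ} (hT : IsSubtree p m T)
    (D D' : Γ → Γ) : C.fieldDist m T D D' ≤ 5 ^ m := by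
  induction m using Nat.twoStepInduction generalizing T with
  | zero => simp [fieldDist]
  | one => exact (rayFieldDist_le_one _ _ _).trans (by norm_num)
  | more m _ ih =>
    obtain ⟨hs, hle⟩ := C.weight_summable h (Nat.succ_pos m) (by omega) hT
    have h1 : ∀ S : SubtreesIn p (m + 1) T, C.weight (m + 1) T S * C.fieldDist (m + 1) S D D' ≤
        C.weight (m + 1) T S * 5 ^ (m + 1) := fun S =>
      mul_le_mul_of_nonneg_left (ih (by omega) S.2.1) (C.weight_nonneg _ _ _)
    have h2 := hs.mul_right (5 ^ (m + 1) : ℝ)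
    refine (Summable.tsum_le_tsum h1 (Summable.of_nonneg_of_le (fun S => mul_nonneg
      (C.weight_nonneg _ _ _) (C.fieldDist_nonneg _ _ _ _)) h1 h2) h2).trans ?_
    rw [tsum_mul_right, pow_succ' _ (m + 1)]
    gcongr

theorem fieldDist_summable (h : IsZTree p) {m : ℕ} (h1 : 1 ≤ m) (hmn : m < n) {T : Set Γ}
    (hT : IsSubtree p (m + 1) T) (D D' : Γ → Γ) :
    Summable fun S : SubtreesIn p m T => C.weight m T S * C.fieldDist m S D D' := by
  refine Summable.of_nonneg_of_le (fun S => mul_nonneg (C.weight_nonneg _ _ _)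
    (C.fieldDist_nonneg _ _ _ _)) (fun S => ?_)
    ((C.weight_summable h h1 hmn hT).1.mul_right (5 ^ m : ℝ))
  exact mul_le_mul_of_nonneg_left (C.fieldDist_le h hmn.le S.2.1 _ _) (C.weight_nonneg _ _ _)

theorem fieldDist_triangle (h : IsZTree p) {m : ℕ} (hmn : m ≤ n) {T : Set Γ}
    (hT : IsSubtree p m T) (D D' D'' : Γ → Γ) :
    C.fieldDist m T D D'' ≤ C.fieldDist m T D D' + C.fieldDist m T D' D'' := by
  induction m using Nat.twoStepInduction generalizing T with
  | zero => simp [fieldDist]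
  | one => exact rayFieldDist_triangle _ _ _ _
  | more m _ ih =>
    have hs := C.fieldDist_summable h (Nat.succ_pos m) (by omega) hT
    simp only [fieldDist]
    rw [← (hs D D').tsum_add (hs D' D'')]
    refine (hs D D'').tsum_le_tsum (fun S => ?_) ((hs D D').add (hs D' D''))
    rw [← mul_add]
    exact mul_le_mul_of_nonneg_left (ih (by omega) S.2.1) (C.weight_nonneg _ _ _)

theorem eq_of_fieldDist_eq_zero [NeZero n] (h : IsZTree p) {m : ℕ} (h1 : 1 ≤ m) (hmn : m ≤ n)
    {T : Set Γ} (hT : IsSubtree p m T) {D D' : Γ → Γ} (h0 : C.fieldDist m T D D' = 0) :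
    ∀ t ∈ T, D t = D' t := by
  induction m using Nat.twoStepInduction generalizing T with
  | zero => omega
  | one =>
    intro t ht
    by_contra hne
    have h2 := (h.mem_subtree_iff hT (C.base_mem T hT)).1 ht
    obtain ⟨j, hj⟩ := Int.eq_ofNat_of_zero_le (ZVec.coord_nonneg (m := 0) h2 (h.nonneg _ _))
    have h3 := ZVec.eq_zsmul_of_mem_one h2
    rw [hj, natCast_zsmul] at h3
    have h4 := exp_le_rayFieldDist (p := p) (w := C.base T) (D := D) (D' := D') (j := j)
      ⟨t, h3, hne⟩
    have h5 : rayFieldDist p (C.base T) D D' = 0 := h0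
    have := Real.exp_pos (-(j : ℝ))
    linarith
  | more m _ ih =>
    intro t ht
    have hs := C.fieldDist_summable h (Nat.succ_pos m) (by omega) hT D D'
    have h2 := (hs.hasSum_iff.2 h0)
    have h3 := (hasSum_zero_iff_of_nonneg (fun S => mul_nonneg
      (C.weight_nonneg _ _ _) (C.fieldDist_nonneg _ _ _ _))).1 h2
    have h4 := congrFun h3 ⟨subtreeOf p (m + 1) t, isSubtree_subtreeOf _ _,
      h.subtreeOf_subset hT ht⟩
    refine ih (Nat.succ_pos m) (by omega) (isSubtree_subtreeOf (m + 1) t) ?_ t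
      (h.mem_subtreeOf_self _ _)
    exact (mul_eq_zero.1 h4).resolve_left (C.weight_pos _ _ _).ne'

theorem finite_ball (h : IsZTree p) (hf : ZLocallyFinite p) (w : Γ) (j : ℕ) :
    {t | p w t = j • e n 0}.Finite := by
  induction j with
  | zero =>
    refine (Set.finite_singleton w).subset fun t ht => ?_
    rw [Set.mem_ofPred_eq, zero_nsmul] at ht
    exact (h.eq_of ht).symm
  | succ j ih =>
    refine (ih.biUnion fun s _ => hf s).subset fun t ht => ?_
    rw [Set.mem_ofPred_eq, succ_nsmul] at ht
    have e0 := e_nonneg n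
    obtain ⟨s, h1, h2⟩ := h.between w t (j • e n 0) (nsmul_nonneg e0 j) (by grind)
    exact Set.mem_biUnion (x := s) h1 (by rw [Set.mem_ofPred_eq, h2, ht]; abel)

/-- Fields that eventually agree at every vertex become close. -/
theorem tendsto_fieldDist (h : IsZTree p) (hf : ZLocallyFinite p) {m : ℕ} (hmn : m ≤ n)
    {T : Set Γ} (hT : IsSubtree p m T) {α : Type*} {l : Filter α} {D D' : α → Γ → Γ}
    (hD : ∀ t, ∀ᶠ a in l, D a t = D' a t) :
    Tendsto (fun a => C.fieldDist m T (D a) (D' a)) l (𝓝 0) := by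
  induction m using Nat.twoStepInduction generalizing T with
  | zero => exact tendsto_const_nhds
  | one =>
    rw [Metric.tendsto_nhds]
    intro ε hε
    obtain ⟨N, hN⟩ : ∃ N : ℕ, Real.exp (-N) < ε := by
      have h1 : Tendsto (fun N : ℕ => Real.exp (-(N : ℝ))) atTop (𝓝 0) :=
        Real.tendsto_exp_neg_atTop_nhds_zero.comp tendsto_natCast_atTop_atTop
      exact (h1.eventually (gt_mem_nhds hε)).exists
    -- Only the finitely many vertices within distance `N` of the base point matter: fields that
    -- agree there are at distance less than `exp (-N)`.
    have hfin : (⋃ j ∈ Set.Iic N, {t | p (C.base T) t = j • e n 0}).Finite :=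
      (Set.finite_Iic N).biUnion fun j _ => finite_ball h hf _ j
    filter_upwards [(hfin.eventually_all).2 fun t _ => hD t] with a ha
    change |rayFieldDist p (C.base T) (D a) (D' a) - 0| < ε
    rw [sub_zero, abs_of_nonneg (rayFieldDist_nonneg _ _ _), rayFieldDist]
    split_ifs with hd
    · refine lt_of_le_of_lt ?_ hN
      rw [Real.exp_le_exp, neg_le_neg_iff]
      obtain ⟨t, h1, h2⟩ := Nat.sInf_mem (s := {j | DifferAt p (C.base T) (D a) (D' a) j}) hd
      by_contra hc
      exact h2 (ha t (Set.mem_biUnion (x := sInf {j | DifferAt p (C.base T) (D a) (D' a) j})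
        (by rw [Set.mem_Iic]; rw [not_le] at hc; exact_mod_cast hc.le) h1))
    · exact hε
  | more m _ ih =>
    have h1 := (C.weight_summable h (Nat.succ_pos m) (by omega) hT).1.mul_right
      (5 ^ (m + 1) : ℝ)
    have h2 := tendsto_tsum_of_dominated_convergence (𝓕 := l)
      (f := fun a (S : SubtreesIn p (m + 1) T) =>
        C.weight (m + 1) T S * C.fieldDist (m + 1) S (D a) (D' a)) (g := fun _ => 0) h1
      (fun S => by
        have := (ih (by omega) S.2.1).const_mul (C.weight (m + 1) T S)
        rwa [mul_zero] at this)
      (Eventually.of_forall fun a S => by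
        rw [Real.norm_of_nonneg (mul_nonneg (C.weight_nonneg _ _ _) (C.fieldDist_nonneg _ _ _ _))]
        exact mul_le_mul_of_nonneg_left (C.fieldDist_le h (by omega) S.2.1 _ _)
          (C.weight_nonneg _ _ _))
    rwa [tsum_zero] at h2

end Choices

end

section

variable {n : ℕ} {Γ : Type*} {p : Γ → Γ → ZVec n}

/-! ### Compactified subtrees and their chains -/

theorem Choices.fieldDist_eq_zero (C : Choices p) (h : IsZTree p) {m : ℕ} (hmn : m ≤ n)
    {T : Set Γ} (hT : IsSubtree p m T) {D D' : Γ → Γ} (hD : ∀ t ∈ T, D t = D' t) :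
    C.fieldDist m T D D' = 0 := by
  induction m using Nat.twoStepInduction generalizing T with
  | zero => rfl
  | one =>
    change rayFieldDist p _ _ _ = 0
    rw [rayFieldDist, if_neg]
    rintro ⟨j, t, h1, h2⟩
    refine h2 (hD t ((h.mem_subtree_iff hT (C.base_mem T hT)).2 ?_))
    rw [h1]
    exact nsmul_mem (ZVec.e_mem_convexSub 0) j
  | more m _ ih =>
    refine (tsum_congr fun S => ?_).trans tsum_zero
    rw [ih (by omega) S.2.1 fun t ht => hD t (S.2.2 ht), mul_zero]

/-- The triangle inequality reduces this to `fieldDist_eq_zero`. It allows the endpoints `x`, `y` to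
be replaced by the points `a i`, `a (i + 1)` inside one subtree of a chain. -/
theorem Choices.fieldDist_congr (C : Choices p) (h : IsZTree p) {m : ℕ} (hmn : m ≤ n)
    {T : Set Γ} (hT : IsSubtree p m T) {D D' E E' : Γ → Γ} (hD : ∀ t ∈ T, D t = E t)
    (hD' : ∀ t ∈ T, D' t = E' t) : C.fieldDist m T D D' = C.fieldDist m T E E' := by
  have h1 := C.fieldDist_eq_zero h hmn hT hD
  have h2 := C.fieldDist_eq_zero h hmn hT hD'
  have t1 := C.fieldDist_triangle h hmn hT D E D'
  have t2 := C.fieldDist_triangle h hmn hT E E' D'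
  have t3 := C.fieldDist_triangle h hmn hT E D E'
  have t4 := C.fieldDist_triangle h hmn hT D D' E'
  have c1 := C.fieldDist_comm m T E D
  have c2 := C.fieldDist_comm m T E' D'
  linarith

namespace IsZTree

variable [NeZero n] (h : IsZTree p)
include h

theorem dir_eq_of_subtree {m : ℕ} {S : Set Γ} (hS : IsSubtree p m S) {u s s' : Γ} (hs : s ∈ S)
    (hs' : s' ∈ S) (hu : u ∉ S) : dir p u s = dir p u s' := by
  rw [h.dir_eq_dir_iff (by rintro rfl; exact hu hs) (by rintro rfl; exact hu hs')]
  intro hb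
  refine hu ((h.mem_subtree_iff hS hs).2 (ZVec.mem_convexSub_of_le (h.nonneg _ _) ?_
    ((h.mem_subtree_iff hS hs).1 hs')))
  rw [← hb]
  exact le_add_of_nonneg_right (h.nonneg _ _)

/-- A subtree is convex, so a vertex outside it is not between two of its points and sees the whole
compactified subtree in one direction. -/
theorem field_of_mem_bar {m : ℕ} {S : Set Γ} (hS : IsSubtree p m S) {x : Compactification p}
    (hx : x ∈ bar m S) {u s : Γ} (hs : s ∈ S) (hu : u ∉ S) : h.field x u = dir p u s := by
  rcases hx with ⟨v, hv, rfl⟩ | ⟨k, hk, γ, -, hγ, rfl⟩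
  · exact h.dir_eq_of_subtree hS hv hs hu
  · rw [field_endOf, ← h.dir_ray_of_not_mem γ (fun ⟨c, hc⟩ => hu (hc ▸ hγ ⟨c, rfl⟩)) 0]
    exact h.dir_eq_of_subtree hS (hγ ⟨0, rfl⟩) hs hu

theorem exists_field_ne {m : ℕ} {T : Set Γ} (hT : IsSubtree p m T) {x y : Compactification p}
    (hx : x ∈ bar m T) (hy : y ∈ bar m T) (hxy : x ≠ y) : ∃ u ∈ T, h.field x u ≠ h.field y u := by
  obtain ⟨u, hu⟩ := Function.ne_iff.1 fun h' => hxy (h.field_injective h')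
  obtain ⟨s, hs⟩ := h.subtree_nonempty hT
  by_contra hc
  push Not at hc
  by_cases huT : u ∈ T
  · exact hu (hc u huT)
  · exact hu (by rw [h.field_of_mem_bar hT hx hs huT, h.field_of_mem_bar hT hy hs huT])

end IsZTree

/-! ### Chains of subtrees and sums along them -/

namespace IsChain

variable {m : ℕ} {T : Set Γ} {x y : Compactification p} {I : Set ℤ} {S : ℤ → Set Γ}
  {a : ℤ → Compactification p}

/-- Statements about the end of a chain follow from those about its start. The exit point `a (i +
1)` of `S i` becomes the entry point with index `-i`, hence the shift `1 - i`. -/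
theorem reverse (hc : IsChain m T x y I S a) :
    IsChain m T y x {i | -i ∈ I} (fun i => S (-i)) (fun i => a (1 - i)) := by
  refine ⟨?_, ⟨?_⟩, fun i hi => hc.subtree _ hi, fun i hi j hj => ?_, fun i hi hi' => ?_, ?_, ?_⟩
  · obtain ⟨i, hi⟩ := hc.nonempty
    exact ⟨-i, by simpa using hi⟩
  · intro i hi j hj k hk
    exact hc.interval.out hj hi ⟨neg_le_neg hk.2, neg_le_neg hk.1⟩
  · rw [hc.geodesic _ hi _ hj, abs_sub_comm]
    congr 1
    ring
  · have := hc.common (-(i + 1)) hi' (by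
      have : -(i + 1) + 1 = -i := by ring
      rw [this]; exact hi)
    have e1 : -(i + 1) + 1 = -i := by ring
    have e2 : 1 - (i + 1) = -i := by ring
    rw [e1] at this
    simp only [e2]
    exact ⟨this.2, this.1⟩
  · rcases hc.finish with ⟨i, hi, hy, hb⟩ | ⟨hb, N, h1, γ, hγ, hN⟩
    · refine Or.inl ⟨-i, ⟨by simpa using hi.1, fun j hj => ?_⟩, ?_, by simpa using hb⟩
      · have := hi.2 hj
        omega
      · simp only [sub_neg_eq_add, add_comm (1 : ℤ), hy]
    · refine Or.inr ⟨fun ⟨b, hb'⟩ => hb ⟨-b, fun j hj => ?_⟩, -N, h1, γ, hγ, fun i hi => hN _ ⟨hi.1, ?_⟩⟩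
      · have := hb' (show -j ∈ {i | -i ∈ I} by simpa using hj)
        omega
      · omega
  · rcases hc.start with ⟨i, hi, hy, hb⟩ | ⟨hb, N, h1, γ, hγ, hN⟩
    · refine Or.inl ⟨-i, ⟨by simpa using hi.1, fun j hj => ?_⟩, ?_, by simpa using hb⟩
      · have := hi.2 hj
        omega
      · rw [← hy]; congr 1; ring
    · refine Or.inr ⟨fun ⟨b, hb'⟩ => hb ⟨-b, fun j hj => ?_⟩, -N, h1, γ, hγ, fun i hi => hN _ ⟨hi.1, ?_⟩⟩
      · have := hb' (show -j ∈ {i | -i ∈ I} by simpa using hj)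
        omega
      · omega

theorem coord_dist (h : IsZTree p) (hT : IsSubtree p (m + 1) T) (hc : IsChain m T x y I S a)
    {i j : ℤ} (hi : i ∈ I) (hj : j ∈ I) {s s' : Γ} (hs : s ∈ S i) (hs' : s' ∈ S j) :
    coord (p s s') m = |i - j| := by
  rw [← hc.geodesic i hi j hj, h.subtreeDist_eq hT (hc.subtree i hi).1 (hc.subtree j hj).1
    (hc.subtree i hi).2 (hc.subtree j hj).2 hs hs']

theorem eq_of_mem (h : IsZTree p) (hT : IsSubtree p (m + 1) T) (hc : IsChain m T x y I S a)
    {i j : ℤ} (hi : i ∈ I) (hj : j ∈ I) {s : Γ} (hs : s ∈ S i) (hs' : s ∈ S j) : i = j := by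
  have h1 := hc.coord_dist h hT hi hj hs hs'
  rw [h.self, ZVec.coord_zero] at h1
  have := abs_eq_zero.1 h1.symm
  omega

variable [NeZero n]

/-- An infinite chain gives the direction to its end at every vertex. -/
theorem start_cases (h : IsZTree p) (hT : IsSubtree p (m + 1) T) (hc : IsChain m T x y I S a) :
    (∃ i, IsLeast I i ∧ a i = x ∧ x ∈ bar m (S i)) ∨
      ((∀ M, ∃ j ∈ I, j ≤ M) ∧
        ∀ u M, ∃ j ∈ I, j ≤ M ∧ ∃ s ∈ S j, h.field x u = dir p u s) := by
  rcases hc.start with h1 | ⟨hb, N, hk, γ, rfl, hN⟩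
  · exact Or.inl h1
  have hM : ∀ M, ∃ j ∈ I, j ≤ M := by
    by_contra hcon
    push Not at hcon
    obtain ⟨M, hM⟩ := hcon
    exact hb ⟨M, fun j hj => (hM j hj).le⟩
  refine Or.inr ⟨hM, fun u M => ?_⟩
  obtain ⟨c₀, hc₀⟩ := h.exists_dir_ray hk.1 γ u
  obtain ⟨i, hi, hiM⟩ := hM (min M N)
  obtain ⟨ci, hci⟩ := hN i ⟨hi, hiM.trans (min_le_right _ _)⟩
  -- Going `q` subtrees further left changes coordinate `m` of the ray parameter by `q`. Since `q`
  -- exceeds that coordinate of `ci`, a decrease would be negative; so the parameter grows, and it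
  -- passes `c₀`.
  set q : ℤ := max (coord (ci : ZVec n) m) (coord (c₀ : ZVec n) m) + 1 with hq
  have q1 := le_max_left (coord (ci : ZVec n) m) (coord (c₀ : ZVec n) m)
  have q2 := le_max_right (coord (ci : ZVec n) m) (coord (c₀ : ZVec n) m)
  have n1 := ZVec.coord_nonneg ci.2.1 ci.2.2
  have n2 := ZVec.coord_nonneg c₀.2.1 c₀.2.2
  obtain ⟨j', hj', hj'i⟩ := hM (i - q)
  have hj : i - q ∈ I := hc.interval.out hj' hi ⟨hj'i, by omega⟩
  have hjN : i - q ≤ min M N := by omega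
  obtain ⟨cj, hcj⟩ := hN _ ⟨hj, hjN.trans (min_le_right _ _)⟩
  refine ⟨i - q, hj, hjN.trans (min_le_left _ _), _, hcj, ?_⟩
  have h2 := hc.coord_dist h hT hi hj hci hcj
  rw [γ.isometry, show i - (i - q) = q by ring, abs_of_nonneg (show (0 : ℤ) ≤ q by omega)] at h2
  have n3 := ZVec.coord_nonneg cj.2.1 cj.2.2
  have h3 : coord (cj : ZVec n) m = coord (ci : ZVec n) m + q := by
    rcases abs_choice ((ci : ZVec n) - cj) with h' | h' <;> rw [h'] at h2
    · rw [ZVec.coord_sub] at h2; omega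
    · rw [ZVec.coord_neg, ZVec.coord_sub] at h2; omega
  have h4 : (c₀ : ZVec n) < cj := ZVec.lt_of_coord_lt (sub_mem cj.2.1 c₀.2.1) (by omega)
  have h5 := hc₀ ⟨cj - c₀, sub_mem cj.2.1 c₀.2.1, by grind⟩
  have h6 : c₀ + ⟨cj - c₀, sub_mem cj.2.1 c₀.2.1, by grind⟩ = cj :=
    Subtype.ext (add_sub_cancel (c₀ : ZVec n) cj)
  rw [h6] at h5
  rw [h5, IsZTree.field_endOf]

/-- From inside `S i`, all earlier subtrees of the chain lie behind the previous one, so they are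
seen in the same direction as the common end `a i`, and so is `x`. -/
theorem field_start (h : IsZTree p) (hT : IsSubtree p (m + 1) T) (hc : IsChain m T x y I S a)
    {i : ℤ} (hi : i ∈ I) : a i ∈ bar m (S i) ∧ ∀ u ∈ S i, h.field (a i) u = h.field x u := by
  by_cases hi' : i - 1 ∈ I
  · have h1 := hc.common (i - 1) hi' (by rwa [sub_add_cancel])
    rw [sub_add_cancel] at h1
    refine ⟨h1.2, fun u hu => ?_⟩
    obtain ⟨s', hs'⟩ := h.subtree_nonempty (hc.subtree _ hi').1
    have hne : ∀ j ∈ I, j < i → u ∉ S j := fun j hj hji hu' =>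
      hji.ne' (hc.eq_of_mem h hT hi hj hu hu')
    have key : ∀ j ∈ I, j < i → ∀ s ∈ S j, dir p u s = dir p u s' := by
      intro j hj hji s hs
      rw [h.dir_eq_dir_iff (by rintro rfl; exact hne j hj hji hs)
        (by rintro rfl; exact hne _ hi' (by omega) hs')]
      intro hb
      have h2 := congrArg (fun z => coord z m) hb
      simp only [ZVec.coord_add] at h2
      rw [hc.coord_dist h hT hj hi hs hu, hc.coord_dist h hT hi hi' hu hs',
        hc.coord_dist h hT hj hi' hs hs'] at h2
      grind
    rw [h.field_of_mem_bar (hc.subtree _ hi').1 h1.1 hs' (hne _ hi' (by omega))]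
    rcases hc.start_cases h hT with ⟨j, hj, -, hjx⟩ | ⟨-, h2⟩
    · have hji : j < i := lt_of_le_of_lt (hj.2 hi') (by omega)
      obtain ⟨s, hs⟩ := h.subtree_nonempty (hc.subtree _ hj.1).1
      rw [h.field_of_mem_bar (hc.subtree _ hj.1).1 hjx hs (hne _ hj.1 hji), key j hj.1 hji s hs]
    · obtain ⟨j, hj, hji, s, hs, he⟩ := h2 u (i - 1)
      rw [he, key j hj (by omega) s hs]
  · rcases hc.start_cases h hT with ⟨j, hj, hjx, hjb⟩ | ⟨h1, -⟩
    · have : j = i := by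
        have h2 := hj.2 hi
        by_contra hne
        exact hi' (hc.interval.out hj.1 hi ⟨by omega, by omega⟩)
      subst this
      rw [hjx]
      exact ⟨hjb, fun _ _ => rfl⟩
    · obtain ⟨j, hj, hji⟩ := h1 (i - 1)
      exact absurd (hc.interval.out hj hi ⟨hji, by omega⟩) hi'

theorem field_finish (h : IsZTree p) (hT : IsSubtree p (m + 1) T) (hc : IsChain m T x y I S a)
    {i : ℤ} (hi : i ∈ I) :
    a (i + 1) ∈ bar m (S i) ∧ ∀ u ∈ S i, h.field (a (i + 1)) u = h.field y u := by
  have := (hc.reverse).field_start h hT (i := -i) (by simpa using hi)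
  simpa only [neg_neg, sub_neg_eq_add, add_comm (1 : ℤ)] using this

theorem exists_dir_start (h : IsZTree p) (hT : IsSubtree p (m + 1) T)
    (hc : IsChain m T x y I S a) {u : Γ} (hu : ∀ i ∈ I, u ∉ S i) :
    ∃ i ∈ I, ∃ s ∈ S i, h.field x u = dir p u s := by
  rcases hc.start_cases h hT with ⟨j, hj, -, hjb⟩ | ⟨-, h1⟩
  · obtain ⟨s, hs⟩ := h.subtree_nonempty (hc.subtree _ hj.1).1
    exact ⟨j, hj.1, s, hs, h.field_of_mem_bar (hc.subtree _ hj.1).1 hjb hs (hu _ hj.1)⟩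
  · obtain ⟨j, hj, -, h2⟩ := h1 u 0
    exact ⟨j, hj, h2⟩

/-- A vertex off the chain has distance at least one, in coordinate `m`, from two consecutive
subtrees, which are at distance one from each other. So it is not between them and sees the whole
chain in one direction. -/
theorem field_off (h : IsZTree p) (hT : IsSubtree p (m + 1) T) (hc : IsChain m T x y I S a)
    {u : Γ} (huT : u ∈ T) (hu : ∀ i ∈ I, u ∉ S i) : h.field x u = h.field y u := by
  have hpos : ∀ i ∈ I, ∀ s ∈ S i, 1 ≤ coord (p u s) m := by
    intro i hi s hs
    have h1 := (h.mem_subtree_iff hT huT).1 ((hc.subtree i hi).2 hs)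
    have h2 := ZVec.coord_nonneg h1 (h.nonneg _ _)
    by_contra hcon
    refine hu i hi ((h.mem_subtree_iff (hc.subtree i hi).1 hs).2 ?_)
    rw [h.symm]
    exact ZVec.mem_convexSub_of_coord h1 (by omega)
  have hstep : ∀ i ∈ I, i + 1 ∈ I → ∀ s ∈ S i, ∀ s' ∈ S (i + 1), dir p u s = dir p u s' := by
    intro i hi hi' s hs s' hs'
    rw [h.dir_eq_dir_iff (by rintro rfl; exact hu i hi hs) (by rintro rfl; exact hu _ hi' hs')]
    intro hb
    have h2 := congrArg (fun z => coord z m) hb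
    simp only [ZVec.coord_add] at h2
    rw [hc.coord_dist h hT hi hi' hs hs', h.symm s] at h2
    have h3 := hpos i hi s hs
    have h4 := hpos _ hi' s' hs'
    simp at h2
    omega
  have hall : ∀ i ∈ I, ∀ j, i ≤ j → j ∈ I → ∀ s ∈ S i, ∀ s' ∈ S j, dir p u s = dir p u s' := by
    intro i hi j hij
    induction j, hij using Int.leInduction with
    | base =>
      intro _ s hs s' hs'
      exact h.dir_eq_of_subtree (hc.subtree i hi).1 hs hs' (hu i hi)
    | succ j hij ih =>
      intro hj s hs s' hs'
      have hj' : j ∈ I := hc.interval.out hi hj ⟨hij, by omega⟩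
      obtain ⟨t, ht⟩ := h.subtree_nonempty (hc.subtree _ hj').1
      rw [ih hj' s hs t ht, hstep j hj' hj t ht s' hs']
  obtain ⟨i, hi, s, hs, he⟩ := hc.exists_dir_start h hT hu
  obtain ⟨j, hj, s', hs', he'⟩ := (hc.reverse).exists_dir_start h hT (u := u)
    (fun i hi => hu _ hi)
  rw [he, he']
  rcases le_total i (-j) with hle | hle
  · exact hall i hi _ hle hj s hs s' hs'
  · exact (hall _ hj i hle hi s' hs' s hs).symm

/-- The sum along a chain is the sum over all subtrees. -/
theorem hasSum (h : IsZTree p) (C : Choices p) (hm : 1 ≤ m) (hmn : m < n)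
    (hT : IsSubtree p (m + 1) T) (hc : IsChain m T x y I S a) :
    HasSum (fun i : I => C.weight m T (S i) *
        C.fieldDist m (S i) (h.field (a i)) (h.field (a (i + 1))))
      (∑' R : SubtreesIn p m T, C.weight m T R * C.fieldDist m R (h.field x) (h.field y)) := by
  let ι : I → SubtreesIn p m T := fun i => ⟨S i, hc.subtree i i.2⟩
  have hι : Function.Injective ι := by
    intro i j hij
    obtain ⟨s, hs⟩ := h.subtree_nonempty (hc.subtree _ i.2).1
    have h1 : S i = S j := congrArg Subtype.val hij
    exact Subtype.ext (hc.eq_of_mem h hT i.2 j.2 hs (h1 ▸ hs))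
  have h1 := (C.fieldDist_summable h hm hmn hT (h.field x) (h.field y)).hasSum
  rw [← hι.hasSum_iff] at h1
  · convert h1 using 1
    funext i
    have h2 := hc.field_start h hT i.2
    have h3 := hc.field_finish h hT i.2
    rw [C.fieldDist_congr h hmn.le (hc.subtree _ i.2).1 h2.2 h3.2]
    rfl
  · rintro ⟨R, hR⟩ hRι
    rw [C.fieldDist_eq_zero h hmn.le hR.1, mul_zero]
    intro t ht
    refine hc.field_off h hT (hR.2 ht) fun i hi hti => hRι ⟨⟨i, hi⟩, ?_⟩
    exact Subtype.ext (h.subtree_eq (hc.subtree i hi).1 hR.1 hti ht)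

end IsChain

end

section

variable {n : ℕ} {Γ : Type*} {p : Γ → Γ → ZVec n}

namespace IsZTree

variable [NeZero n] (h : IsZTree p)
include h

/-! ### Existence of chains -/

/-- Every end of the `ℤᵏ`-subtree of `w` is represented by a ray from `w`. -/
theorem exists_rebase {k : ℕ} (γ : Ray p k) {w : Γ} (hw : p w (γ.toFun 0) ∈ convexSub n k) :
    ∃ γ' : Ray p k, γ'.toFun 0 = w ∧ γ.SameTail γ' := by
  let d : cone n k := ⟨p w (γ.toFun 0), hw, h.nonneg _ _⟩
  -- The median of `γ 0`, `w` and a far point is on `γ` at a parameter at most `d`, so after `d` the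
  -- ray runs straight away from `w`.
  have hB : ∀ e e' : cone n k, (d : ZVec n) ≤ e → (e : ZVec n) ≤ e' →
      p w (γ.toFun e) + p (γ.toFun e) (γ.toFun e') = p w (γ.toFun e') := by
    intro e e' hde hee
    obtain ⟨μ, h1, h2, h3⟩ := h.exists_median (γ.toFun 0) w (γ.toFun e')
    obtain ⟨q, rfl⟩ := γ.mem_range_of_between h h2
    rw [γ.dist_zero] at h1
    have h4 := h.symm (γ.toFun 0) w
    have h5 := h.nonneg (γ.toFun q) w
    have hqd : (q : ZVec n) ≤ d := by change (q : ZVec n) ≤ p w (γ.toFun 0); grind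
    have h6 := γ.dist_of_le (hqd.trans hde)
    have h7 := γ.dist_of_le (hqd.trans (hde.trans hee))
    have h8 := γ.dist_of_le hee
    have h9 := h.triangle w (γ.toFun e) (γ.toFun q)
    have h10 := h.triangle w (γ.toFun e') (γ.toFun e)
    grind
  have hd : ∀ c : cone n k, (d : ZVec n) ≤ (c + d : cone n k) := fun c => by
    rw [add_comm]; exact cone_le_add _ _
  have hle : ∀ c : cone n k, (c : ZVec n) ≤ p w (γ.toFun (c + d)) := by
    intro c
    have h1 := h.triangle (γ.toFun 0) (γ.toFun (c + d)) w
    rw [γ.dist_zero, coe_cone_add, h.symm _ w] at h1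
    change (c : ZVec n) + d ≤ d + _ at h1
    grind
  choose f hf1 hf2 using fun c : cone n k => h.between w (γ.toFun (c + d)) c c.2.2 (hle c)
  have hfB : ∀ c c' : cone n k, (c : ZVec n) ≤ c' →
      p w (f c) + p (f c) (γ.toFun (c' + d)) = p w (γ.toFun (c' + d)) := by
    intro c c' hc
    refine h.between_trans (hB (c + d) (c' + d) (hd c) ?_) ?_
    · rw [coe_cone_add, coe_cone_add]; gcongr
    · rw [hf1, hf2]; abel
  have hdist : ∀ c c' : cone n k, (c : ZVec n) ≤ c' → p (f c) (f c') = c' - c := by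
    intro c c' hc
    have h1 := h.between_of_le (hfB c' c' le_rfl) (hfB c c' hc) (by rw [hf1, hf1]; exact hc)
    rw [hf1, hf1] at h1
    grind
  refine ⟨⟨f, fun c c' => ?_⟩, (h.eq_of (by rw [hf1]; rfl)).symm, ?_⟩
  · rcases le_total (c : ZVec n) c' with hc | hc
    · rw [hdist c c' hc, abs_of_nonpos (by grind), neg_sub]
    · rw [h.symm, hdist c' c hc, abs_of_nonneg (by grind)]
  · have hg : p w (γ.toFun d) ∈ cone n k := by
      refine ⟨h.mem_trans hw ?_, h.nonneg _ _⟩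
      rw [γ.dist_zero]; exact d.2.1
    refine ⟨d, ⟨_, hg⟩, fun c => ?_⟩
    set g : cone n k := ⟨_, hg⟩
    have hgd : (d + c : cone n k) = c + d := add_comm _ _
    have e1 : p w (γ.toFun (d + c)) = (g + c : cone n k) := by
      rw [← hB d (d + c) le_rfl (cone_le_add _ _), γ.dist_add]; rfl
    refine h.eq_of_between (x := w) (y := γ.toFun (g + c + d)) ?_ (hfB _ _ le_rfl) ?_
    · refine hB _ _ (cone_le_add _ _) ?_
      have : g + c + d = (d + c) + g := by abel
      rw [this]; exact cone_le_add _ _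
    · rw [e1, hf1]

/-- Two adjacent subtrees have a common end. -/
theorem exists_common_end {m : ℕ} (hm : m ∈ Set.Icc 1 n) (hmn : m < n) {v w : Γ}
    (hvw : p v w ∈ convexSub n (m + 1)) (h1 : coord (p v w) m = 1) :
    ∃ z : Compactification p, z ∈ bar m (subtreeOf p m v) ∩ bar m (subtreeOf p m w) := by
  -- As coordinate `m` of `p v w` is one, the whole half-line of ℤᵐ lies below `p v w`, and the
  -- points of the segment at these distances from `v` form a ray.
  have key : ∀ v w : Γ, p v w ∈ convexSub n (m + 1) → coord (p v w) m = 1 →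
      ∃ γ : Ray p m, ∀ c, p v (γ.toFun c) = c ∧ p (γ.toFun c) w = p v w - c := by
    intro v w hvw h1
    have hle : ∀ c : cone n m, (c : ZVec n) ≤ p v w := fun c =>
      (ZVec.lt_of_coord_lt (m := m) (sub_mem hvw (ZVec.convexSub_mono (Nat.le_succ m) c.2.1))
        (by rw [ZVec.coord_eq_zero c.2.1, h1]; omega)).le
    choose f hf1 hf2 using fun c : cone n m => h.between v w c c.2.2 (hle c)
    have hdist : ∀ c c' : cone n m, (c : ZVec n) ≤ c' → p (f c) (f c') = c' - c := by
      intro c c' hc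
      have h1 := h.between_of_le (v := v) (w := w) (u := f c') (t := f c) (by grind) (by grind)
        (by rw [hf1, hf1]; exact hc)
      rw [hf1, hf1] at h1
      grind
    refine ⟨⟨f, fun c c' => ?_⟩, fun c => ⟨hf1 c, hf2 c⟩⟩
    rcases le_total (c : ZVec n) c' with hc | hc
    · rw [hdist c c' hc, abs_of_nonpos (by grind), neg_sub]
    · rw [h.symm, hdist c' c hc, abs_of_nonneg (by grind)]
  obtain ⟨γ, hγ⟩ := key v w hvw h1
  obtain ⟨γ', hγ'⟩ := key w v (by rwa [h.symm]) (by rwa [h.symm])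
  have hop : γ.Opposite γ' := by
    refine ⟨p v w, ZVec.mem_convexSub_of_coord (sub_mem hvw (ZVec.e_mem_convexSub m)) ?_,
      fun c c' => ?_⟩
    · rw [ZVec.coord_sub, h1, ZVec.coord_e hmn]; rfl
    · have a1 := (hγ c).1
      have a2 := (hγ c).2
      have a3 := (hγ' c').1
      have a4 := (hγ' c').2
      have s1 := h.symm w (γ'.toFun c')
      have s2 := h.symm v (γ'.toFun c')
      have s3 := h.symm v w
      have hle : (c : ZVec n) ≤ p v w - c' := by
        have h5 : (c + c' : cone n m).1 ≤ p v w := (ZVec.lt_of_coord_lt (m := m)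
          (sub_mem hvw (ZVec.convexSub_mono (Nat.le_succ m) (c + c').2.1))
          (by rw [ZVec.coord_eq_zero (c + c').2.1, h1]; omega)).le
        change (c : ZVec n) + c' ≤ _ at h5
        grind
      have h6 := h.between_of_le (v := v) (w := w) (u := γ'.toFun c') (t := γ.toFun c)
        (by grind) (by grind) (by grind)
      grind
  refine ⟨endOf hm γ, Or.inr ⟨m, hm, γ, le_rfl, ?_, rfl⟩, Or.inr ⟨m, hm, γ', le_rfl, ?_, ?_⟩⟩
  · rintro _ ⟨c, rfl⟩
    change p v _ ∈ convexSub n m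
    rw [(hγ c).1]; exact c.2.1
  · rintro _ ⟨c, rfl⟩
    change p w _ ∈ convexSub n m
    rw [(hγ' c).1]; exact c.2.1
  · exact congrArg Sum.inr (Quot.sound (EndRel.glue (k := ⟨m, hm⟩) γ γ' hmn hop))

end IsZTree

/-- The vertices `t i`, `i ∈ J`, are in the successive `ℤᵐ`-subtrees on the way from `w` to `x`. -/
structure HalfChain (h : IsZTree p) [NeZero n] (m : ℕ) (T : Set Γ) (w : Γ)
    (x : Compactification p) (J : Set ℕ) (t : ℕ → Γ) : Prop where
  zero_mem : 0 ∈ J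
  interval : J.OrdConnected
  start : t 0 = w
  mem : ∀ i ∈ J, t i ∈ T
  dist : ∀ i ∈ J, ∀ j ∈ J, i ≤ j → coord (p (t i) (t j)) m = j - i
  dir_eq : ∀ i ∈ J, 1 ≤ i → dir p w (t i) = h.field x w
  finish : (∃ N, IsGreatest J N ∧ x ∈ bar m (subtreeOf p m (t N))) ∨
    (J = Set.univ ∧ ∃ (hk : m + 1 ∈ Set.Icc 1 n) (γ : Ray p (m + 1)), x = endOf hk γ ∧
      ∀ i, ∃ c, γ.toFun c = t i)

namespace IsZTree

variable [NeZero n] (h : IsZTree p)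
include h

/-- The vertices are the points at distance `i • e n m` from `w` on a segment into the last subtree
or, for an end of type ℤᵐ⁺¹, on a ray from `w`. -/
theorem exists_halfChain {m : ℕ} (hmn : m < n) {T : Set Γ} (hT : IsSubtree p (m + 1) T) {w : Γ}
    (hw : w ∈ T) {x : Compactification p} (hx : x ∈ bar (m + 1) T) :
    ∃ J t, HalfChain h m T w x J t := by
  have he0 := ZVec.e_nonneg' (n := n) m
  have key : ∀ s ∈ T, x ∈ bar m (subtreeOf p m s) → ∃ J t, HalfChain h m T w x J t := by
    intro s hs hxs
    have hws := (h.mem_subtree_iff hT hw).1 hs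
    obtain ⟨N, hN⟩ := Int.eq_ofNat_of_zero_le (ZVec.coord_nonneg hws (h.nonneg w s))
    rcases Nat.eq_zero_or_pos N with rfl | hNpos
    · refine ⟨{0}, fun _ => w, rfl, Set.ordConnected_singleton, rfl, fun _ _ => hw, ?_, ?_, ?_⟩
      · rintro i rfl j rfl -
        simp [h.self]
      · rintro i rfl hi
        omega
      · refine Or.inl ⟨0, isGreatest_singleton, ?_⟩
        have : w ∈ subtreeOf p m s := by
          change p s w ∈ convexSub n m
          rw [h.symm]
          exact ZVec.mem_convexSub_of_coord hws hN
        rwa [← h.subtree_eq_subtreeOf (isSubtree_subtreeOf m s) this]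
    have hlt : ∀ i : ℕ, i < N → i • e n m ≤ p w s := fun i hi =>
      (ZVec.lt_of_coord_lt (m := m) (sub_mem hws (nsmul_mem (ZVec.e_mem_convexSub m) _)) (by
        rw [ZVec.coord_nsmul, ZVec.coord_e hmn, hN]; simpa using hi)).le
    -- The last vertex has to be `s` itself: lower coordinates of `p w s` may be negative, and then
    -- `N • e n m` exceeds the length of the segment.
    have hex : ∀ i : ℕ, ∃ t, (i < N → p w t = i • e n m ∧ p t s = p w s - i • e n m) ∧
        (N ≤ i → t = s) := by
      intro i
      rcases lt_or_ge i N with hi | hi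
      · obtain ⟨z, hz⟩ := h.between w s (i • e n m) (nsmul_nonneg he0 i) (hlt i hi)
        exact ⟨z, fun _ => hz, fun h' => absurd hi (not_lt.2 h')⟩
      · exact ⟨s, fun h' => absurd h' (not_lt.2 hi), fun _ => rfl⟩
    choose t ht1 ht2 using hex
    have htN : t N = s := ht2 N le_rfl
    have hB : ∀ i ≤ N, p w (t i) + p (t i) s = p w s ∧ coord (p w (t i)) m = i := by
      intro i hi
      rcases hi.eq_or_lt with rfl | hi
      · rw [htN, h.self]; exact ⟨add_zero _, hN⟩
      · obtain ⟨a1, a2⟩ := ht1 i hi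
        refine ⟨by rw [a1, a2]; abel, ?_⟩
        rw [a1, ZVec.coord_nsmul, ZVec.coord_e hmn, mul_one]
    have hmono : ∀ i j, i ≤ j → j ≤ N → p w (t i) ≤ p w (t j) := by
      intro i j hij hj
      rcases hij.eq_or_lt with rfl | hij
      · exact le_rfl
      refine (ZVec.lt_of_coord_lt (m := m) ?_ ?_).le
      · have hmem : ∀ i ≤ N, p w (t i) ∈ convexSub n (m + 1) := fun i hi =>
          ZVec.mem_convexSub_of_le (h.nonneg _ _)
            (by rw [← (hB i hi).1]; exact le_add_of_nonneg_right (h.nonneg _ _)) hws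
        exact sub_mem (hmem j hj) (hmem i (hij.le.trans hj))
      · rw [(hB i (hij.le.trans hj)).2, (hB j hj).2]
        exact_mod_cast hij
    refine ⟨Set.Iic N, t, Nat.zero_le N, Set.ordConnected_Iic, ?_, ?_, ?_, ?_, ?_⟩
    · refine (h.eq_of ?_).symm
      rw [(ht1 0 hNpos).1, zero_nsmul]
    · intro i hi
      refine (h.mem_subtree_iff hT hw).2 (ZVec.mem_convexSub_of_le (h.nonneg _ _) ?_ hws)
      rw [← (hB i hi).1]
      exact le_add_of_nonneg_right (h.nonneg _ _)
    · intro i hi j hj hij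
      have h1 := h.between_of_le (hB j hj).1 (hB i hi).1 (hmono i j hij hj)
      have h2 := congrArg (fun z => coord z m) h1
      simp only [ZVec.coord_add] at h2
      rw [(hB i hi).2, (hB j hj).2] at h2
      omega
    · intro i hi h1
      have hne : w ≠ t i := fun h' => by
        have := (hB i hi).2
        rw [← h', h.self, ZVec.coord_zero] at this
        omega
      rw [h.dir_of_between hne (hB i hi).1]
      refine (h.field_of_mem_bar (isSubtree_subtreeOf m s) hxs (h.mem_subtreeOf_self m s) ?_).symm
      intro hws'
      have := ZVec.coord_eq_zero (show p s w ∈ convexSub n m from hws')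
      rw [h.symm, hN] at this
      omega
    · exact Or.inl ⟨N, isGreatest_Iic, by rwa [htN]⟩
  rcases hx with ⟨v, hv, rfl⟩ | ⟨k, hk, γ, hkm, hγ, rfl⟩
  · exact key v hv (Or.inl ⟨v, h.mem_subtreeOf_self m v, rfl⟩)
  rcases hkm.eq_or_lt with rfl | hkm
  · obtain ⟨γ', h0, ht⟩ := h.exists_rebase γ (w := w)
      ((h.mem_subtree_iff hT hw).1 (hγ ⟨0, rfl⟩))
    rw [h.endOf_eq_of_sameTail hk ht]
    let c : ℕ → cone n (m + 1) := fun i =>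
      ⟨i • e n m, nsmul_mem (ZVec.e_mem_convexSub m) i, nsmul_nonneg he0 i⟩
    refine ⟨Set.univ, fun i => γ'.toFun (c i), trivial, Set.ordConnected_univ, ?_, ?_, ?_, ?_,
      Or.inr ⟨rfl, hk, γ', rfl, fun i => ⟨_, rfl⟩⟩⟩
    · rw [← h0]; congr 1; exact Subtype.ext (zero_nsmul _)
    · intro i _
      refine (h.mem_subtree_iff hT hw).2 ?_
      rw [← h0, γ'.dist_zero]
      exact (c i).2.1
    · intro i _ j _ hij
      rw [γ'.dist_of_le (nsmul_le_nsmul_left he0 hij), ZVec.coord_sub]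
      simp only [c, ZVec.coord_nsmul, ZVec.coord_e hmn]
      ring
    · intro i _ hi
      rw [field_endOf, ← h0, h.rayDir_apply hk.1]
      have hem : e n 0 ≤ i • e n m := by
        refine e_le_of_pos (ZVec.lt_of_coord_lt (m := m)
          (sub_mem (c i).2.1 (zero_mem _)) ?_)
        rw [ZVec.coord_nsmul, ZVec.coord_e hmn, ZVec.coord_zero]
        omega
      have := h.dir_ray hk.1 γ' 0 ⟨i • e n m - e n 0,
        sub_mem (c i).2.1 (coneOne n hk.1).2.1, sub_nonneg.2 hem⟩
      rw [← this]
      congr 2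
      refine Subtype.ext ?_
      change i • e n m = 0 + e n 0 + (i • e n m - e n 0)
      abel
  · refine key _ (hγ ⟨0, rfl⟩) (Or.inr ⟨k, hk, γ, by omega, ?_, rfl⟩)
    rintro _ ⟨c, rfl⟩
    change p _ _ ∈ convexSub n m
    rw [γ.dist_zero]
    exact ZVec.convexSub_mono (by omega) c.2.1

/-- At a vertex `w` of `T` where the fields of `x` and `y` differ, the half-chains to `x` and to `y`
leave in different directions, so they join to a geodesic of subtrees through that of `w`. -/
theorem exists_isChain {m : ℕ} (hm : 1 ≤ m) (hmn : m < n) {T : Set Γ}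
    (hT : IsSubtree p (m + 1) T) {x y : Compactification p} (hx : x ∈ bar (m + 1) T)
    (hy : y ∈ bar (m + 1) T) (hxy : x ≠ y) : ∃ I S a, IsChain m T x y I S a := by
  classical
  obtain ⟨w, hw, hne⟩ := h.exists_field_ne hT hx hy hxy
  obtain ⟨J, t, hJ⟩ := h.exists_halfChain hmn hT hw hx
  obtain ⟨J', t', hJ'⟩ := h.exists_halfChain hmn hT hw hy
  -- Non-positive indices follow the half-chain to `x`, non-negative ones that to `y`; both give `w`
  -- at index zero.
  let I : Set ℤ := {i | (0 ≤ i → i.toNat ∈ J') ∧ (i ≤ 0 → (-i).toNat ∈ J)}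
  let r : ℤ → Γ := fun i => if 0 ≤ i then t' i.toNat else t (-i).toNat
  have hr0 : ∀ i, 0 ≤ i → r i = t' i.toNat := fun i hi => if_pos hi
  have hr1 : ∀ i, i ≤ 0 → r i = t (-i).toNat := by
    intro i hi
    rcases hi.eq_or_lt with rfl | hi
    · rw [hr0 0 le_rfl]; simp [hJ.start, hJ'.start]
    · exact if_neg (not_le.2 hi)
  have hrT : ∀ i ∈ I, r i ∈ T := by
    intro i hi
    rcases le_total 0 i with h0 | h0
    · rw [hr0 i h0]; exact hJ'.mem _ (hi.1 h0)
    · rw [hr1 i h0]; exact hJ.mem _ (hi.2 h0)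
  have hdist : ∀ i ∈ I, ∀ j ∈ I, i ≤ j → coord (p (r i) (r j)) m = j - i := by
    intro i hi j hj hij
    rcases le_or_gt 0 i with h0 | h0
    · rw [hr0 i h0, hr0 j (h0.trans hij), hJ'.dist _ (hi.1 h0) _ (hj.1 (h0.trans hij))
        (Int.toNat_le_toNat hij)]
      omega
    rcases le_or_gt j 0 with h1 | h1
    · rw [hr1 i h0.le, hr1 j h1, h.symm, hJ.dist _ (hj.2 h1) _ (hi.2 h0.le)
        (Int.toNat_le_toNat (by omega))]
      omega
    rw [hr1 i h0.le, hr0 j h1.le]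
    have i1 := hJ.dist 0 hJ.zero_mem _ (hi.2 h0.le) (Nat.zero_le _)
    have i2 := hJ'.dist 0 hJ'.zero_mem _ (hj.1 h1.le) (Nat.zero_le _)
    rw [hJ.start] at i1
    rw [hJ'.start] at i2
    have n1 : w ≠ t (-i).toNat := fun h' => by
      rw [← h', h.self, ZVec.coord_zero] at i1
      omega
    have n2 : w ≠ t' j.toNat := fun h' => by
      rw [← h', h.self, ZVec.coord_zero] at i2
      omega
    have hb := (h.dir_ne_dir_iff n1 n2).1 (by
      rw [hJ.dir_eq _ (hi.2 h0.le) (by omega), hJ'.dir_eq _ (hj.1 h1.le) (by omega)]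
      exact hne)
    rw [← hb, ZVec.coord_add, h.symm, i1, i2]
    omega
  have hcommon : ∀ i, ∃ z : Compactification p, i - 1 ∈ I → i ∈ I →
      z ∈ bar m (subtreeOf p m (r (i - 1))) ∩ bar m (subtreeOf p m (r i)) := by
    intro i
    by_cases hi : i - 1 ∈ I ∧ i ∈ I
    · obtain ⟨z, hz⟩ := h.exists_common_end ⟨hm, hmn.le⟩ hmn (v := r (i - 1)) (w := r i)
        ((h.mem_subtree_iff hT (hrT _ hi.1)).1 (hrT _ hi.2)) (by
          rw [hdist _ hi.1 _ hi.2 (by omega)]; ring)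
      exact ⟨z, fun _ _ => hz⟩
    · exact ⟨x, fun h1 h2 => absurd ⟨h1, h2⟩ hi⟩
  choose z hz using hcommon
  have hI0 : 0 ∈ I := ⟨fun _ => by simpa using hJ'.zero_mem, fun _ => by simpa using hJ.zero_mem⟩
  have hsub : ∀ i ∈ I, IsSubtree p m (subtreeOf p m (r i)) ∧ subtreeOf p m (r i) ⊆ T :=
    fun i hi => ⟨isSubtree_subtreeOf _ _, h.subtreeOf_subset hT (hrT i hi)⟩
  -- The point with index `i` is the common end if both neighbouring subtrees exist; at the least
  -- index it is `x`, and just after the greatest one it is `y`.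
  refine ⟨I, fun i => subtreeOf p m (r i), fun i => if i - 1 ∈ I ∧ i ∈ I then z i else
    if i ∈ I then x else y, ⟨0, hI0⟩, ⟨?_⟩, hsub, ?_, ?_, ?_, ?_⟩
  · intro i hi j hj k hk
    refine ⟨fun h0 => ?_, fun h0 => ?_⟩
    · exact hJ'.interval.out hJ'.zero_mem (hj.1 (h0.trans hk.2))
        ⟨Nat.zero_le _, Int.toNat_le_toNat hk.2⟩
    · exact hJ.interval.out hJ.zero_mem (hi.2 (hk.1.trans h0))
        ⟨Nat.zero_le _, Int.toNat_le_toNat (by have := hk.1; omega)⟩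
  · intro i hi j hj
    rw [h.subtreeDist_eq hT (hsub i hi).1 (hsub j hj).1 (hsub i hi).2 (hsub j hj).2
      (h.mem_subtreeOf_self _ _) (h.mem_subtreeOf_self _ _)]
    rcases le_total i j with hij | hij
    · rw [hdist i hi j hj hij, abs_of_nonpos (by omega)]; ring
    · rw [h.symm, hdist j hj i hi hij, abs_of_nonneg (by omega)]
  · intro i hi hi'
    have h1 : i + 1 - 1 ∈ I := by rwa [add_sub_cancel_right]
    rw [if_pos ⟨h1, hi'⟩]
    have := hz (i + 1) h1 hi'
    rwa [add_sub_cancel_right] at this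
  · rcases hJ.finish with ⟨N, hN, hxN⟩ | ⟨rfl, hk, γ, hγ, hγt⟩
    · have h1 : -(N : ℤ) ∈ I := by
        refine ⟨fun h0 => ?_, fun _ => by simpa using hN.1⟩
        have : N = 0 := by omega
        subst this
        simpa using hJ'.zero_mem
      have h2 : ∀ i ∈ I, -(N : ℤ) ≤ i := by
        intro i hi
        by_contra hc
        have := hN.2 (hi.2 (by omega))
        omega
      refine Or.inl ⟨-N, ⟨h1, h2⟩, ?_, ?_⟩
      · rw [if_neg, if_pos h1]
        rintro ⟨h3, -⟩
        have := h2 _ h3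
        omega
      · rw [hr1 _ (by omega)]
        simpa using hxN
    · refine Or.inr ⟨?_, 0, hk, γ, hγ, fun i hi => ?_⟩
      · rintro ⟨b, hb⟩
        have := hb (show -(|b| + 1) ∈ I from ⟨fun h0 => by have := abs_nonneg b; omega,
          fun _ => trivial⟩)
        have := neg_abs_le b
        omega
      · obtain ⟨c, hc⟩ := hγt (-i).toNat
        refine ⟨c, ?_⟩
        rw [hc, ← hr1 i hi.2]
        exact h.mem_subtreeOf_self _ _
  · rcases hJ'.finish with ⟨N, hN, hxN⟩ | ⟨rfl, hk, γ, hγ, hγt⟩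
    · have h1 : (N : ℤ) ∈ I := by
        refine ⟨fun _ => by simpa using hN.1, fun h0 => ?_⟩
        have : N = 0 := by omega
        subst this
        simpa using hJ.zero_mem
      have h2 : ∀ i ∈ I, i ≤ (N : ℤ) := by
        intro i hi
        by_contra hc
        have := hN.2 (hi.1 (by omega))
        omega
      have h3 : (N : ℤ) + 1 ∉ I := fun h3 => by
        have := h2 _ h3
        omega
      refine Or.inl ⟨N, ⟨h1, h2⟩, ?_, ?_⟩
      · rw [if_neg (fun h4 => h3 h4.2), if_neg h3]
      · rw [hr0 _ (by omega)]
        simpa using hxN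
    · refine Or.inr ⟨?_, 0, hk, γ, hγ, fun i hi => ?_⟩
      · rintro ⟨b, hb⟩
        have := hb (show |b| + 1 ∈ I from ⟨fun _ => trivial,
          fun h0 => by have := abs_nonneg b; omega⟩)
        have := le_abs_self b
        omega
      · obtain ⟨c, hc⟩ := hγt i.toNat
        refine ⟨c, ?_⟩
        rw [hc, ← hr0 i hi.2]
        exact h.mem_subtreeOf_self _ _

end IsZTree

end

section

variable {n : ℕ} {Γ : Type*} {p : Γ → Γ → ZVec n}

/-! ### The metric of a compactified subtree -/

namespace IsZTree

variable [NeZero n] (h : IsZTree p)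
include h

theorem exists_approximates {T : Set Γ} (hT : IsSubtree p 1 T) {w : Γ} (hw : w ∈ T)
    {x : Compactification p} (hx : x ∈ bar 1 T) : ∃ u, Approximates w x u := by
  rcases hx with ⟨v, -, rfl⟩ | ⟨k, hk, γ, hk1, hγ, rfl⟩
  · exact ⟨fun _ => v, Or.inl ⟨v, rfl, fun _ => rfl⟩⟩
  · obtain rfl : k = 1 := le_antisymm hk1 hk.1
    obtain ⟨γ', h0, ht⟩ := h.exists_rebase γ (w := w)
      ((h.mem_subtree_iff hT hw).1 (hγ ⟨0, rfl⟩))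
    exact ⟨_, Or.inr ⟨hk, γ', h0, h.endOf_eq_of_sameTail hk ht, fun _ => rfl⟩⟩

theorem eventually_field_eq {w : Γ} {x : Compactification p} {u : ℕ → Γ}
    (hu : Approximates w x u) (t : Γ) : ∀ᶠ i in atTop, h.field x t = dir p t (u i) := by
  rcases hu with ⟨v, rfl, hv⟩ | ⟨hk, γ, -, rfl, hγ⟩
  · exact Eventually.of_forall fun i => by rw [hv, field_vertex]
  · obtain ⟨c₀, hc₀⟩ := h.exists_dir_ray le_rfl γ t
    obtain ⟨j, hj⟩ := Int.eq_ofNat_of_zero_le (ZVec.coord_nonneg (m := 0) c₀.2.1 c₀.2.2)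
    have h1 : c₀ = j • coneUnit n := Subtype.ext (by
      have := ZVec.eq_zsmul_of_mem_one c₀.2.1
      rw [hj, natCast_zsmul] at this
      exact this)
    filter_upwards [eventually_ge_atTop j] with i hi
    rw [hγ, field_endOf, ← hc₀ ((i - j) • coneUnit n), h1, ← add_nsmul, Nat.add_sub_cancel' hi]

/-- The first vertex `t` where the fields differ is the point at which the ways from `w` to `x` and
to `y` separate, so the Gromov products are eventually equal to its distance `N` from `w`. -/
theorem simplicialDist_eq {T : Set Γ} (hT : IsSubtree p 1 T) {w : Γ} (hw : w ∈ T)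
    {x y : Compactification p} (hx : x ∈ bar 1 T) (hy : y ∈ bar 1 T) :
    simplicialDist w x y = rayFieldDist p w (h.field x) (h.field y) := by
  by_cases hxy : x = y
  · subst hxy
    rw [rayFieldDist_self, simplicialDist, dif_neg]
    exact fun h' => h'.1 rfl
  have hn : 0 < n := Nat.pos_of_ne_zero (NeZero.ne n)
  have e0 := ZVec.e_pos (n := n)
  have hd : ∃ j, DifferAt p w (h.field x) (h.field y) j := by
    obtain ⟨t, ht, hne⟩ := h.exists_field_ne hT hx hy hxy
    have h2 := (h.mem_subtree_iff hT hw).1 ht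
    obtain ⟨j, hj⟩ := Int.eq_ofNat_of_zero_le (ZVec.coord_nonneg (m := 0) h2 (h.nonneg _ _))
    have h3 := ZVec.eq_zsmul_of_mem_one h2
    rw [hj, natCast_zsmul] at h3
    exact ⟨j, t, h3, hne⟩
  classical
  set N := Nat.find hd with hN
  obtain ⟨t, ht, hne⟩ := Nat.find_spec hd
  rw [← hN] at ht
  have hmin : ∀ i < N, ¬ DifferAt p w (h.field x) (h.field y) i := fun i hi => Nat.find_min hd hi
  -- If the field of `x` pointed from `t` back to `t'`, then at `t'` neither field would point to
  -- `t`, since they agree there by minimality. By `flow`, the field of `y` at `t` would point to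
  -- `t'` as well, but the fields differ at `t`.
  have hw_between : ∀ {x y : Compactification p}, h.field x t ≠ h.field y t →
      (∀ i < N, ¬ DifferAt p w (h.field x) (h.field y) i) → ∀ u, h.field x t = dir p t u →
      p w u = N • e n 0 + p t u := by
    intro x y hne hmin u hu
    by_cases hwt : w = t
    · subst hwt
      rw [← ht, h.self, zero_add]
    by_cases htu : t = u
    · rw [← htu, h.self, add_zero, ht]
    rw [← ht]
    refine ((h.dir_ne_dir_iff (Ne.symm hwt) htu).1 fun he => ?_).symm
    obtain ⟨a1, a2⟩ := h.dir_spec (Ne.symm hwt)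
    set t' := dir p t w
    rw [← hu] at he
    have hN0 : N ≠ 0 := fun h' => by
      rw [h', zero_nsmul] at ht
      exact hwt (h.eq_of ht)
    obtain ⟨M, hM⟩ := Nat.exists_eq_succ_of_ne_zero hN0
    have h1 : p w t' = M • e n 0 := by
      rw [h.symm, a2, h.symm, ht, hM, succ_nsmul, add_sub_cancel_right]
    have h2 : h.field x t' = h.field y t' := by
      by_contra hc
      exact hmin M (by omega) ⟨t', h1, hc⟩
    have h3 : h.field x t' ≠ t := fun h' => (h.consistent_field x).asymm t t' a1 ⟨he.symm, h'⟩
    rcases (h.consistent_field y).flow t t' (h.ne_of_adj a1) with h4 | h4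
    · rw [h.dir_of_adj a1] at h4
      exact hne (he.symm.trans h4.symm)
    · rw [h.dir_of_adj (by rw [h.symm, a1])] at h4
      exact h3 (h2.trans h4)
  have hlim : ∀ u v : ℕ → Γ, Approximates w x u → Approximates w y v →
      Tendsto (fun i => gromov p w (u i) (v i)) atTop (𝓝 N) := by
    intro u v hu hv
    refine tendsto_const_nhds.congr' ?_
    filter_upwards [h.eventually_field_eq hu t, h.eventually_field_eq hv t] with i hi1 hi2
    have h1 := hw_between hne hmin _ hi1
    have h2 := hw_between hne.symm (fun i hi hd => hmin i hi hd.symm) _ hi2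
    have h3 : p (u i) t + p t (v i) = p (u i) (v i) := by
      by_cases e1 : t = u i
      · rw [← e1, h.self, zero_add]
      by_cases e2 : t = v i
      · rw [← e2, h.self, add_zero]
      exact (h.dir_ne_dir_iff e1 e2).1 (by rw [← hi1, ← hi2]; exact hne)
    rw [gromov, h.symm _ w, h.symm _ w, h1, h2, ← h3, ZVec.coord_add, ZVec.coord_add,
      ZVec.coord_add, ZVec.coord_nsmul, ZVec.coord_e hn, h.symm (u i) t]
    push_cast
    ring
  obtain ⟨u, hu⟩ := h.exists_approximates hT hw hx
  obtain ⟨v, hv⟩ := h.exists_approximates hT hw hy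
  have hex : x ≠ y ∧ ∃ l : ℝ, ∃ u v : ℕ → Γ, Approximates w x u ∧ Approximates w y v ∧
      Tendsto (fun i => gromov p w (u i) (v i)) atTop (𝓝 l) :=
    ⟨hxy, N, u, v, hu, hv, hlim u v hu hv⟩
  obtain ⟨u', v', hu', hv', hl⟩ := hex.2.choose_spec
  rw [simplicialDist, dif_pos hex, tendsto_nhds_unique hl (hlim u' v' hu' hv'),
    rayFieldDist_eq ⟨t, ht, hne⟩ hmin]

/-- The chain and the sum chosen in `chainDist` are irrelevant: every chain from `x` to `y` has the
same sum, expressed by fields only. -/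
theorem subtreeMetric_eq (C : Choices p) {m : ℕ} (hm : 1 ≤ m) (hmn : m ≤ n) {T : Set Γ}
    (hT : IsSubtree p m T) {x y : Compactification p} (hx : x ∈ bar m T) (hy : y ∈ bar m T) :
    C.subtreeMetric m T x y = C.fieldDist m T (h.field x) (h.field y) := by
  induction m using Nat.twoStepInduction generalizing T x y with
  | zero => omega
  | one => exact h.simplicialDist_eq hT (C.base_mem T hT) hx hy
  | more m _ ih =>
    by_cases hxy : x = y
    · subst hxy
      rw [C.fieldDist_self, Choices.subtreeMetric, chainDist, dif_neg]
      exact fun h' => h'.1 rfl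
    have hsum : ∀ I S a, IsChain (m + 1) T x y I S a →
        HasSum (fun i : I => C.weight (m + 1) T (S i) *
          C.subtreeMetric (m + 1) (S i) (a i) (a (i + 1)))
          (C.fieldDist (m + 2) T (h.field x) (h.field y)) := by
      intro I S a hc
      convert hc.hasSum h C (Nat.succ_pos m) (by omega) hT using 1
      · funext i
        rw [ih (Nat.succ_pos m) (by omega) (hc.subtree i i.2).1 (hc.field_start h hT i.2).1
          (hc.field_finish h hT i.2).1]
      · rfl
    obtain ⟨I, S, a, hc⟩ := h.exists_isChain (Nat.succ_pos m) (by omega) hT hx hy hxy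
    have hex : x ≠ y ∧ ∃ (l : ℝ) (I : Set ℤ) (S : ℤ → Set Γ) (a : ℤ → Compactification p),
        IsChain (m + 1) T x y I S a ∧ HasSum (fun i : I => C.weight (m + 1) T (S i) *
          C.subtreeMetric (m + 1) (S i) (a i) (a (i + 1))) l :=
      ⟨hxy, _, I, S, a, hc, hsum I S a hc⟩
    rw [Choices.subtreeMetric, chainDist, dif_pos hex]
    obtain ⟨I', S', a', hc', hs'⟩ := hex.2.choose_spec
    exact hs'.unique (hsum I' S' a' hc')

omit [NeZero n] in
theorem isSubtree_univ [Nonempty Γ] : IsSubtree p n Set.univ :=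
  ⟨Classical.arbitrary Γ, (Set.eq_univ_of_forall fun _ =>
    show p _ _ ∈ convexSub n n from ZVec.mem_convexSub_self _).symm⟩

theorem mem_bar_univ (x : Compactification p) : x ∈ bar n (Set.univ : Set Γ) := by
  rcases cases x with ⟨v, rfl⟩ | ⟨k, hk, γ, rfl⟩
  · exact Or.inl ⟨v, trivial, rfl⟩
  · exact Or.inr ⟨k, hk, γ, hk.2, Set.subset_univ _, rfl⟩

/-! ### Metric and topology of the whole compactification -/

variable [Nonempty Γ]

theorem metric_eq (C : Choices p) (x y : Compactification p) :
    C.metric x y = C.fieldDist n Set.univ (h.field x) (h.field y) :=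
  h.subtreeMetric_eq C (Nat.one_le_iff_ne_zero.2 (NeZero.ne n)) le_rfl h.isSubtree_univ
    (h.mem_bar_univ x) (h.mem_bar_univ y)

/-- The metric space structure on the compactification. -/
@[reducible] noncomputable def metricSpace (C : Choices p) : MetricSpace (Compactification p) where
  dist := C.metric
  dist_self x := by
    rw [h.metric_eq, C.fieldDist_self]
  dist_comm x y := by
    rw [h.metric_eq, h.metric_eq, C.fieldDist_comm]
  dist_triangle x y z := by
    rw [h.metric_eq, h.metric_eq, h.metric_eq]
    exact C.fieldDist_triangle h le_rfl h.isSubtree_univ _ _ _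
  eq_of_dist_eq_zero {x y} hxy := by
    change C.metric x y = 0 at hxy
    rw [h.metric_eq] at hxy
    exact h.field_injective (funext fun t => C.eq_of_fieldDist_eq_zero h
      (Nat.one_le_iff_ne_zero.2 (NeZero.ne n)) le_rfl h.isSubtree_univ hxy t trivial)

/-- Points of the compactification correspond to consistent direction fields. -/
noncomputable def fieldEquiv : {D : Γ → Γ // Consistent p D} ≃ Compactification p :=
  (Equiv.ofBijective (fun x => ⟨h.field x, h.consistent_field x⟩)
    ⟨fun _ _ hxy => h.field_injective (congrArg Subtype.val hxy),
      fun D => (h.exists_field_eq D.2).imp fun _ hx => Subtype.ext hx⟩).symm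

theorem field_fieldEquiv (D : {D : Γ → Γ // Consistent p D}) : h.field (h.fieldEquiv D) = D.1 :=
  congrArg Subtype.val ((h.fieldEquiv).symm_apply_apply D)

/-- Only this direction needs an estimate. Continuity of the inverse is automatic, from a compact to
a Hausdorff space. -/
theorem continuous_fieldEquiv (C : Choices p) (hf : ZLocallyFinite p) :
    letI : TopologicalSpace Γ := ⊥
    letI := h.metricSpace C
    Continuous h.fieldEquiv := by
  let _ : TopologicalSpace Γ := ⊥
  have : DiscreteTopology Γ := ⟨rfl⟩
  let _ := h.metricSpace C
  refine continuous_iff_continuousAt.2 fun D => tendsto_iff_dist_tendsto_zero.2 ?_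
  have h1 := C.tendsto_fieldDist h hf le_rfl h.isSubtree_univ (l := 𝓝 D)
    (D := fun E => E.1) (D' := fun _ => D.1) fun t => by
      have h2 : Continuous fun E : {D : Γ → Γ // Consistent p D} => E.1 t :=
        (continuous_apply t).comp continuous_subtype_val
      exact h2.continuousAt.eventually (mem_nhds_discrete.2 rfl : {D.1 t} ∈ 𝓝 (D.1 t))
  refine h1.congr fun E => ?_
  change _ = C.metric _ _
  rw [h.metric_eq, field_fieldEquiv, field_fieldEquiv]

theorem compactSpace_consistent (hf : ZLocallyFinite p) :
    letI : TopologicalSpace Γ := ⊥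
    CompactSpace {D : Γ → Γ // Consistent p D} :=
  let _ : TopologicalSpace Γ := ⊥
  isCompact_iff_compactSpace.1 (isCompact_consistent hf)

theorem compactSpace (C : Choices p) (hf : ZLocallyFinite p) :
    letI := h.metricSpace C
    CompactSpace (Compactification p) := by
  let _ : TopologicalSpace Γ := ⊥
  let _ := h.metricSpace C
  have := h.compactSpace_consistent hf
  exact h.fieldEquiv.surjective.compactSpace (h.continuous_fieldEquiv C hf)

theorem continuous_field (C : Choices p) (hf : ZLocallyFinite p) :
    letI : TopologicalSpace Γ := ⊥
    letI := h.metricSpace C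
    Continuous h.field := by
  let _ : TopologicalSpace Γ := ⊥
  have : DiscreteTopology Γ := ⟨rfl⟩
  let _ := h.metricSpace C
  have := h.compactSpace_consistent hf
  have h1 := Continuous.continuous_symm_of_equiv_compact_to_t2 (h.continuous_fieldEquiv C hf)
  exact continuous_subtype_val.comp h1

/-- A map is continuous if the direction at each vertex of the image depends only on the direction
at some vertex. -/
theorem continuous_of_field (C : Choices p) (hf : ZLocallyFinite p)
    (f : Compactification p → Compactification p)
    (hfield : ∀ t, ∃ s, ∀ x y, h.field x s = h.field y s → h.field (f x) t = h.field (f y) t) :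
    letI := h.metricSpace C
    Continuous f := by
  let _ : TopologicalSpace Γ := ⊥
  have : DiscreteTopology Γ := ⟨rfl⟩
  let _ := h.metricSpace C
  refine continuous_iff_continuousAt.2 fun x => tendsto_iff_dist_tendsto_zero.2 ?_
  have h1 := C.tendsto_fieldDist h hf le_rfl h.isSubtree_univ (l := 𝓝 x)
    (D := fun y => h.field (f y)) (D' := fun _ => h.field (f x)) fun t => by
      obtain ⟨s, hs⟩ := hfield t
      have h2 : Continuous fun y => h.field y s :=
        (continuous_apply s).comp (h.continuous_field C hf)
      filter_upwards [h2.continuousAt.eventually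
        (mem_nhds_discrete.2 rfl : {h.field x s} ∈ 𝓝 (h.field x s))] with y hy
      exact hs y x hy
  refine h1.congr fun y => ?_
  change _ = C.metric _ _
  rw [h.metric_eq]

end IsZTree

end

section

/-! ### The universal tree -/

namespace Word

variable {n : ℕ} {X : Type*} {u v : Word n X} {b : ZVec n}

theorem concat_letter_left (h : b ≤ u.len) : (u.concat v).letter b = u.letter b := if_pos h

theorem concat_letter_right (h : u.len < b) : (u.concat v).letter b = v.letter (b - u.len) :=
  if_neg h.not_ge

theorem inv_letter : u.inv.letter b = (u.letter (u.len + e n 0 - b)).map invLetter := rfl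

end Word

namespace CDRGroup

variable {n : ℕ} {X G : Type*} [Group G] (φ : CDRGroup n X G)

/-- The length of the common initial segment of the segments from the base point of the universal
tree to `⟨a, f⟩` and `⟨b, g⟩`. -/
noncomputable def meet (a : ZVec n) (f : G) (b : ZVec n) (g : G) : ZVec n :=
  min (min a b) (φ.comLen f g)

theorem exists_point (x : φ.UniversalTree) : ∃ a g h, x = φ.point a g h := by
  obtain ⟨⟨⟨a, g⟩, h⟩, rfl⟩ := Quotient.exists_rep x
  exact ⟨a, g, h, rfl⟩

theorem dist_point {a b : ZVec n} {f g : G} (ha : 0 ≤ a ∧ a ≤ (φ.word f).len)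
    (hb : 0 ≤ b ∧ b ≤ (φ.word g).len) : φ.dist (φ.point a f ha) (φ.point b g hb) =
    a + b - (φ.meet a f b g + φ.meet a f b g) := by
  rw [← two_nsmul]
  rfl

theorem point_eq {a b : ZVec n} {f g : G} (ha : 0 ≤ a ∧ a ≤ (φ.word f).len)
    (hb : 0 ≤ b ∧ b ≤ (φ.word g).len) (h : a = b) (h' : a ≤ φ.comLen f g) :
    φ.point a f ha = φ.point b g hb :=
  Quotient.sound ⟨h, h'⟩

theorem meet_comm (a : ZVec n) (f : G) (b : ZVec n) (g : G) :
    φ.meet a f b g = φ.meet b g a f := by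
  rw [meet, meet, φ.comLen_comm, min_comm a]

/-- Two words that share an initial segment with a third share the shorter of the two. This
ultrametric inequality is the source of the four point condition. -/
theorem meet_ultra (a : ZVec n) (f : G) (b : ZVec n) (g : G) (c : ZVec n) (k : G) :
    min (φ.meet a f b g) (φ.meet b g c k) ≤ φ.meet a f c k := by
  have := φ.min_comLen_le k (le_refl (φ.comLen g f))
  rw [φ.comLen_comm g f] at this
  unfold meet
  grind

theorem comLen_self (g : G) : φ.comLen g g = (φ.word g).len :=
  le_antisymm (φ.comLen_le g g).1 ((φ.le_comLen_iff le_rfl le_rfl).2 fun _ _ => rfl)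

theorem isZTree : IsZTree φ.dist where
  self x := by
    obtain ⟨a, f, ha, rfl⟩ := φ.exists_point x
    have := φ.comLen_self f
    rw [dist_point, meet]
    grind
  eq_of {x y} := by
    obtain ⟨a, f, ha, rfl⟩ := φ.exists_point x
    obtain ⟨b, g, hb, rfl⟩ := φ.exists_point y
    intro h
    rw [dist_point, meet] at h
    apply φ.point_eq <;> grind
  symm x y := by
    obtain ⟨a, f, ha, rfl⟩ := φ.exists_point x
    obtain ⟨b, g, hb, rfl⟩ := φ.exists_point y
    rw [dist_point, dist_point, meet_comm, add_comm a]
  nonneg x y := by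
    obtain ⟨a, f, ha, rfl⟩ := φ.exists_point x
    obtain ⟨b, g, hb, rfl⟩ := φ.exists_point y
    rw [dist_point, meet]
    grind
  between x y c h0 hc := by
    obtain ⟨a, f, ha, rfl⟩ := φ.exists_point x
    obtain ⟨b, g, hb, rfl⟩ := φ.exists_point y
    have h4 := φ.comLen_nonneg f g
    have h5 := φ.comLen_self f
    have h6 := φ.comLen_self g
    rw [dist_point] at hc ⊢
    unfold meet at *
    -- The point at distance `c` is on the descent from `⟨a, f⟩` to the branch point, or on the
    -- ascent from there to `⟨b, g⟩`.
    rcases le_total c (a - min (min a b) (φ.comLen f g)) with h7 | h7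
    · refine ⟨φ.point (a - c) f (by constructor <;> grind), ?_, ?_⟩ <;>
      · rw [dist_point, meet]
        grind
    · refine ⟨φ.point (c - a + (min (min a b) (φ.comLen f g) + min (min a b) (φ.comLen f g))) g
        (by constructor <;> grind), ?_, ?_⟩ <;>
      · rw [dist_point, meet]
        grind
  four x y z t := by
    obtain ⟨a, f, ha, rfl⟩ := φ.exists_point x
    obtain ⟨b, g, hb, rfl⟩ := φ.exists_point y
    obtain ⟨c, k, hc, rfl⟩ := φ.exists_point z
    obtain ⟨d, l, hd, rfl⟩ := φ.exists_point t
    simp only [dist_point]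
    have u1 := φ.meet_ultra a f c k b g
    have u2 := φ.meet_ultra a f d l b g
    have u3 := φ.meet_ultra c k a f d l
    have u4 := φ.meet_ultra c k b g d l
    have c1 := φ.meet_comm c k a f
    have c2 := φ.meet_comm c k b g
    have c3 := φ.meet_comm d l b g
    grind
  parity x y z := by
    obtain ⟨a, f, ha, rfl⟩ := φ.exists_point x
    obtain ⟨b, g, hb, rfl⟩ := φ.exists_point y
    obtain ⟨c, k, hc, rfl⟩ := φ.exists_point z
    refine ⟨a - φ.meet a f b g - φ.meet a f c k + φ.meet b g c k, ?_⟩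
    simp only [dist_point]
    abel

/-- The vertex of the universal tree that belongs to a group element. -/
def orbitPoint (g : G) : φ.UniversalTree := φ.point (φ.word g).len g ⟨(φ.word g).len_nonneg, le_rfl⟩

theorem dist_orbitPoint {a : ZVec n} {f : G} (ha : 0 ≤ a ∧ a ≤ (φ.word f).len) (g : G) :
    φ.dist (φ.point a f ha) (φ.orbitPoint g) =
    a + (φ.word g).len - (min a (φ.comLen f g) + min a (φ.comLen f g)) := by
  rw [orbitPoint, dist_point, meet]
  have := φ.comLen_le f g
  grind

theorem len_one : (φ.word 1).len = 0 := by
  have := φ.len_mul 1 1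
  rw [mul_one, inv_one, φ.comLen_self] at this
  grind

theorem len_inv (g : G) : (φ.word g⁻¹).len = (φ.word g).len := by
  rw [φ.inv]
  rfl

theorem dist_orbitPoint_orbitPoint (f g : G) :
    φ.dist (φ.orbitPoint f) (φ.orbitPoint g) = (φ.word (f⁻¹ * g)).len := by
  have h1 := φ.len_mul f⁻¹ g
  have h2 := φ.comLen_le f g
  have h3 := φ.len_inv f
  rw [_root_.inv_inv] at h1
  rw [orbitPoint, dist_orbitPoint]
  grind

/-- The distances to the vertices of `1` and of `f` suffice: the first determines the height, the
second the agreement with `f`. The axioms of an action thereby reduce to computations of distances.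
-/
theorem eq_of_dist_orbitPoint {x y : φ.UniversalTree}
    (h : ∀ g, φ.dist x (φ.orbitPoint g) = φ.dist y (φ.orbitPoint g)) : x = y := by
  obtain ⟨a, f, ha, rfl⟩ := φ.exists_point x
  obtain ⟨b, k, hb, rfl⟩ := φ.exists_point y
  have h1 := h 1
  have h2 := h f
  have e1 := φ.len_one
  have e2 := φ.comLen_self f
  have e3 := φ.comLen_le f 1
  have e4 := φ.comLen_le k 1
  have e5 := φ.comLen_nonneg f 1
  have e6 := φ.comLen_nonneg k 1
  have e7 := φ.comLen_comm f k
  simp only [dist_orbitPoint] at h1 h2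
  apply φ.point_eq <;> grind

theorem act_point_of_le {a : ZVec n} {h g : G} (ha : 0 ≤ a ∧ a ≤ (φ.word g).len)
    (hq : a ≤ φ.comLen h⁻¹ g) : ∃ h', φ.act h (φ.point a g ha) =
      φ.point ((φ.word h).len - a) h h' :=
  ⟨_, dif_pos hq⟩

theorem act_point_of_not_le {a : ZVec n} {h g : G} (ha : 0 ≤ a ∧ a ≤ (φ.word g).len)
    (hq : ¬ a ≤ φ.comLen h⁻¹ g) : ∃ h', φ.act h (φ.point a g ha) =
      φ.point ((φ.word h).len + a - (φ.comLen h⁻¹ g + φ.comLen h⁻¹ g)) (h * g) h' :=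
  ⟨_, dif_neg hq⟩

theorem dist_act_orbitPoint (h k : G) (x : φ.UniversalTree) :
    φ.dist (φ.act h x) (φ.orbitPoint (h * k)) = φ.dist x (φ.orbitPoint k) := by
  obtain ⟨a, g, ha, rfl⟩ := φ.exists_point x
  have l1 := φ.len_mul h k
  have l2 := φ.len_inv h
  have l3 := φ.comLen_le h⁻¹ k
  by_cases hq : a ≤ φ.comLen h⁻¹ g
  · obtain ⟨h', hh⟩ := φ.act_point_of_le ha hq
    rw [hh, dist_orbitPoint, dist_orbitPoint]
    have l4 := φ.len_mul h⁻¹ (h * k)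
    rw [inv_mul_cancel_left, _root_.inv_inv] at l4
    have u := φ.min_comLen_congr k hq
    have u1 := φ.min_comLen_le k (le_refl (φ.comLen h⁻¹ g))
    grind
  · obtain ⟨h', hh⟩ := φ.act_point_of_not_le ha hq
    rw [hh, dist_orbitPoint, dist_orbitPoint]
    have l4 := φ.len_mul (h * g)⁻¹ (h * k)
    rw [_root_.inv_inv, mul_inv_rev, mul_assoc, inv_mul_cancel_left] at l4
    have l5 := φ.len_mul g⁻¹ k
    rw [_root_.inv_inv] at l5
    have l6 := φ.len_mul h g
    have l7 := φ.len_inv g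
    have l8 : (φ.word (g⁻¹ * h⁻¹)).len = (φ.word (h * g)).len := by
      rw [← mul_inv_rev, len_inv]
    have u1 := φ.min_comLen_le k (le_refl (φ.comLen h⁻¹ g))
    have u2 := φ.min_comLen_le k (le_refl (φ.comLen g h⁻¹))
    have u3 := φ.min_comLen_le g (le_refl (φ.comLen k h⁻¹))
    have c1 := φ.comLen_comm h⁻¹ g
    have c2 := φ.comLen_comm k h⁻¹
    have c3 := φ.comLen_comm k g
    grind

theorem act_orbitPoint (h k : G) : φ.act h (φ.orbitPoint k) = φ.orbitPoint (h * k) :=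
  φ.isZTree.eq_of (by rw [dist_act_orbitPoint, φ.isZTree.self])

/-- The action of the group on its universal tree. -/
noncomputable instance : MulAction G φ.UniversalTree where
  smul g x := φ.act g x
  one_smul x := φ.eq_of_dist_orbitPoint fun g => by
    have := φ.dist_act_orbitPoint 1 g x
    rwa [one_mul] at this
  mul_smul g h x := φ.eq_of_dist_orbitPoint fun k => by
    change φ.dist (φ.act (g * h) x) _ = φ.dist (φ.act g (φ.act h x)) _
    have h1 := φ.dist_act_orbitPoint (g * h) ((g * h)⁻¹ * k) x
    have h2 := φ.dist_act_orbitPoint g (g⁻¹ * k) (φ.act h x)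
    have h3 := φ.dist_act_orbitPoint h (h⁻¹ * (g⁻¹ * k)) x
    rw [mul_inv_cancel_left] at h1 h2 h3
    rw [h1, h2, h3, mul_inv_rev, mul_assoc]

theorem smul_eq_act (g : G) (x : φ.UniversalTree) : g • x = φ.act g x := rfl

theorem exists_between_orbitPoint (x : φ.UniversalTree) : ∃ g, φ.dist (φ.orbitPoint 1) x +
    φ.dist x (φ.orbitPoint g) = φ.dist (φ.orbitPoint 1) (φ.orbitPoint g) := by
  obtain ⟨a, g, ha, rfl⟩ := φ.exists_point x
  refine ⟨g, ?_⟩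
  have e1 := φ.len_one
  have e2 := φ.comLen_self g
  have e3 := φ.comLen_le g 1
  have e5 := φ.comLen_nonneg g 1
  rw [φ.isZTree.symm, dist_orbitPoint, dist_orbitPoint, dist_orbitPoint_orbitPoint, inv_one,
    one_mul]
  grind

/-- Each point is on a segment between two orbit points, and the distance to a point of a segment is
determined by the distances to its endpoints. -/
theorem dist_smul_smul (h : G) (x y : φ.UniversalTree) :
    φ.dist (h • x) (h • y) = φ.dist x y := by
  obtain ⟨g, hg⟩ := φ.exists_between_orbitPoint y
  have e1 := φ.dist_act_orbitPoint h 1 y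
  have e2 := φ.dist_act_orbitPoint h g y
  have e3 := φ.dist_act_orbitPoint h g (φ.orbitPoint 1)
  have e4 := φ.dist_act_orbitPoint h 1 x
  have e5 := φ.dist_act_orbitPoint h g x
  rw [act_orbitPoint] at e3
  have s1 := φ.isZTree.symm (φ.orbitPoint 1) y
  have s2 := φ.isZTree.symm (φ.orbitPoint (h * 1)) (φ.act h y)
  rw [φ.isZTree.dist_of_between hg, φ.isZTree.dist_of_between (p := φ.dist)
    (x := h • x) (y := h • y) (a := φ.orbitPoint (h * 1)) (b := φ.orbitPoint (h * g))
    (by rw [smul_eq_act]; grind)]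
  simp only [smul_eq_act]
  grind

theorem eq_one_of_len_eq_zero [NeZero n] {g : G} (hg : (φ.word g).len = 0) : g = 1 := by
  refine φ.injective (Word.ext (hg.trans φ.len_one.symm) (funext fun b => ?_))
  have key : ∀ k, (φ.word k).len = 0 → (φ.word k).letter b = none := fun k hk => by
    rw [← Option.not_isSome_iff_eq_none, (φ.word k).isSome_iff, hk]
    exact fun h' => (h'.1.trans h'.2).not_gt (ZVec.e_pos (n := n))
  rw [key g hg, key 1 φ.len_one]

/-- Write `g = c⁻¹ ∘ w ∘ c`. After `c⁻¹`, the next letter of `g` is the first letter of `w`, and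
that of `g⁻¹` is the inverse of the last one. They differ as `w` is cyclically reduced, so the
common initial segment is not longer than `c`. -/
theorem two_comLen_lt [NeZero n] {g : G} (hg : g ≠ 1) :
    φ.comLen g⁻¹ g + φ.comLen g⁻¹ g < (φ.word g).len := by
  have he := ZVec.e_pos (n := n)
  have hpos : (φ.word g).len ≠ 0 := fun h0 => hg (φ.eq_one_of_len_eq_zero h0)
  obtain ⟨hr, c, w, -, -, hw, hu⟩ := φ.isCDR g
  have hl : (φ.word g).len = c.len + w.len + c.len := by rw [hu]; rfl
  have hl' : (c.inv.concat w).len = c.len + w.len := rfl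
  have hc0 := c.len_nonneg
  have hw0 := w.len_nonneg
  have hii : ∀ o : Option (X × Bool), (o.map invLetter).map invLetter = o := by
    rintro (_ | x) <;> simp [invLetter]
  -- If `w` is empty, then `c` is not, and `c⁻¹ c` is not reduced at the junction.
  have hwpos : 0 < w.len := by
    refine lt_of_le_of_ne hw0 fun hw1 => ?_
    have hc : 0 < c.len := by grind
    refine hr c.len (e_le_of_pos hc) (by grind) ?_
    rw [hu, Word.concat_letter_right (by grind), Word.concat_letter_left (by grind),
      Word.concat_letter_left (show c.len ≤ c.inv.len from le_rfl), Word.inv_letter, hii, hl', ← hw1]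
    congr 1
    abel
  have hew := e_le_of_pos hwpos
  have hlt : φ.comLen g⁻¹ g < c.len + e n 0 := by
    by_contra hcon
    have h1 := (φ.le_comLen_iff (f := g⁻¹) (g := g) (a := c.len + e n 0)
      (by rw [len_inv]; grind) (by grind)).1 (not_lt.1 hcon) _ le_rfl
    have h2 : (φ.word g).letter (c.len + e n 0) = w.letter (e n 0) := by
      rw [hu, Word.concat_letter_left (by grind),
        Word.concat_letter_right (show c.inv.len < _ by change c.len < _; grind)]
      congr 1
      exact add_sub_cancel_left c.len _
    have h3 : (φ.word g).letter (c.len + w.len) = w.letter w.len := by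
      rw [hu, Word.concat_letter_left (by grind),
        Word.concat_letter_right (show c.inv.len < _ by change c.len < _; grind)]
      congr 1
      exact add_sub_cancel_left c.len _
    have h4 : (φ.word g⁻¹).letter (c.len + e n 0) =
        ((φ.word g).letter (c.len + w.len)).map invLetter := by
      rw [φ.inv, Word.inv_letter, hl]
      congr 2
      abel
    rw [h4, h2, h3] at h1
    obtain ⟨x, hx⟩ := Option.isSome_iff_exists.1 ((w.isSome_iff w.len).2 ⟨hew, le_rfl⟩)
    refine hw ⟨invLetter x, ?_, ?_⟩
    · rw [← h1, hx]
      rfl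
    · rw [hx]
      simp [invLetter]
  have hle : φ.comLen g⁻¹ g ≤ c.len := by
    by_contra hcon
    have := e_le_of_pos (sub_pos.2 (not_le.1 hcon))
    grind
  grind

end CDRGroup

end

section

/-! ### Isometric actions and the induced action on the compactification -/

section Action

variable {n : ℕ} {Γ : Type*} {p : Γ → Γ → ZVec n} {G : Type*} [Group G] [MulAction G Γ]

/-- The action of `G` on `Γ` is isometric. -/
class IsometricAction (G : Type*) [Group G] {Γ : Type*} [MulAction G Γ] (p : Γ → Γ → ZVec n) :
    Prop where
  dist_smul : ∀ (g : G) (x y : Γ), p (g • x) (g • y) = p x y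

variable [IsometricAction G p]

theorem dist_smul_smul (p : Γ → Γ → ZVec n) [IsometricAction G p] (g : G) (x y : Γ) :
    p (g • x) (g • y) = p x y := IsometricAction.dist_smul g x y

/-- The translate of a ray. -/
def Ray.smul {k : ℕ} (g : G) (γ : Ray p k) : Ray p k :=
  ⟨fun c => g • γ.toFun c, fun a b => by rw [dist_smul_smul p, γ.isometry]⟩

theorem Ray.smul_apply {k : ℕ} (g : G) (γ : Ray p k) (c : cone n k) :
    (γ.smul g).toFun c = g • γ.toFun c := rfl

theorem Ray.SameTail.smul {k : ℕ} {γ γ' : Ray p k} (h : γ.SameTail γ') (g : G) :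
    (γ.smul g).SameTail (γ'.smul g) := by
  obtain ⟨a, a', h⟩ := h
  exact ⟨a, a', fun c => congrArg (g • ·) (h c)⟩

theorem Ray.Opposite.smul {k : ℕ} {γ γ' : Ray p k} (h : γ.Opposite γ') (g : G) :
    (γ.smul g).Opposite (γ'.smul g) := by
  obtain ⟨b, hb, h⟩ := h
  exact ⟨b, hb, fun c c' => by rw [γ.smul_apply, γ'.smul_apply, dist_smul_smul p, h]⟩

/-- The action on the compactification. -/
noncomputable instance : MulAction G (Compactification p) where
  smul g := Sum.map (g • ·) (Quot.map (fun r => ⟨r.1, r.2.smul g⟩) (by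
    rintro _ _ (⟨γ, γ', ht⟩ | ⟨γ, γ', hk, ho⟩)
    · exact .tail _ _ (ht.smul g)
    · exact .glue _ _ hk (ho.smul g)))
  one_smul := by
    rintro (v | ⟨k, γ⟩)
    · exact congrArg Sum.inl (one_smul G v)
    · refine congrArg (fun r : Ray p k =>
        (Sum.inr (Quot.mk EndRel (⟨k, r⟩ : AnyRay p)) : Compactification p)) ?_
      cases γ
      simp [Ray.smul]
  mul_smul g h := by
    rintro (v | ⟨k, γ⟩)
    · exact congrArg Sum.inl (mul_smul g h v)
    · refine congrArg (fun r : Ray p k =>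
        (Sum.inr (Quot.mk EndRel (⟨k, r⟩ : AnyRay p)) : Compactification p)) ?_
      simp [Ray.smul, mul_smul]

theorem smul_vertex (g : G) (v : Γ) :
    g • (vertex v : Compactification p) = vertex (g • v) := rfl

theorem smul_endOf {k : ℕ} (hk : k ∈ Set.Icc 1 n) (g : G) (γ : Ray p k) :
    g • (endOf hk γ : Compactification p) = endOf hk (γ.smul g) := rfl

namespace IsZTree

variable [NeZero n] (h : IsZTree p)
include h

theorem dir_smul (g : G) (u v : Γ) : dir p (g • u) (g • v) = g • dir p u v := by
  by_cases huv : u = v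
  · subst huv
    rw [h.dir_self, h.dir_self]
  · obtain ⟨h1, h2⟩ := h.dir_spec huv
    exact h.dir_eq (by rw [dist_smul_smul p, h1]) (by rw [dist_smul_smul p, dist_smul_smul p, h2])

theorem field_smul (g : G) (x : Compactification p) (u : Γ) :
    h.field (g • x) (g • u) = g • h.field x u := by
  rcases cases x with ⟨v, rfl⟩ | ⟨k, hk, γ, rfl⟩
  · rw [smul_vertex, field_vertex, field_vertex, h.dir_smul]
  · obtain ⟨c, hc⟩ := h.exists_dir_ray hk.1 γ u
    rw [smul_endOf, field_endOf, field_endOf]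
    exact rayDir_eq c fun d => by rw [Ray.smul_apply, h.dir_smul, hc]

/-- Every group element acts continuously on the compactification. -/
theorem continuous_smul [Nonempty Γ] (C : Choices p) (hf : ZLocallyFinite p) (g : G) :
    letI := h.metricSpace C
    Continuous fun x : Compactification p => g • x :=
  h.continuous_of_field C hf _ fun t => ⟨g⁻¹ • t, fun x y hxy => by
    have key : ∀ x, h.field (g • x) t = g • h.field x (g⁻¹ • t) := fun x => by
      rw [← h.field_smul, smul_inv_smul]
    rw [key, key, hxy]⟩

end IsZTree

end Action

/-! ### Hyperbolic actions -/

/-- The action of `G` on the tree is isometric, and each non-trivial group element is hyperbolic: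
it has no fixed points and does not invert any segments. -/
class HyperbolicAction {n : ℕ} (G : Type*) [Group G] {Γ : Type*} [MulAction G Γ]
    (p : Γ → Γ → ZVec n) : Prop extends IsometricAction G p where
  dist_lt : ∀ g : G, g ≠ 1 → ∀ x : Γ, p x (g • x) < p x (g • g • x)

namespace IsZTree

variable {n : ℕ} {Γ : Type*} {p : Γ → Γ → ZVec n} {G : Type*} [Group G] [MulAction G Γ]
variable (h : IsZTree p)
include h

/-- An element that is not hyperbolic at one point is not hyperbolic at any point. -/
theorem dist_smul_smul_le [IsometricAction G p] {g : G} {x : Γ}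
    (hx : p x (g • g • x) ≤ p x (g • x)) (y : Γ) : p y (g • g • y) ≤ p y (g • y) := by
  have i1 := dist_smul_smul p g x (g • x)
  have i2 := dist_smul_smul p g y (g • y)
  have i3 := dist_smul_smul p g y x
  have i4 := dist_smul_smul p g y (g • x)
  have i5 := dist_smul_smul p g (g • y) x
  have i6 := dist_smul_smul p g (g • y) (g • x)
  have f1 := h.four (g • y) x (g • x) (g • g • x)
  have f2 := h.four (g • y) (g • g • x) x (g • x)
  have f3 := h.four y (g • g • y) (g • y) x
  have f4 := h.four y (g • g • y) (g • y) (g • x)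
  have f5 := h.four (g • g • y) x (g • x) (g • g • x)
  have s1 := h.symm (g • y) x
  have s2 := h.symm (g • x) x
  have s3 := h.symm (g • g • x) x
  have s4 := h.symm (g • g • x) (g • x)
  have s5 := h.symm (g • y) (g • x)
  have s6 := h.symm (g • g • y) x
  have s7 := h.symm (g • g • y) (g • x)
  have s8 := h.symm (g • g • y) (g • y)
  grind

variable [HyperbolicAction G p]

theorem eq_one_of_smul_eq {g : G} {x : Γ} (hg : g • x = x) : g = 1 := by
  by_contra hne
  have := HyperbolicAction.dist_lt (p := p) g hne x
  rw [hg, hg] at this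
  exact lt_irrefl _ this

/-- Distances grow linearly along the orbits of a cyclic group. -/
theorem dist_pow_smul {g : G} (hg : g ≠ 1) (x : Γ) (k : ℕ) : p x (g ^ (k + 1) • x) =
    p x (g • x) + k • (p x (g • g • x) - p x (g • x)) := by
  have hlt := HyperbolicAction.dist_lt (p := p) g hg x
  induction k using Nat.twoStepInduction with
  | zero => simp
  | one => simp [pow_two, mul_smul]
  | more k ih1 ih2 =>
    have i1 := dist_smul_smul p g x (g ^ (k + 1) • x)
    have i2 := dist_smul_smul p g x (g ^ (k + 2) • x)
    have i3 := dist_smul_smul p (g ^ (k + 2)) x (g • x)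
    rw [← mul_smul, ← pow_succ'] at i1 i2
    rw [← mul_smul, ← pow_succ] at i3
    have f1 := h.four x (g ^ (k + 3) • x) (g • x) (g ^ (k + 2) • x)
    have f2 := h.four x (g ^ (k + 2) • x) (g • x) (g ^ (k + 3) • x)
    have s1 := h.symm (g • x) (g ^ (k + 2) • x)
    have s2 := h.symm (g • x) (g ^ (k + 3) • x)
    have s3 := h.symm (g ^ (k + 3) • x) (g ^ (k + 2) • x)
    have hk : 0 ≤ k • (p x (g • g • x) - p x (g • x)) := nsmul_nonneg (sub_nonneg.2 hlt.le) k
    change p x (g ^ (k + 2) • x) = _ at ih2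
    change p x (g ^ (k + 3) • x) = _
    rw [succ_nsmul] at ih2
    rw [succ_nsmul, succ_nsmul]
    change p (g • x) (g ^ (k + 2) • x) = _ at i1
    change p (g • x) (g ^ (k + 3) • x) = _ at i2
    change p (g ^ (k + 2) • x) (g ^ (k + 3) • x) = _ at i3
    grind

theorem pow_ne_one {g : G} (hg : g ≠ 1) [Nonempty Γ] (k : ℕ) : g ^ (k + 1) ≠ 1 := fun h1 => by
  have x := Classical.arbitrary Γ
  have hlt := HyperbolicAction.dist_lt (p := p) g hg x
  have h2 := h.dist_pow_smul hg x k
  have hk : 0 ≤ k • (p x (g • g • x) - p x (g • x)) := nsmul_nonneg (sub_nonneg.2 hlt.le) k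
  rw [h1, one_smul, h.self] at h2
  have h3 := h.nonneg x (g • x)
  exact hg (h.eq_one_of_smul_eq (h.eq_of (x := x) (y := g • x) (by grind)).symm)

/-- A hyperbolic element has an axis. -/
theorem exists_axis {g : G} (hg : g ≠ 1) [Nonempty Γ] :
    ∃ q : Γ, p q (g • g • q) = p q (g • q) + p q (g • q) := by
  have x := Classical.arbitrary Γ
  have hlt := HyperbolicAction.dist_lt (p := p) g hg x
  -- The median of `g⁻¹ x`, `x` and `g x` is the branch point of `x` from the axis.
  obtain ⟨q, h1, h2, h3⟩ := h.exists_median x (g⁻¹ • x) (g • x)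
  have i1 := dist_smul_smul p g (g⁻¹ • x) x
  have i2 := dist_smul_smul p g (g⁻¹ • x) (g • x)
  have i3 := dist_smul_smul p g x q
  have i4 := dist_smul_smul p g (g⁻¹ • x) q
  have i5 := dist_smul_smul p g (g • x) (g • q)
  have i6 := dist_smul_smul p g q (g • q)
  rw [smul_inv_smul] at i1 i2 i4
  have s1 := h.symm x (g⁻¹ • x)
  have s2 := h.symm q (g • x)
  have s3 := h.symm q (g⁻¹ • x)
  have s4 := h.symm x q
  have s5 := h.symm (g • x) (g • q)
  have s6 := h.symm (g • g • x) (g • g • q)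
  have s7 := h.symm q (g • q)
  have e1 := h.dist_of_between (x := q) (a := x) (b := g • x) (y := g • q) (by grind)
  have t1 := h.triangle x (g • g • x) q
  have t2 := h.triangle q (g • g • x) (g • g • q)
  have t3 := h.triangle q (g • g • q) (g • q)
  refine ⟨q, ?_⟩
  grind

/-- Roots are unique. -/
theorem eq_of_pow_eq [Nonempty Γ] {f g : G} {k : ℕ} (hfg : f ^ (k + 1) = g ^ (k + 1)) :
    f = g := by
  by_cases hf : f = 1
  · by_contra hne
    refine h.pow_ne_one (g := g) (fun hg => hne (hf.trans hg.symm)) k ?_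
    rw [← hfg, hf, one_pow]
  by_cases hg : g = 1
  · exact absurd (hfg.trans (by rw [hg, one_pow])) (h.pow_ne_one hf k)
  obtain ⟨q, hq⟩ := h.exists_axis hf
  have f1 := h.dist_pow_smul hf q k
  have f2 := h.dist_pow_smul hf q (k + 1 + k)
  have g1 := h.dist_pow_smul hg q k
  have g2 := h.dist_pow_smul hg q (k + 1 + k)
  have e1 : f ^ (k + 1 + k + 1) = g ^ (k + 1 + k + 1) := by
    rw [add_assoc (k + 1), pow_add, pow_add g, hfg]
  rw [e1] at f2
  rw [hfg] at f1
  set σ := p q (f • f • q) - p q (f • q) with hσ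
  set τ := p q (g • g • q) - p q (g • q) with hτ
  -- The lengths grow linearly in the exponent, so comparing the powers `k + 1` and `2 (k + 1)`
  -- gives the same multiple of both translation lengths.
  have hστ : σ = τ := by
    have h1 : (k + 1) • σ = p q (g ^ (k + 1 + k + 1) • q) - p q (g ^ (k + 1) • q) := by
      rw [f2, f1, add_nsmul σ (k + 1) k]
      abel
    have h2 : (k + 1) • τ = p q (g ^ (k + 1 + k + 1) • q) - p q (g ^ (k + 1) • q) := by
      rw [g2, g1, add_nsmul τ (k + 1) k]
      abel
    exact nsmul_right_injective k.succ_ne_zero (h1.trans h2.symm)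
  have hd : p q (f • q) = p q (g • q) := by
    rw [hστ] at f1
    grind
  rcases Nat.eq_zero_or_pos k with rfl | hk
  · simpa using hfg
  obtain ⟨j, rfl⟩ : ∃ j, k = j + 1 := ⟨k - 1, by omega⟩
  have key : ∀ a : G, a ≠ 1 → p q (a • a • q) = p q (a • q) + p q (a • q) →
      p q (a • q) + p (a • q) (a ^ (j + 1 + 1) • q) = p q (a ^ (j + 1 + 1) • q) := by
    intro a ha haq
    have h1 := h.dist_pow_smul ha q j
    have h2 := h.dist_pow_smul ha q (j + 1)
    rw [pow_succ' a (j + 1), mul_smul, dist_smul_smul p]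
    rw [pow_succ' a (j + 1), mul_smul] at h2
    rw [h1, h2, haq, succ_nsmul]
    grind
  -- Thus `q` is also on the axis of `g`, and `f q`, `g q` are points of one segment at the same
  -- distance from `q`; freeness of the action finishes the proof.
  have h3 := h.eq_of_between (hfg ▸ key f hf hq) (key g hg (by grind)) hd
  have h4 : (g⁻¹ * f) • q = q := by rw [mul_smul, h3, inv_smul_smul]
  exact (inv_mul_eq_one.1 (h.eq_one_of_smul_eq h4)).symm

end IsZTree

end

section

/-! ### Orbits in the compactification -/

namespace IsZTree

section

variable {n : ℕ} {Γ : Type*} {p : Γ → Γ → ZVec n} {G : Type*} [Group G] [MulAction G Γ]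
variable [NeZero n] (h : IsZTree p)
include h

/-- There are no three mutually opposite rays. -/
theorem not_opposite_of_opposite {k : ℕ} (hkn : k < n) {γ γ' γ'' : Ray p k} (h1 : γ.Opposite γ')
    (h2 : γ'.Opposite γ'') : ¬ γ.Opposite γ'' := by
  rintro ⟨b₃, hb₃, h3⟩
  obtain ⟨b₁, hb₁, h1⟩ := h1
  obtain ⟨b₂, hb₂, h2⟩ := h2
  -- Coordinate `k` of each of the three distances is one, so that of twice the Gromov product would
  -- be `1 + 1 - 1`, an odd number.
  obtain ⟨r, hr⟩ := h.parity (γ.toFun 0) (γ'.toFun 0) (γ''.toFun 0)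
  rw [h1, h2, h3] at hr
  have hc : ∀ b, b - e n k ∈ convexSub n k → coord b k = 1 := fun b hb => by
    have := ZVec.coord_eq_zero hb
    rw [ZVec.coord_sub, ZVec.coord_e hkn] at this
    omega
  have h4 := congrArg (coord · k) hr
  simp only [ZVec.coord_add, ZVec.coord_sub, hc _ hb₁, hc _ hb₂, hc _ hb₃] at h4
  have h0 : coord ((0 : cone n k) : ZVec n) k = 0 := ZVec.coord_zero k
  omega

/-- The square of an element that fixes an end maps each ray to this end to an equivalent ray. -/
theorem sameTail_of_smul_eq [IsometricAction G p] {k : ℕ} (hk : k ∈ Set.Icc 1 n) {γ : Ray p k}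
    {g : G} (hg : g • (endOf hk γ : Compactification p) = endOf hk γ) :
    γ.SameTail (γ.smul (g * g)) := by
  have hss : (γ.smul g).smul g = γ.smul (g * g) := by simp [Ray.smul, mul_smul]
  have hg2 : (g * g) • (endOf hk γ : Compactification p) = endOf hk γ := by
    rw [mul_smul, hg, hg]
  rw [smul_endOf] at hg hg2
  rcases h.endOf_eq hk hg2.symm with h2 | ⟨hkn, h2⟩
  · exact h2
  rcases h.endOf_eq hk hg.symm with h1 | ⟨-, h1⟩
  · obtain ⟨a, a', haa⟩ := h1
    refine ⟨a + a, a' + a', fun c => ?_⟩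
    rw [add_assoc, haa, Ray.smul_apply, add_left_comm, haa, Ray.smul_apply, Ray.smul_apply,
      mul_smul, add_assoc]
  · have h3 := h1.smul g
    rw [hss] at h3
    exact absurd h2 (h.not_opposite_of_opposite hkn h1 h3)

variable [HyperbolicAction G p]

/-- Two elements that map a ray to equivalent rays commute. -/
theorem commute_of_sameTail {k : ℕ} {γ : Ray p k} {f g : G} (hf : γ.SameTail (γ.smul f))
    (hg : γ.SameTail (γ.smul g)) : f * g = g * f := by
  obtain ⟨a, a', haa⟩ := hf
  obtain ⟨b, b', hbb⟩ := hg
  simp only [Ray.smul_apply] at haa hbb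
  have h1 : (f * g) • γ.toFun (a' + b') = γ.toFun (a + b) := by
    rw [mul_smul, add_comm a', ← hbb, add_comm b, ← haa]
  have h2 : (g * f) • γ.toFun (a' + b') = γ.toFun (a + b) := by
    rw [mul_smul, ← haa, add_comm a, ← hbb, add_comm b]
  have h3 : ((g * f)⁻¹ * (f * g)) • γ.toFun (a' + b') = γ.toFun (a' + b') := by
    rw [mul_smul, h1, ← h2, inv_smul_smul]
  exact (inv_mul_eq_one.1 (h.eq_one_of_smul_eq h3)).symm

/-- If the group is not abelian, then all orbits in the compactification are infinite. -/
theorem orbit_infinite (hab : ∃ a b : G, a * b ≠ b * a) (x : Compactification p) :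
    (MulAction.orbit G x).Infinite := by
  intro hfin
  obtain ⟨a, b, hne⟩ := hab
  apply hne
  have hidx : (MulAction.stabilizer G x).index ≠ 0 := by
    rw [MulAction.index_stabilizer]
    exact (Set.ncard_pos hfin).2 (MulAction.nonempty_orbit x) |>.ne'
  have hpow : ∀ g : G, ∃ N, g ^ (N + 1) • x = x := fun g => by
    obtain ⟨N, h0, -, hN⟩ := Subgroup.exists_pow_mem_of_index_ne_zero hidx g
    obtain ⟨M, rfl⟩ := Nat.exists_eq_succ_of_ne_zero h0.ne'
    exact ⟨M, hN⟩
  obtain ⟨M, hM⟩ := hpow a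
  obtain ⟨N, hN⟩ := hpow b
  have hΓ : Nonempty Γ := by
    rcases cases x with ⟨v, -⟩ | ⟨k, hk, γ, -⟩
    · exact ⟨v⟩
    · exact ⟨γ.toFun 0⟩
  have hcomm : (a ^ (M + 1) * a ^ (M + 1)) * (b ^ (N + 1) * b ^ (N + 1)) =
      (b ^ (N + 1) * b ^ (N + 1)) * (a ^ (M + 1) * a ^ (M + 1)) := by
    rcases cases x with ⟨v, rfl⟩ | ⟨k, hk, γ, rfl⟩
    · rw [smul_vertex] at hM
      rw [h.eq_one_of_smul_eq (Sum.inl.inj hM), mul_one, one_mul, mul_one]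
    · exact h.commute_of_sameTail (h.sameTail_of_smul_eq hk hM) (h.sameTail_of_smul_eq hk hN)
  -- If `c` commutes with a power of `d`, then `d` and its conjugate by `c` have this power in
  -- common, and roots are unique.
  have key : ∀ (c d : G) (k : ℕ), c * (d ^ (k + 1) * d ^ (k + 1)) =
      (d ^ (k + 1) * d ^ (k + 1)) * c → c * d = d * c := by
    intro c d k hc
    have h1 : (c * d * c⁻¹) ^ (k + 1 + k + 1) = d ^ (k + 1 + k + 1) := by
      rw [conj_pow, add_assoc (k + 1), pow_add, hc, mul_inv_cancel_right]
    exact mul_inv_eq_iff_eq_mul.1 (h.eq_of_pow_eq h1)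
  exact (key b a M (key _ b N hcomm).symm).symm

end

/-! ### Existence of choices -/

/-- The choices can be made if the tree is countable. -/
theorem nonempty_choices {n : ℕ} {Γ : Type*} {p : Γ → Γ → ZVec n} (h : IsZTree p) [Countable Γ]
    [Nonempty Γ] : Nonempty (Choices p) := by
  classical
  obtain ⟨f, hf⟩ := exists_injective_nat Γ
  let pt : Set Γ → Γ := fun S => if hS : S.Nonempty then hS.some else Classical.arbitrary Γ
  have hpt : ∀ k S, IsSubtree p k S → pt S ∈ S := fun k S hS => by
    have h1 := h.subtree_nonempty hS
    change dite _ _ _ ∈ S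
    rw [dif_pos h1]
    exact h1.some_mem
  exact ⟨{
    base := pt
    base_mem := hpt 1
    root := fun m T => subtreeOf p m (pt T)
    root_spec := fun m T _ _ hT =>
      ⟨isSubtree_subtreeOf _ _, h.subtreeOf_subset hT (hpt _ T hT)⟩
    index := fun _ S => f (pt S)
    index_injOn := fun m T k _ _ _ S hS S' hS' heq => by
      have h1 := hpt m S hS.1
      have h2 := hpt m S' hS'.1
      rw [hf heq] at h1
      exact h.subtree_eq hS.1 hS'.1 h1 h2 }⟩

end IsZTree

/-! ### Hyperbolicity and countability for the universal tree -/

namespace CDRGroup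

variable {n : ℕ} {X G : Type*} [Group G] (φ : CDRGroup n X G)

instance : Nonempty φ.UniversalTree := ⟨φ.orbitPoint 1⟩

instance [NeZero n] : HyperbolicAction G φ.dist where
  dist_smul := φ.dist_smul_smul
  dist_lt g hg x := by
    have : IsometricAction G φ.dist := ⟨φ.dist_smul_smul⟩
    by_contra hx
    have h1 := φ.isZTree.dist_smul_smul_le (not_lt.1 hx) (φ.orbitPoint 1)
    simp only [smul_eq_act, act_orbitPoint, dist_orbitPoint_orbitPoint] at h1
    rw [inv_one, one_mul, one_mul, mul_one, φ.len_mul] at h1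
    have h2 := φ.two_comLen_lt hg
    grind

theorem exists_between_smul_orbitPoint (x : φ.UniversalTree) : ∃ g : G,
    φ.dist (φ.orbitPoint 1) x + φ.dist x (g • φ.orbitPoint 1) =
      φ.dist (φ.orbitPoint 1) (g • φ.orbitPoint 1) := by
  obtain ⟨g, hg⟩ := φ.exists_between_orbitPoint x
  refine ⟨g, ?_⟩
  rwa [smul_eq_act, act_orbitPoint, mul_one]

theorem countable_of_fg (hG : Group.FG G) : Countable G := by
  obtain ⟨S, hS, f, hf⟩ := Group.fg_iff_exists_freeGroup_hom_surjective.1 hG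
  have := hS.countable.to_subtype
  exact hf.countable

theorem countable_universalTree (hG : Group.FG G) : Countable φ.UniversalTree := by
  have h1 := countable_of_fg hG
  have h2 : Countable (ZVec n) := inferInstanceAs (Countable (Fin n → ℤ))
  have h3 : Countable φ.Pairs := inferInstanceAs (Countable {q : ZVec n × G // _})
  exact Quotient.mk_surjective.countable (f := (Quotient.mk φ.pairsSetoid))

end CDRGroup

end

section

/-! ### Branches at a subtree -/

/-- The points `u` and `v` lie outside of the `ℤᵐ`-subtree of `s`, on the same branch. -/
def SameBranch {n : ℕ} {Γ : Type*} (p : Γ → Γ → ZVec n) (m : ℕ) (s u v : Γ) : Prop :=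
  p s u + p s v - p u v ∉ convexSub n m

namespace IsZTree

variable {n : ℕ} {Γ : Type*} {p : Γ → Γ → ZVec n} (h : IsZTree p) {m : ℕ} {s : Γ}
include h

theorem sameBranch_symm {u v : Γ} (hb : SameBranch p m s u v) : SameBranch p m s v u := by
  rwa [SameBranch, h.symm v u, add_comm (p s v)]

theorem not_mem_of_sameBranch {u v : Γ} (hb : SameBranch p m s u v) :
    p s u ∉ convexSub n m := fun h1 => by
  have h2 := h.triangle u v s
  have h3 := h.triangle s v u
  have h4 := h.triangle s u v
  have s1 := h.symm u s
  have s2 := h.symm u v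
  exact hb (ZVec.mem_convexSub_of_le (b := p s u + p s u) (by grind) (by grind) (add_mem h1 h1))

theorem sameBranch_self {u : Γ} (hu : p s u ∉ convexSub n m) : SameBranch p m s u u := by
  rw [SameBranch, h.self, sub_zero]
  exact fun h1 => hu (ZVec.mem_convexSub_of_add_self h1)

/-- By the four point condition, the Gromov product of `u` and `w` at `s` is at least the smaller of
the other two, neither of which lies in ℤᵐ. -/
theorem sameBranch_trans {u v w : Γ} (h1 : SameBranch p m s u v) (h2 : SameBranch p m s v w) :
    SameBranch p m s u w := fun h3 => by
  have h4 := h.four u w v s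
  have t1 := h.triangle u v s
  have t2 := h.triangle v w s
  have s1 := h.symm u s
  have s2 := h.symm v s
  have s3 := h.symm w s
  have s4 := h.symm w v
  rcases le_total (p s u + p s v - p u v) (p s v + p s w - p v w) with h5 | h5
  · exact h1 (ZVec.mem_convexSub_of_le (by grind) (by grind) h3)
  · exact h2 (ZVec.mem_convexSub_of_le (by grind) (by grind) h3)

theorem sameBranch_congr {s' u v : Γ} (hs : p s s' ∈ convexSub n m) :
    SameBranch p m s u v ↔ SameBranch p m s' u v := by
  have key : ∀ {s s'}, p s s' ∈ convexSub n m → SameBranch p m s u v →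
      SameBranch p m s' u v := fun {s s'} hs hb hb' => hb (by
    have h1 := add_mem hb' (add_mem (h.sub_dist_mem hs u) (h.sub_dist_mem hs v))
    convert h1 using 1
    abel)
  exact ⟨key hs, key (by rwa [h.symm])⟩

variable {G : Type*} [Group G] [MulAction G Γ]

/-- The setwise stabilizer of the `ℤᵐ`-subtree of `s`. -/
def levelStabilizer (h : IsZTree p) (G : Type*) [Group G] [MulAction G Γ] [IsometricAction G p]
    (m : ℕ) (s : Γ) : Subgroup G where
  carrier := {g | p s (g • s) ∈ convexSub n m}
  one_mem' := by
    change p s ((1 : G) • s) ∈ convexSub n m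
    rw [one_smul, h.self]
    exact zero_mem _
  mul_mem' {f g} hf hg := by
    have hg' : p s (g • s) ∈ convexSub n m := hg
    change p s ((f * g) • s) ∈ convexSub n m
    rw [← dist_smul_smul p f, ← mul_smul] at hg'
    exact h.mem_trans hf hg'
  inv_mem' {g} hg := by
    change p s (g⁻¹ • s) ∈ convexSub n m
    rw [← dist_smul_smul p g, smul_inv_smul, h.symm]
    exact hg

variable [IsometricAction G p]

theorem mem_levelStabilizer {g : G} :
    g ∈ h.levelStabilizer G m s ↔ p s (g • s) ∈ convexSub n m := Iff.rfl

theorem levelStabilizer_le : h.levelStabilizer G m s ≤ h.levelStabilizer G (m + 1) s :=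
  fun _ hg => ZVec.convexSub_mono m.le_succ hg

theorem sameBranch_smul_iff {g : G} (hg : g ∈ h.levelStabilizer G m s) {u v : Γ} :
    SameBranch p m s (g • u) (g • v) ↔ SameBranch p m s u v := by
  rw [h.sameBranch_congr hg]
  simp only [SameBranch, dist_smul_smul p]

theorem mul_inv_mem_levelStabilizer {f g : G} :
    f * g⁻¹ ∈ h.levelStabilizer G m s ↔ p (f⁻¹ • s) (g⁻¹ • s) ∈ convexSub n m := by
  rw [mem_levelStabilizer, ← dist_smul_smul p f (f⁻¹ • s) (g⁻¹ • s), smul_inv_smul, mul_smul]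

/-- Up to the stabilizer of the `ℤᵐ`-subtree of `s` there are only finitely many elements for
which the segment from `f s` to `f w` passes through this subtree. -/
theorem exists_finite_crossing {w : Γ} (hw : p s w ∈ convexSub n (m + 1)) (Q : G → Prop) :
    ∃ A : Set G, A.Finite ∧ (∀ a ∈ A, Q a) ∧ ∀ f ∈ h.levelStabilizer G (m + 1) s, Q f →
      ¬ SameBranch p m s (f • s) (f • w) → ∃ a ∈ A, f * a⁻¹ ∈ h.levelStabilizer G m s := by
  let B : Set G := {f | f ∈ h.levelStabilizer G (m + 1) s ∧ Q f ∧
    ¬ SameBranch p m s (f • s) (f • w)}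
  let j : G → ℤ := fun f => coord (p s (f • s)) m
  have hB : ∀ f ∈ B, p s (f • s) + p s (f • w) - p s w ∈ convexSub n m := fun f hf => by
    have := not_not.1 hf.2.2
    rwa [dist_smul_smul p] at this
  have hfin : (j '' B).Finite := by
    refine (Set.finite_Icc 0 (coord (p s w) m)).subset ?_
    rintro _ ⟨f, hf, rfl⟩
    have h1 := ZVec.coord_eq_zero (hB f hf)
    have h2 := ZVec.coord_nonneg (m := m) hf.1 (h.nonneg _ _)
    have h3 : p s (f • w) ∈ convexSub n (m + 1) :=
      h.mem_trans hf.1 (by rwa [dist_smul_smul p])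
    have h4 := ZVec.coord_nonneg h3 (h.nonneg _ _)
    rw [ZVec.coord_sub, ZVec.coord_add] at h1
    exact ⟨h2, show coord (p s (f • s)) m ≤ _ by omega⟩
  -- One representative for each value of `j` suffices: up to ℤᵐ, `f⁻¹ s` is the point of the
  -- segment from `s` to `w` at level `j f`.
  obtain ⟨A, hAB, hA⟩ := (Set.surjOn_image j B).exists_bijOn_subset
  refine ⟨A, hA.finite_iff_finite.2 hfin, fun a ha => (hAB ha).2.1, fun f hf hQ hb => ?_⟩
  obtain ⟨a, ha, haj⟩ := hA.surjOn ⟨f, ⟨hf, hQ, hb⟩, rfl⟩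
  refine ⟨a, ha, ?_⟩
  have c1 := hB f ⟨hf, hQ, hb⟩
  have c2 := hB a (hAB ha)
  have c3 : p s (a • s) - p s (f • s) ∈ convexSub n m := by
    refine ZVec.mem_convexSub_of_coord (sub_mem (hAB ha).1 hf) ?_
    rw [ZVec.coord_sub]
    exact sub_eq_zero.2 haj
  rw [mul_inv_mem_levelStabilizer]
  have h4 := h.four (f⁻¹ • s) (a⁻¹ • s) s w
  have e1 := dist_smul_smul p f (f⁻¹ • s) s
  have e2 := dist_smul_smul p f (f⁻¹ • s) w
  have e3 := dist_smul_smul p a (a⁻¹ • s) s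
  have e4 := dist_smul_smul p a (a⁻¹ • s) w
  rw [smul_inv_smul] at e1 e2 e3 e4
  rcases le_total (p (f⁻¹ • s) s + p (a⁻¹ • s) w) (p (f⁻¹ • s) w + p (a⁻¹ • s) s) with h5 | h5
  · exact ZVec.mem_convexSub_of_le (h.nonneg _ _) (by grind) (add_mem c1 c3)
  · exact ZVec.mem_convexSub_of_le (h.nonneg _ _) (by grind) (sub_mem c2 c3)

/-- There are only finitely many branches at the `ℤᵐ`-subtree of `s`, up to the action of its
stabilizer. -/
def BranchFinite (h : IsZTree p) (G : Type*) [Group G] [MulAction G Γ] [IsometricAction G p]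
    (m : ℕ) (s : Γ) : Prop :=
  ∃ F : Set Γ, F.Finite ∧ ∀ u, p s u ∉ convexSub n m →
    ∃ k ∈ h.levelStabilizer G m s, ∃ f ∈ F, SameBranch p m s u (k • f)

/-- Follow a word in the generators from `s` to `g s`. The last entry into the branch of `u` is by a
step from `x s` to `x t s` that crosses the ℤᵐ-subtree of `s`, and there are finitely many such
steps up to its stabilizer. -/
theorem exists_finite_branches_orbit (hfg : (h.levelStabilizer G (m + 1) s).FG) :
    ∃ F : Set Γ, F.Finite ∧ ∀ u, ∀ g ∈ h.levelStabilizer G (m + 1) s, SameBranch p m s u (g • s) →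
      ∃ k ∈ h.levelStabilizer G m s, ∃ f ∈ F, SameBranch p m s u (k • f) := by
  rw [Subgroup.fg_iff_submonoid_fg, Submonoid.fg_iff] at hfg
  obtain ⟨S, hS, hSfin⟩ := hfg
  have := hSfin.to_subtype
  have hSm : ∀ t ∈ S, t ∈ h.levelStabilizer G (m + 1) s := fun t ht => by
    have := Submonoid.subset_closure ht
    rw [hS] at this
    exact this
  choose A hA1 hA2 hA3 using fun t : S => h.exists_finite_crossing (s := s) (m := m)
    (w := t.1 • s) (hSm t t.2) fun _ : G => True
  refine ⟨⋃ t : S, (fun a : G => a • t.1 • s) '' A t, Set.finite_iUnion fun t => (hA1 t).image _,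
    fun u g hg => ?_⟩
  have hg' : g ∈ Submonoid.closure S := hS ▸ hg
  induction hg' using Submonoid.closure_induction_right with
  | one =>
    intro hb
    exact absurd (by rw [one_smul, h.self]; exact zero_mem _)
      (h.not_mem_of_sameBranch (h.sameBranch_symm hb))
  | mul_right x hx t ht ih =>
    have hx' : x ∈ h.levelStabilizer G (m + 1) s := by rw [hS] at hx; exact hx
    intro hb
    by_cases hbx : SameBranch p m s u (x • s)
    · exact ih hx' hbx
    rw [mul_smul] at hb
    obtain ⟨a, ha, hk⟩ := hA3 ⟨t, ht⟩ x hx' trivial fun hc =>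
      hbx (h.sameBranch_trans hb (h.sameBranch_symm hc))
    refine ⟨_, hk, a • t • s, Set.mem_iUnion.2 ⟨⟨t, ht⟩, a, ha, rfl⟩, ?_⟩
    rwa [← mul_smul (x * a⁻¹), inv_mul_cancel_right]

variable {ε : Γ}

/-- Each branch contains an orbit point of `ε`, hence, up to `H`, one of finitely many points.
Branches that meet `H s` are covered by `exists_finite_branches_orbit`; for the others, one element
of `H` for each of these points suffices. -/
theorem branchFinite_of_succ (hε : ∀ u, ∃ g : G, p ε u + p u (g • ε) = p ε (g • ε))
    (hfg : (h.levelStabilizer G (m + 1) s).FG) (hb : h.BranchFinite G (m + 1) s) :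
    h.BranchFinite G m s := by
  obtain ⟨F₀, hF₀, hF₀'⟩ := h.exists_finite_branches_orbit hfg
  obtain ⟨F₁, hF₁, hF₁'⟩ := hb
  set H := h.levelStabilizer G (m + 1) s with hH
  obtain ⟨u₀, hu₀⟩ : ∃ u₀ : Γ, ∀ g : G, p s (g • ε) ∈ convexSub n (m + 1) →
      ∃ f ∈ H, g • ε = f • u₀ := by
    by_cases hex : ∃ g : G, p s (g • ε) ∈ convexSub n (m + 1)
    · obtain ⟨g₀, hg₀⟩ := hex
      refine ⟨g₀ • ε, fun g hg => ⟨g * g₀⁻¹, ?_, ?_⟩⟩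
      · refine h.mem_trans hg ?_
        rw [← dist_smul_smul p (g * g₀⁻¹), ← mul_smul, inv_mul_cancel_right, h.symm] at hg₀
        exact hg₀
      · rw [← mul_smul, inv_mul_cancel_right]
    · exact ⟨ε, fun g hg => absurd ⟨g, hg⟩ hex⟩
  have hfar : ∀ u, p s u ∉ convexSub n m →
      ∃ f ∈ H, ∃ v ∈ insert u₀ F₁, SameBranch p m s u (f • v) := by
    intro u hu
    obtain ⟨g, hg⟩ : ∃ g : G, SameBranch p m s u (g • ε) := by
      obtain ⟨g, hg⟩ := hε u
      have h1 := h.dist_of_between (x := s) hg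
      have h2 := h.sameBranch_self hu
      have s1 := h.symm ε u
      have s2 := h.symm (g • ε) u
      rcases le_total (p s ε - p ε u) (p s (g • ε) - p u (g • ε)) with h3 | h3
      · refine ⟨g, fun h4 => h2 ?_⟩
        convert h4 using 1
        rw [h.self]
        grind
      · refine ⟨1, fun h4 => h2 ?_⟩
        rw [one_smul] at h4
        convert h4 using 1
        rw [h.self]
        grind
    by_cases hgT : p s (g • ε) ∈ convexSub n (m + 1)
    · obtain ⟨f, hf, hfu⟩ := hu₀ g hgT
      exact ⟨f, hf, u₀, Set.mem_insert _ _, hfu ▸ hg⟩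
    · obtain ⟨f, hf, v, hv, hfv⟩ := hF₁' _ hgT
      exact ⟨f, hf, v, Set.mem_insert_of_mem _ hv,
        h.sameBranch_trans hg fun h1 => hfv (ZVec.convexSub_mono m.le_succ h1)⟩
  let P : Γ → G → Prop := fun v f => f ∈ H ∧ ∀ g ∈ H, ¬ SameBranch p m s (f • v) (g • s)
  have hc : ∀ v, ∃ c : G, ∀ f, P v f → P v c := fun v => by
    by_cases hex : ∃ c, P v c
    · exact hex.imp fun c hc _ _ => hc
    · exact ⟨1, fun f hf => absurd ⟨f, hf⟩ hex⟩
  choose c hc using hc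
  refine ⟨F₀ ∪ (fun v => c v • v) '' insert u₀ F₁, hF₀.union ((hF₁.insert u₀).image _),
    fun u hu => ?_⟩
  by_cases hcase : ∃ g ∈ H, SameBranch p m s u (g • s)
  · obtain ⟨g, hg, hgu⟩ := hcase
    obtain ⟨k, hk, f, hf, hb⟩ := hF₀' u g hg hgu
    exact ⟨k, hk, f, Or.inl hf, hb⟩
  · obtain ⟨f, hf, v, hv, hfv⟩ := hfar u hu
    have hPf : P v f := ⟨hf, fun g hg hb => hcase ⟨g, hg, h.sameBranch_trans hfv hb⟩⟩
    obtain ⟨hcH, hPc⟩ := hc v f hPf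
    refine ⟨f * (c v)⁻¹, ?_, _, Or.inr ⟨v, hv, rfl⟩, by rwa [← mul_smul, inv_mul_cancel_right]⟩
    -- The ℤᵐ-subtree of `s` lies between `f v` and `f c⁻¹ s`, and between `c v` and `c f⁻¹ s`.
    -- Adding the two relations cancels `v` and leaves twice the distance of `f⁻¹ s` and `c⁻¹ s`.
    have h1 := not_not.1 (hPf.2 _ (H.mul_mem hf (H.inv_mem hcH)))
    have h2 := not_not.1 (hPc _ (H.mul_mem hcH (H.inv_mem hf)))
    rw [mul_inv_mem_levelStabilizer]
    refine ZVec.mem_convexSub_of_add_self ?_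
    convert add_mem h1 h2 using 1
    rw [mul_smul, mul_smul, dist_smul_smul p, dist_smul_smul p]
    have e1 := dist_smul_smul p f (f⁻¹ • s) v
    have e2 := dist_smul_smul p f (f⁻¹ • s) ((c v)⁻¹ • s)
    have e3 := dist_smul_smul p (c v) ((c v)⁻¹ • s) v
    have e4 := dist_smul_smul p (c v) ((c v)⁻¹ • s) (f⁻¹ • s)
    rw [smul_inv_smul] at e1 e2 e3 e4
    have s1 := h.symm v ((c v)⁻¹ • s)
    have s2 := h.symm v (f⁻¹ • s)
    have s3 := h.symm ((c v)⁻¹ • s) (f⁻¹ • s)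
    grind

end IsZTree

end

/-! ### Finite generation of stabilizers and local finiteness -/

section

theorem fg_of_injective_zVec {n : ℕ} {E : Type*} [Group E] (θ : E →* Multiplicative (ZVec n))
    (hθ : Function.Injective θ) : Group.FG E := by
  have h0 : Module.Finite ℤ (ZVec n) := by
    rw [Module.Finite.iff_addGroup_fg]
    exact Module.Finite.iff_addGroup_fg.1 (inferInstanceAs (Module.Finite ℤ (Fin n → ℤ)))
  have h1 : IsNoetherian ℤ (ZVec n) := isNoetherian_of_isNoetherianRing_of_finite ℤ _
  have h1' : IsNoetherian ℤ (Additive (Multiplicative (ZVec n))) := h1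
  have h2 : θ.range.FG := by
    rw [Subgroup.fg_iff_add_fg]
    exact (Submodule.fg_iff_addSubgroup_fg
      (AddSubgroup.toIntSubmodule (Subgroup.toAddSubgroup θ.range))).1 (IsNoetherian.noetherian _)
  have h3 : Group.FG θ.range := (Group.fg_iff_subgroup_fg _).2 h2
  exact Group.fg_of_surjective (f := (MonoidHom.ofInjective hθ).symm.toMonoidHom)
    (MonoidHom.ofInjective hθ).symm.surjective

namespace IsZTree

variable {n : ℕ} {Γ : Type*} {p : Γ → Γ → ZVec n} (h : IsZTree p) {m : ℕ} {s : Γ}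
variable {G : Type*} [Group G] [MulAction G Γ]
include h

/-- Points on the same branch define the same Busemann function on the `ℤᵐ`-subtree of `s`. -/
theorem busemann_eq {u v x y : Γ} (hb : SameBranch p m s u v) (hx : p s x ∈ convexSub n m)
    (hy : p s y ∈ convexSub n m) : p x u - p y u = p x v - p y v := by
  -- On one branch, `u` and `v` are so close to each other, compared with distances within the
  -- subtree, that in the four point condition the sum containing `p x y` is strictly the smallest;
  -- so the other two are equal.
  have key : ∀ {u v}, SameBranch p m s u v → p x y + p u v < p x u + p y v := by
    intro u v hb
    have h1 := h.triangle u v s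
    have h2 := h.symm u s
    have h4 : p u v - p s u - p s v + (p s u + p s v - p u v) = 0 := by abel
    have h5 := ZVec.lt_of_not_mem (by grind) hb (b := p x y + (p s u - p x u) + (p s v - p y v))
      (add_mem (add_mem (h.mem_trans (by rwa [h.symm]) hy) (h.sub_dist_mem hx u))
        (h.sub_dist_mem hy v))
    grind
  have h1 := key hb
  have h2 := key (h.sameBranch_symm hb)
  have h3 := h.four x u y v
  have h4 := h.four x v y u
  have s1 := h.symm u v
  have s2 := h.symm u y
  have s3 := h.symm v y
  grind

/-- The stabilizer of a branch at the `ℤᵐ`-subtree of `s`. -/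
def branchStabilizer (h : IsZTree p) (G : Type*) [Group G] [MulAction G Γ] [IsometricAction G p]
    (m : ℕ) (s f : Γ) : Subgroup G where
  carrier := {g | g ∈ h.levelStabilizer G m s ∧ ∀ u, SameBranch p m s u (g • f) ↔
    SameBranch p m s u f}
  one_mem' := ⟨one_mem _, fun u => by rw [one_smul]⟩
  mul_mem' {a b} ha hb := ⟨mul_mem ha.1 hb.1, fun u => by
    rw [← ha.2, mul_smul, ← h.sameBranch_smul_iff (inv_mem ha.1), inv_smul_smul, hb.2,
      ← h.sameBranch_smul_iff ha.1, smul_inv_smul]⟩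
  inv_mem' {a} ha := ⟨inv_mem ha.1, fun u => by
    rw [← h.sameBranch_smul_iff ha.1, smul_inv_smul, ← ha.2, h.sameBranch_smul_iff ha.1]⟩

variable [HyperbolicAction G p]

/-- The Busemann function of the branch turns displacement into a homomorphism to ℤⁿ. An element of
the kernel keeps `s`, `k s` and `k² s` at the same distance from `f`; then `k² s` is not farther
from `s` than `k s`, contrary to hyperbolicity. -/
theorem branchStabilizer_fg {f : Γ} (hf : p s f ∉ convexSub n m) :
    (h.branchStabilizer G m s f).FG := by
  rw [← Group.fg_iff_subgroup_fg]
  have hmem : ∀ k : h.branchStabilizer G m s f, p s (k.1 • s) ∈ convexSub n m := fun k => k.2.1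
  have hself := h.sameBranch_self hf
  have hs : p s s ∈ convexSub n m := by rw [h.self]; exact zero_mem _
  let θ : h.branchStabilizer G m s f →* Multiplicative (ZVec n) :=
    { toFun := fun k => Multiplicative.ofAdd (p (k.1 • s) f - p s f)
      map_one' := by simp
      map_mul' := fun k l => by
        rw [← ofAdd_add]
        congr 1
        have h1 := h.busemann_eq (((k⁻¹).2.2 _).2 hself |> h.sameBranch_symm) (hmem l) hs
        have h2 := dist_smul_smul p k.1 (l.1 • s) (k.1⁻¹ • f)
        have h3 := dist_smul_smul p k.1 s (k.1⁻¹ • f)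
        rw [smul_inv_smul] at h2 h3
        change p (l.1 • s) (k.1⁻¹ • f) - p s (k.1⁻¹ • f) = _ at h1
        rw [Subgroup.coe_mul, mul_smul]
        grind }
  refine fg_of_injective_zVec θ ((injective_iff_map_eq_one θ).2 fun k hk => ?_)
  have h1 : p (k.1 • s) f - p s f = 0 := hk
  have h2 : p ((k * k).1 • s) f - p s f = 0 := by
    have : θ (k * k) = 1 := by rw [map_mul, hk, mul_one]
    exact this
  by_contra hne
  have h3 := HyperbolicAction.dist_lt (p := p) k.1 (fun h' => hne (Subtype.ext h')) s
  rw [Subgroup.coe_mul, mul_smul] at h2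
  have h4 := h.four s (k.1 • k.1 • s) (k.1 • s) f
  have h5 := dist_smul_smul p k.1 s (k.1 • s)
  have s1 := h.symm (k.1 • k.1 • s) (k.1 • s)
  grind

/-- An argument of Reidemeister–Schreier type. Along a word in the generators of `H`, one records an
element of the stabilizer each time the orbit path meets or crosses the ℤᵐ-subtree. Up to the
stabilizers of finitely many branches, which are finitely generated, only finitely many recorded
elements occur. -/
theorem levelStabilizer_fg (hfg : (h.levelStabilizer G (m + 1) s).FG)
    (hb : h.BranchFinite G m s) : (h.levelStabilizer G m s).FG := by
  classical
  set H := h.levelStabilizer G (m + 1) s with hH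
  set K := h.levelStabilizer G m s with hK
  obtain ⟨F₀, hF₀, hbr₀⟩ := hb
  let F : Set Γ := {f | f ∈ F₀ ∧ p s f ∉ convexSub n m}
  have hbr : ∀ u, p s u ∉ convexSub n m → ∃ k ∈ K, ∃ f ∈ F, SameBranch p m s u (k • f) := by
    intro u hu
    obtain ⟨k, hk, f, hf, hkf⟩ := hbr₀ u hu
    refine ⟨k, hk, f, ⟨hf, fun hf' => ?_⟩, hkf⟩
    refine h.not_mem_of_sameBranch (h.sameBranch_symm hkf) (h.mem_trans hk ?_)
    rwa [dist_smul_smul p]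
  have := (hF₀.subset fun _ hf => hf.1 : F.Finite).to_subtype
  rw [Subgroup.fg_iff_submonoid_fg, Submonoid.fg_iff] at hfg
  obtain ⟨S, hS, hSfin⟩ := hfg
  have := hSfin.to_subtype
  have hSm : ∀ t ∈ S, t ∈ H := fun t ht => by
    have := Submonoid.subset_closure ht
    rw [hS] at this
    exact this
  have hκ : ∀ x : G, ∃ k ∈ K, (x ∈ K → k = x) ∧
      (x ∉ K → ∃ f ∈ F, SameBranch p m s (x • s) (k • f)) := fun x => by
    by_cases hx : x ∈ K
    · exact ⟨x, hx, fun _ => rfl, fun hx' => absurd hx hx'⟩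
    · obtain ⟨k, hk, hkf⟩ := hbr (x • s) hx
      exact ⟨k, hk, fun hx' => absurd hx' hx, fun _ => hkf⟩
  choose κ hκK hκ1 hκ2 using hκ
  choose A hA1 hA2 hA3 using fun (t : S) (f : F) => h.exists_finite_crossing (s := s) (m := m)
    (w := t.1 • s) (hSm t t.2) fun a : G => SameBranch p m s (a • s) f
  have hE : ∀ f : F, ∃ B : Set G, Subgroup.closure B = h.branchStabilizer G m s f ∧ B.Finite :=
    fun f => (Subgroup.fg_iff _).1 (h.branchStabilizer_fg f.2.2)
  choose B hB1 hB2 using hE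
  let D : Set G := (Set.range fun t : S => κ t) ∪
    ((⋃ t : S, ⋃ f : F, (fun a => κ (a * t)) '' A t f) ∪ ⋃ f : F, B f)
  have hD : D.Finite := (Set.finite_range _).union ((Set.finite_iUnion fun t =>
    Set.finite_iUnion fun f => (hA1 t f).image _).union (Set.finite_iUnion hB2))
  set K₀ := Subgroup.closure D
  have hK₀ : K₀ ≤ K := by
    rw [Subgroup.closure_le]
    rintro _ (⟨t, rfl⟩ | hd | hd)
    · exact hκK _
    · simp only [Set.mem_iUnion] at hd
      obtain ⟨t, f, a, -, rfl⟩ := hd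
      exact hκK _
    · simp only [Set.mem_iUnion] at hd
      obtain ⟨f, hf⟩ := hd
      have h1 : _ ∈ Subgroup.closure (B f) := Subgroup.subset_closure hf
      rw [hB1] at h1
      exact h1.1
  refine (Subgroup.fg_iff _).2 ⟨D, le_antisymm hK₀ fun k hk => ?_, hD⟩
  -- The invariant of a prefix `y`: if `y s` is in the subtree, then `y` is already in `K₀`;
  -- otherwise an element of `K₀` carries a representative branch to that of `y s`.
  let I : G → Prop := fun y => (y ∈ K → y ∈ K₀) ∧
    (y ∉ K → ∃ k ∈ K₀, ∃ f ∈ F, SameBranch p m s (y • s) (k • f))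
  have hI : ∀ x, κ x ∈ K₀ → ∀ k ∈ K₀, I (k * x) := by
    intro x hx k hk
    have hkK := hK₀ hk
    refine ⟨fun hkx => ?_, fun hkx => ?_⟩
    · rw [hκ1 x ((K.mul_mem_cancel_left hkK).1 hkx)] at hx
      exact mul_mem hk hx
    · obtain ⟨f, hf, hxf⟩ := hκ2 x fun hx => hkx (mul_mem hkK hx)
      refine ⟨k * κ x, mul_mem hk hx, f, hf, ?_⟩
      rwa [mul_smul, mul_smul, h.sameBranch_smul_iff hkK]
  have key : ∀ g ∈ Submonoid.closure S, I g := by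
    intro g hg
    induction hg using Submonoid.closure_induction_right with
    | one => exact ⟨fun _ => one_mem _, fun h1 => absurd (one_mem _) h1⟩
    | mul_right x hx t ht ih =>
      have hxH : x ∈ H := by rw [hS] at hx; exact hx
      by_cases hxK : x ∈ K
      · exact hI t (Subgroup.subset_closure (Or.inl ⟨⟨t, ht⟩, rfl⟩)) x (ih.1 hxK)
      obtain ⟨k, hk, f, hf, hkf⟩ := ih.2 hxK
      have hkK := hK₀ hk
      by_cases hb : SameBranch p m s (x • s) (x • t • s)
      · refine ⟨fun hxt => absurd hxt ?_, fun _ => ⟨k, hk, f, hf, ?_⟩⟩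
        · have h1 := h.not_mem_of_sameBranch (h.sameBranch_symm hb)
          rwa [← mul_smul] at h1
        · rw [mul_smul]
          exact h.sameBranch_trans (h.sameBranch_symm hb) hkf
      have hy : k⁻¹ * x ∈ H := mul_mem (inv_mem (h.levelStabilizer_le hkK)) hxH
      have hyf : SameBranch p m s ((k⁻¹ * x) • s) f := by
        rwa [← h.sameBranch_smul_iff hkK, ← mul_smul, mul_inv_cancel_left]
      obtain ⟨a, ha, hk'⟩ := hA3 ⟨t, ht⟩ ⟨f, hf⟩ (k⁻¹ * x) hy hyf (by
        rwa [← h.sameBranch_smul_iff hkK, ← mul_smul, ← mul_smul, mul_inv_cancel_left])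
      have haf := hA2 ⟨t, ht⟩ ⟨f, hf⟩ a ha
      -- Both `k⁻¹ x s` and `a s` are on the branch of `f`, so this element stabilizes the branch.
      -- Now `x t` is an element of `K₀` times `a t`, whose corrector `κ (a t)` is one of the
      -- generators.
      have hk₀ : k⁻¹ * x * a⁻¹ ∈ K₀ := by
        have h1 : k⁻¹ * x * a⁻¹ ∈ h.branchStabilizer G m s f := by
          refine ⟨hk', fun u => ?_⟩
          have h2 : SameBranch p m s f ((k⁻¹ * x * a⁻¹) • f) := by
            rw [← h.sameBranch_smul_iff hk', ← mul_smul, inv_mul_cancel_right] at haf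
            exact h.sameBranch_trans (h.sameBranch_symm hyf) haf
          exact ⟨fun h3 => h.sameBranch_trans h3 (h.sameBranch_symm h2),
            fun h3 => h.sameBranch_trans h3 h2⟩
        rw [← hB1 ⟨f, hf⟩] at h1
        exact Subgroup.closure_mono (fun b hb =>
          Or.inr (Or.inr (Set.mem_iUnion.2 ⟨⟨f, hf⟩, hb⟩))) h1
      have h1 := hI (a * t) (Subgroup.subset_closure (Or.inr (Or.inl (Set.mem_iUnion₂.2
        ⟨⟨t, ht⟩, ⟨f, hf⟩, a, ha, rfl⟩)))) _ (mul_mem hk hk₀)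
      convert h1 using 1
      group
  refine (key k ?_).1 hk
  rw [hS]
  exact h.levelStabilizer_le hk

variable {ε : Γ}

/-- The two properties descend together from `m = n`, where the stabilizer is `G` and there are no
branches: branch finiteness at `m` uses generation at `m + 1`, and generation at `m` uses branch
finiteness at `m`. -/
theorem branchFinite_and_fg (hε : ∀ u, ∃ g : G, p ε u + p u (g • ε) = p ε (g • ε))
    (hG : Group.FG G) (s : Γ) (m : ℕ) (hm : m ≤ n) :
    (h.levelStabilizer G m s).FG ∧ h.BranchFinite G m s := by
  refine Nat.decreasingInduction (motive := fun m _ => (h.levelStabilizer G m s).FG ∧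
    h.BranchFinite G m s) (fun m _ ih => ?_) ?_ hm
  · have := h.branchFinite_of_succ hε ih.1 ih.2
    exact ⟨h.levelStabilizer_fg ih.1 this, this⟩
  · refine ⟨?_, ∅, Set.finite_empty, fun u hu => absurd (ZVec.mem_convexSub_self _) hu⟩
    have : h.levelStabilizer G n s = ⊤ :=
      (Subgroup.eq_top_iff' _).2 fun g => h.mem_levelStabilizer.2 (ZVec.mem_convexSub_self _)
    rw [this]
    exact Group.fg_def.1 hG

/-- If a finitely generated group acts freely and hyperbolically on a tree that is spanned by an
orbit, then the `ℤ`-subtrees are locally finite. -/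
theorem zLocallyFinite_of_fg [NeZero n]
    (hε : ∀ u, ∃ g : G, p ε u + p u (g • ε) = p ε (g • ε)) (hG : Group.FG G) :
    ZLocallyFinite p := by
  intro s
  obtain ⟨-, F, hF, hF'⟩ := h.branchFinite_and_fg hε hG s 0 (Nat.zero_le n)
  have e0 := ZVec.e_pos (n := n)
  have hex : ∀ w ∈ {w | p s w = e n 0}, ∃ f ∈ F, SameBranch p 0 s w f := fun w hw => by
    obtain ⟨k, hk, f, hf, hb⟩ := hF' w (by
      rw [ZVec.mem_convexSub_zero, show p s w = _ from hw]
      exact e0.ne')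
    rw [h.mem_levelStabilizer, ZVec.mem_convexSub_zero] at hk
    rw [h.eq_one_of_smul_eq (h.eq_of hk).symm, one_smul] at hb
    exact ⟨f, hf, hb⟩
  choose! c hc hb using hex
  refine Set.Finite.of_finite_image (hF.subset (Set.image_subset_iff.2 hc)) ?_
  intro w hw w' hw' heq
  have h1 := h.sameBranch_trans (hb w hw) (heq ▸ h.sameBranch_symm (hb w' hw'))
  rw [SameBranch, ZVec.mem_convexSub_zero, show p s w = _ from hw, show p s w' = _ from hw'] at h1
  obtain ⟨r, hr⟩ := h.parity s w w'
  rw [show p s w = _ from hw, show p s w' = _ from hw'] at hr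
  have h2 := h.triangle w w' s
  have s1 := h.symm w s
  rw [show p s w = _ from hw, ] at s1
  -- On one branch, the Gromov product of the two neighbours at `s` is positive, so it is at least
  -- `e n 0`, which is the distance of each of them from `s`; so they coincide.
  have hr0 : 0 < r := by
    rw [show p s w' = _ from hw', s1] at h2
    grind
  have h3 := e_le_of_pos hr0
  have h4 := h.nonneg w w'
  exact h.eq_of (by grind)

end IsZTree

end

end ZnFree

/-! ### The main theorem -/

theorem mainTheorem7 (n : ℕ) (hn : 1 ≤ n) :
    (∀ (Γ : Type*) (p : Γ → Γ → ZnFree.ZVec n), ZnFree.IsLambdaTree p →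
      ZnFree.ZLocallyFinite p → ∀ D : ZnFree.Choices p,
        ∃ _ : MetricSpace (ZnFree.Compactification p),
          (∀ x y : ZnFree.Compactification p, dist x y = D.metric x y) ∧
            CompactSpace (ZnFree.Compactification p)) ∧
    (∀ (X G : Type*) [Group G] (φ : ZnFree.CDRGroup n X G), Group.FG G →
      (∃ a b : G, a * b ≠ b * a) →
        Nonempty (ZnFree.Choices φ.dist) ∧
        ∃ _ : MulAction G (ZnFree.Compactification φ.dist),
          (∀ (g : G) (v : φ.UniversalTree),
            g • (ZnFree.vertex v : ZnFree.Compactification φ.dist) =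
              ZnFree.vertex (φ.act g v)) ∧
          (∀ (g : G) (k : ℕ) (hk : k ∈ Set.Icc 1 n) (γ : ZnFree.Ray φ.dist k),
            ∃ γ' : ZnFree.Ray φ.dist k, (∀ c, γ'.toFun c = φ.act g (γ.toFun c)) ∧
              g • ZnFree.endOf hk γ = ZnFree.endOf hk γ') ∧
          (¬ ∃ x : ZnFree.Compactification φ.dist, ∀ g : G, g • x = x) ∧
          (∀ x : ZnFree.Compactification φ.dist, (MulAction.orbit G x).Infinite) ∧
          ∀ D : ZnFree.Choices φ.dist,
            ∃ _ : MetricSpace (ZnFree.Compactification φ.dist),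
              (∀ x y : ZnFree.Compactification φ.dist, dist x y = D.metric x y) ∧
                CompactSpace (ZnFree.Compactification φ.dist) ∧
                ∀ g : G, Continuous fun x : ZnFree.Compactification φ.dist => g • x) := by
  have : NeZero n := ⟨by omega⟩
  refine ⟨fun Γ p hT hf D => ?_, fun X G _ φ hG hab => ?_⟩
  · have h := hT.isZTree
    have := hT.nonempty
    exact ⟨h.metricSpace D, fun _ _ => rfl, h.compactSpace D hf⟩
  · have h := φ.isZTree
    have hf : ZnFree.ZLocallyFinite φ.dist :=
      h.zLocallyFinite_of_fg (G := G) φ.exists_between_smul_orbitPoint hG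
    have := φ.countable_universalTree hG
    refine ⟨h.nonempty_choices, inferInstance, fun _ _ => rfl,
      fun g k hk γ => ⟨γ.smul g, fun _ => rfl, rfl⟩, fun ⟨x, hx⟩ => ?_, h.orbit_infinite hab,
      fun D => ⟨h.metricSpace D, fun _ _ => rfl, h.compactSpace D hf, h.continuous_smul D hf⟩⟩
    refine h.orbit_infinite hab x ((Set.finite_singleton x).subset ?_)
    rintro _ ⟨g, rfl⟩
    exact hx g
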